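/- **Proposition 2.4 (Interior Hölder continuity).** Let $d\ge 1$, $0<\lambda\le\Lambda<\infty$, $a>0$, let $\Omega\subset\mathbb R^d$ be a bounded domain with $B_1\subset\Omega$, let $\Gamma\subset\Omega$ be a smooth hypersurface such that $\Omega\setminus\Gamma$ has exactly two connected components, both open, and put $\omega(x)=\operatorname{dist}(x,\Gamma)^a$. Let $f\in C(\overline\Omega)$ with $f\omega^{-1}\in L^d(\Omega)$, and let $p\ge 1$ satisfy $ap<1$ (so that the model function $|t|^{2-a}$ lies in $W^{2,p}_{loc}$). Let $\mathcal M^-(M)=\inf_{\lambda I\le A\le\Lambda I}\operatorname{tr}(AM)$ and $\mathcal M^+(M)=\sup_{\lambda I\le A\le\Lambda I}\operatorname{tr}(AM)$ ($A$ symmetric) be the Pucci operators. Write $u\in S^*(f)$ in $B_1$ if $u\in C(B_1)$ satisfies $$\omega\,\mathcal M^-(D^2u)\le |f|\quad\text{and}\quad \omega\,\mathcal M^+(D^2u)\ge -|f|\quad\text{in } B_1$$ in the $L^p$ viscosity sense, that is, for every continuous $\varphi\in W^{2,p}_{loc}(B_1)$ and $x_0\in B_1$: if $u-\varphi$ has a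 local minimum at $x_0$ then $$\operatorname*{ess\,lim\,inf}_{x\to x_0}\bigl(\omega(x)\mathcal M^-(D^2\varphi(x))-|f(x)|\bigr)\le 0,$$ and if $u-\varphi$ has a local maximum at $x_0$ then $$\operatorname*{ess\,lim\,sup}_{x\to x_0}\bigl(\omega(x)\mathcal M^+(D^2\varphi(x))+|f(x)|\bigr)\ge 0.$$ Then there exist $\alpha\in(0,1)$ and $C>0$, depending only on $d,\lambda,\Lambda$ and $\omega$ (that is, on $\Gamma$ and $a$), such that every $u\in S^*(f)$ in $B_1$ belongs to $C^\alpha(B_{1/2})$ and $$\|u\|_{C^\alpha(B_{1/2})}\le C\left(\|u\|_{L^\infty(B_1)}+\|f\omega^{-1}\|_{L^d(B_1)}\right),$$ where $\|u\|_{C^\alpha(B_{1/2})}=\sup_{B_{1/2}}|u|+\sup_{x\ne y\in B_{1/2}}\frac{|u(x)-u(y)|}{|x-y|^\alpha}$, and the right-hand side is $+\infty$ if $u$ is unbounded. -/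

import Mathlib

open MeasureTheory Set Filter Topology Metric
open scoped NNReal ENNReal

noncomputable section

namespace WeightedPucci

variable {d : ℕ}

/-- A smooth embedded hypersurface of `ℝ^d`: locally the zero set of a smooth function whose
differential does not vanish. -/
def IsSmoothHypersurface (Γ : Set (EuclideanSpace ℝ (Fin d))) : Prop :=
  ∀ x ∈ Γ, ∃ U : Set (EuclideanSpace ℝ (Fin d)), ∃ g : EuclideanSpace ℝ (Fin d) → ℝ,
    IsOpen U ∧ x ∈ U ∧ ContDiffOn ℝ ((⊤ : ℕ∞) : WithTop ℕ∞) g U ∧ (∀ y ∈ U, fderiv ℝ g y ≠ 0) ∧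
      Γ ∩ U = {y ∈ U | g y = 0}

/-- `Ω \ Γ` has exactly two connected components `V` and `W`, both open
(in particular `Γ` is relatively closed in `Ω`). -/
def DividesIntoTwo (Γ Ω : Set (EuclideanSpace ℝ (Fin d))) : Prop :=
  ∃ V W : Set (EuclideanSpace ℝ (Fin d)), IsOpen V ∧ IsOpen W ∧ IsConnected V ∧ IsConnected W ∧
    Disjoint V W ∧ V ∪ W = Ω \ Γ

/-- The weight `ω(x) = dist(x, Γ)^a`. -/
def weight (Γ : Set (EuclideanSpace ℝ (Fin d))) (a : ℝ) (x : EuclideanSpace ℝ (Fin d)) : ℝ :=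
  infDist x Γ ^ a

/-- Symmetric matrices with all eigenvalues in `[lam, Lam]`. -/
def ellipticMatrices (d : ℕ) (lam Lam : ℝ) : Set (Matrix (Fin d) (Fin d) ℝ) :=
  {A | (A - lam • (1 : Matrix (Fin d) (Fin d) ℝ)).PosSemidef ∧
    (Lam • (1 : Matrix (Fin d) (Fin d) ℝ) - A).PosSemidef}

/-- The minimal Pucci operator `M⁻(M) = inf tr(A M)` over `lam I ≤ A ≤ Lam I`. -/
def pucciInf (lam Lam : ℝ) (M : Matrix (Fin d) (Fin d) ℝ) : ℝ :=
  sInf ((fun A => (A * M).trace) '' ellipticMatrices d lam Lam)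

/-- The maximal Pucci operator `M⁺(M) = sup tr(A M)` over `lam I ≤ A ≤ Lam I`. -/
def pucciSup (lam Lam : ℝ) (M : Matrix (Fin d) (Fin d) ℝ) : ℝ :=
  sSup ((fun A => (A * M).trace) '' ellipticMatrices d lam Lam)

/-- `g` is the weak partial derivative of `φ` in the direction of the `i`-th coordinate on the open
set `U`, tested against `C_c^∞(U)`. -/
def IsWeakPartial (U : Set (EuclideanSpace ℝ (Fin d))) (i : Fin d)
    (φ g : EuclideanSpace ℝ (Fin d) → ℝ) : Prop :=
  ∀ ψ : EuclideanSpace ℝ (Fin d) → ℝ, ContDiff ℝ ((⊤ : ℕ∞) : WithTop ℕ∞) ψ →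
    HasCompactSupport ψ → tsupport ψ ⊆ U →
    ∫ x in U, φ x * fderiv ℝ ψ x (EuclideanSpace.single i 1) = - ∫ x in U, g x * ψ x

/-- `g ∈ L^p_loc(U)`. -/
def MemLpLoc (p : ℝ) (U : Set (EuclideanSpace ℝ (Fin d)))
    (g : EuclideanSpace ℝ (Fin d) → ℝ) : Prop :=
  ∀ K ⊆ U, IsCompact K → MemLp g (ENNReal.ofReal p) (volume.restrict K)

/-- `φ` is a continuous function in `W^{2,p}_loc(U)` with weak gradient `G` and weak Hessian `H`. -/
structure IsW2pLoc (p : ℝ) (U : Set (EuclideanSpace ℝ (Fin d)))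
    (φ : EuclideanSpace ℝ (Fin d) → ℝ) (G : Fin d → EuclideanSpace ℝ (Fin d) → ℝ)
    (H : EuclideanSpace ℝ (Fin d) → Matrix (Fin d) (Fin d) ℝ) : Prop where
  continuousOn : ContinuousOn φ U
  grad_memLp : ∀ i, MemLpLoc p U (G i)
  hess_memLp : ∀ i j, MemLpLoc p U (fun x => H x i j)
  grad_weak : ∀ i, IsWeakPartial U i φ (G i)
  hess_weak : ∀ i j, IsWeakPartial U j (G i) (fun x => H x i j)

/-- `ess lim inf` of `h` at `x₀` with respect to Lebesgue measure, as an extended real. -/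
def essLiminfAt (h : EuclideanSpace ℝ (Fin d) → ℝ) (x₀ : EuclideanSpace ℝ (Fin d)) : EReal :=
  liminf (fun x => (h x : EReal)) (𝓝 x₀ ⊓ ae volume)

/-- `ess lim sup` of `h` at `x₀` with respect to Lebesgue measure, as an extended real. -/
def essLimsupAt (h : EuclideanSpace ℝ (Fin d) → ℝ) (x₀ : EuclideanSpace ℝ (Fin d)) : EReal :=
  limsup (fun x => (h x : EReal)) (𝓝 x₀ ⊓ ae volume)

/-- `u ∈ C(U)` is an `L^p` viscosity subsolution of `F(D²u, x) = f` in the open set `U`. -/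
def IsLpViscositySubsolution (p : ℝ)
    (F : Matrix (Fin d) (Fin d) ℝ → EuclideanSpace ℝ (Fin d) → ℝ)
    (f : EuclideanSpace ℝ (Fin d) → ℝ) (U : Set (EuclideanSpace ℝ (Fin d)))
    (u : EuclideanSpace ℝ (Fin d) → ℝ) : Prop :=
  ContinuousOn u U ∧ ∀ φ G H, IsW2pLoc p U φ G H →
    ∀ x₀ ∈ U, IsLocalMax (fun x => u x - φ x) x₀ →
      0 ≤ essLimsupAt (fun x => F (H x) x - f x) x₀

/-- `u ∈ C(U)` is an `L^p` viscosity supersolution of `F(D²u, x) = f` in the open set `U`. -/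
def IsLpViscositySupersolution (p : ℝ)
    (F : Matrix (Fin d) (Fin d) ℝ → EuclideanSpace ℝ (Fin d) → ℝ)
    (f : EuclideanSpace ℝ (Fin d) → ℝ) (U : Set (EuclideanSpace ℝ (Fin d)))
    (u : EuclideanSpace ℝ (Fin d) → ℝ) : Prop :=
  ContinuousOn u U ∧ ∀ φ G H, IsW2pLoc p U φ G H →
    ∀ x₀ ∈ U, IsLocalMin (fun x => u x - φ x) x₀ →
      essLiminfAt (fun x => F (H x) x - f x) x₀ ≤ 0

/-- The class of `u` with `w M⁻(D²u) ≤ f` in `U` in the `L^p` viscosity sense. -/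
def SUpper (p lam Lam : ℝ) (w f : EuclideanSpace ℝ (Fin d) → ℝ)
    (U : Set (EuclideanSpace ℝ (Fin d))) : Set (EuclideanSpace ℝ (Fin d) → ℝ) :=
  {u | IsLpViscositySupersolution p (fun M x => w x * pucciInf lam Lam M) f U u}

/-- The class of `u` with `w M⁺(D²u) ≥ f` in `U` in the `L^p` viscosity sense. -/
def SLower (p lam Lam : ℝ) (w f : EuclideanSpace ℝ (Fin d) → ℝ)
    (U : Set (EuclideanSpace ℝ (Fin d))) : Set (EuclideanSpace ℝ (Fin d) → ℝ) :=
  {u | IsLpViscositySubsolution p (fun M x => w x * pucciSup lam Lam M) f U u}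

/-- The weighted Pucci class `S*(f)` in `U`. -/
def SStar (p lam Lam : ℝ) (w f : EuclideanSpace ℝ (Fin d) → ℝ)
    (U : Set (EuclideanSpace ℝ (Fin d))) : Set (EuclideanSpace ℝ (Fin d) → ℝ) :=
  SUpper p lam Lam w (fun x => |f x|) U ∩ SLower p lam Lam w (fun x => -|f x|) U

/-- The full Hölder norm `sup_s |u| + [u]_{C^α(s)}`, equal to `∞` when `u ∉ C^α(s)`. -/
def holderNormOn (α : ℝ≥0) (u : EuclideanSpace ℝ (Fin d) → ℝ)
    (s : Set (EuclideanSpace ℝ (Fin d))) : ℝ≥0∞ :=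
  (⨆ x ∈ s, ‖u x‖ₑ) + eHolderNorm α (s.domRestrict u)

end WeightedPucci

end

/-!
The weight degenerates on `Γ`, so the equation carries no ellipticity there. What saves the
estimate is that the class of test functions is rich: since `a p < 1`, it contains functions whose
Hessian blows up like `dist(·, Γ)⁻ᵃ`, which is exactly what the weight can be made to feel. Take
`g` with `Γ = {g = 0}` locally and `∇g ≠ 0`, a cut-off `χ`, and `F` with `F'' = |t|⁻ᵃ - δ⁻ᵃ` on
`|t| ≤ δ` and `F'' = 0` elsewhere. As `a < 1`, the functions `F'` and hence `ψ = χ · F(g)` are small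
for small `δ`, the Hessian of `ψ` is bounded below by a small negative multiple of the identity,
and `ω M⁻(D²ψ)` exceeds a constant of our choice near the zero set (`HasCorrections`,
`isW2pLoc_patch`). If `u` is in the class, then testing with `ψ` plus a quadratic polynomial shows
that `u - ψ` cannot be touched from below on `Γ` at all, and that off `Γ` it satisfies the uniformly
elliptic inequality `M⁻(D²(u - ψ)) ≤ |f| / ω + η` (`isApproxSuper_of_mem_SUpper`). The same holds
for `-u`. Thus the contact sets in the Krylov–Safonov theory never meet `Γ`, the right-hand side
enters only through `‖f / ω‖_{L^d}`, and the constants depend on `d` and `Λ / λ` only; moreover no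
trace of `ψ` remains in the limit `η → 0`.

The Krylov–Safonov theory is built for `IsPucciSuper`, whose right-hand side is only continuous on
the open set where touching is possible. The Alexandrov–Bakelman–Pucci estimate
(`exists_contact_set`) is obtained without convex envelopes or sup-convolutions: comparison with a
tilted quadratic polynomial shows directly that the slope of a supporting plane is a Lipschitz
function of the contact point, with local constant controlled by the right-hand side
(`norm_slope_sub_le`), so the measure of the set of slopes is at most the integral of the `d`-th
power of the latter. A barrier then gives the measure estimate `exists_measure_estimate`, the
growing ink-spots lemma `ink_spots` upgrades it to a lower bound for supersolutions that are large
on half of a ball (`exists_lower_bound_of_half`), and this yields decay of oscillation and the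
Hölder estimate `exists_holder_estimate`.
-/

/-! ### Slopes of supporting planes -/

namespace WeightedPucci

set_option maxHeartbeats 800000 in
/-- Two planes of slopes `p₀`, `p` that support `w` from below at `x₀` and `x`. The graph of `w`
lies above the wedge they form, so a quadratic polynomial of size `‖p - p₀‖ / r`, bent upwards in
the direction `p - p₀` only, touches `w` from below near `x₀`; the touching condition bounds it. -/
theorem norm_slope_sub_le {d : ℕ} {θ r G : ℝ} {V D : Set (EuclideanSpace ℝ (Fin d))}
    {g w : EuclideanSpace ℝ (Fin d) → ℝ} (hθ : 1 ≤ θ) (hw : ContinuousOn w D)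
    (htouch : ∀ x ∈ D, ∀ (p e : EuclideanSpace ℝ (Fin d)) (c : ℝ), 0 ≤ c →
      (∀ᶠ z in 𝓝 x, w x + inner ℝ p (z - x) + (inner ℝ e (z - x) ^ 2 - c * ‖z - x‖ ^ 2) ≤ w z) →
      x ∈ V ∧ ‖e‖ ^ 2 ≤ θ * c + g x)
    {x₀ x p₀ p : EuclideanSpace ℝ (Fin d)}
    (h0 : ∀ z ∈ D, w x₀ + inner ℝ p₀ (z - x₀) ≤ w z) (h1 : ∀ z ∈ D, w x + inner ℝ p (z - x) ≤ w z)
    (hr : 0 < r) (hxr : ‖x - x₀‖ ≤ r) (hx : x ∈ D) (hball : closedBall x₀ (5 * θ * r) ⊆ D)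
    (hG : ∀ z ∈ closedBall x₀ (5 * θ * r), z ∈ V → g z ≤ G) (hG0 : 0 ≤ G) :
    ‖p - p₀‖ ≤ 18 * r * G := by
  rcases eq_or_ne (p - p₀) 0 with hq | hq
  · rw [hq, norm_zero]; positivity
  have hqn : 0 < ‖p - p₀‖ := norm_pos_iff.2 hq
  set q := p - p₀ with hqdef
  set N : ℝ := 5 * θ * r with hN
  have hNr : 5 * r ≤ N := by nlinarith
  set e : EuclideanSpace ℝ (Fin d) := ‖q‖⁻¹ • q with he
  have hen : ‖e‖ = 1 := by rw [he, norm_smul, norm_inv, norm_norm, inv_mul_cancel₀ hqn.ne']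
  have heq : ∀ y, inner ℝ q y = ‖q‖ * inner ℝ e y := fun y => by
    rw [he, real_inner_smul_left, ← mul_assoc, mul_inv_cancel₀ hqn.ne', one_mul]
  -- With `t` the coordinate along `e`, the polynomial `P = α ((t + r)² - κ |z - x₀|²)` exceeds `W`
  -- at `x₀`. The factor `1 / 9` keeps it below the second plane on the face `t = 2 r`; `κ` makes it
  -- nonpositive on the sphere of radius `N`, while `θ κ = 1 / 2` keeps it a strict subsolution.
  set α : ℝ := ‖q‖ / (9 * r) with hα
  have hα0 : 0 < α := by positivity
  have hαr : 9 * r * α = ‖q‖ := by rw [hα]; field_simp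
  set κ : ℝ := 1 / (2 * θ) with hκ
  have hκ0 : 0 < κ := by positivity
  have hκθ : 2 * θ * κ = 1 := by rw [hκ]; field_simp
  have hκN : 9 * r ^ 2 ≤ κ * N ^ 2 := by
    have : κ * N ^ 2 = 25 / 2 * θ * r ^ 2 := by
      rw [hN]; linear_combination (25 / 2 * θ * r ^ 2) * hκθ
    rw [this]; nlinarith [sq_nonneg r]
  -- `W` is `w` minus the supporting plane at `x₀`
  set W : EuclideanSpace ℝ (Fin d) → ℝ := fun z => w z - w x₀ - inner ℝ p₀ (z - x₀) with hW
  have hW0 : ∀ z ∈ D, 0 ≤ W z := fun z hz => by have := h0 z hz; simp only [hW]; linarith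
  have hWl : ∀ z ∈ D, ‖q‖ * (inner ℝ e (z - x₀) - r) ≤ W z := fun z hz => by
    have a1 := h1 z hz
    have a2 := h0 x hx
    have a3 : inner ℝ p (z - x) = inner ℝ p₀ (z - x₀) - inner ℝ p₀ (x - x₀)
        + inner ℝ q (z - x₀) - inner ℝ q (x - x₀) := by
      rw [hqdef]; simp only [inner_sub_left, inner_sub_right]; ring
    have a4 : inner ℝ q (x - x₀) ≤ ‖q‖ * r :=
      (real_inner_le_norm _ _).trans (mul_le_mul_of_nonneg_left hxr hqn.le)
    simp only [hW]
    rw [heq] at a3 a4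
    rw [heq] at a3
    nlinarith
  have hx0D : x₀ ∈ D := hball (mem_closedBall_self (by linarith))
  set P : EuclideanSpace ℝ (Fin d) → ℝ :=
    fun z => α * ((inner ℝ e (z - x₀) + r) ^ 2 - κ * ‖z - x₀‖ ^ 2) with hP
  set S : Set (EuclideanSpace ℝ (Fin d)) :=
    closedBall x₀ N ∩ {z | -r ≤ inner ℝ e (z - x₀) ∧ inner ℝ e (z - x₀) ≤ 2 * r} with hS
  have hcont : Continuous fun z : EuclideanSpace ℝ (Fin d) => inner ℝ e (z - x₀) := by fun_prop
  have hScomp : IsCompact S := (isCompact_closedBall x₀ N).inter_right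
    ((isClosed_le continuous_const hcont).inter (isClosed_le hcont continuous_const))
  have hx0S : x₀ ∈ S := by
    refine ⟨mem_closedBall_self (by linarith), ?_⟩
    simp only [mem_ofPred_eq, sub_self, inner_zero_right]; constructor <;> linarith
  have hSD : S ⊆ D := fun z hz => hball hz.1
  have hPc : Continuous P := by simp only [hP]; fun_prop
  have hWc : ContinuousOn W D := by
    simp only [hW]
    exact (hw.sub continuousOn_const).sub (by fun_prop)
  obtain ⟨y, hyS, hymin⟩ := hScomp.exists_isMinOn ⟨x₀, hx0S⟩
    ((hWc.mono hSD).sub hPc.continuousOn)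
  have hyneg : W y - P y < 0 := by
    have h2 : W y - P y ≤ W x₀ - P x₀ := hymin hx0S
    have h3 : W x₀ - P x₀ = -(α * r ^ 2) := by simp [hW, hP]
    have := mul_pos hα0 (pow_pos hr 2)
    linarith
  have hyD := hSD hyS
  obtain ⟨hyb, hy1, hy2⟩ := hyS
  have hyb' : ‖y - x₀‖ ≤ N := by simpa [dist_eq_norm] using hyb
  set t := inner ℝ e (y - x₀) with ht
  have hWy := hW0 y hyD
  have hPy : P y = α * ((t + r) ^ 2 - κ * ‖y - x₀‖ ^ 2) := rfl
  have hPpos : 0 < (t + r) ^ 2 - κ * ‖y - x₀‖ ^ 2 := by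
    by_contra hcon
    push Not at hcon
    have := mul_nonpos_of_nonneg_of_nonpos hα0.le hcon
    linarith
  have hκy : 0 ≤ κ * ‖y - x₀‖ ^ 2 := by positivity
  have hi1 : ‖y - x₀‖ < N := by
    refine lt_of_le_of_ne hyb' fun h => ?_
    rw [h] at hPpos
    nlinarith
  have hi2 : -r < t := by
    refine lt_of_le_of_ne hy1 fun h => ?_
    rw [← h] at hPpos
    nlinarith
  have hi3 : t < 2 * r := by
    refine lt_of_le_of_ne hy2 fun h => ?_
    have b1 := hWl y hyD
    rw [← ht, h] at b1
    rw [h] at hPy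
    have : P y ≤ α * (9 * r ^ 2) := by
      rw [hPy]; exact mul_le_mul_of_nonneg_left (by nlinarith) hα0.le
    have : α * (9 * r ^ 2) = ‖q‖ * r := by rw [← hαr]; ring
    linarith
  have hnear : ∀ᶠ z in 𝓝 y, W y - P y ≤ W z - P z := by
    have o1 : ∀ᶠ z in 𝓝 y, ‖z - x₀‖ < N :=
      (continuous_id.sub continuous_const).norm.continuousAt.eventually_lt continuousAt_const hi1
    have o2 : ∀ᶠ z in 𝓝 y, -r < inner ℝ e (z - x₀) :=
      continuousAt_const.eventually_lt hcont.continuousAt hi2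
    have o3 : ∀ᶠ z in 𝓝 y, inner ℝ e (z - x₀) < 2 * r :=
      hcont.continuousAt.eventually_lt continuousAt_const hi3
    filter_upwards [o1, o2, o3] with z z1 z2 z3
    exact hymin ⟨by simpa [dist_eq_norm] using z1.le, z2.le, z3.le⟩
  obtain ⟨hyV, hbd⟩ := htouch y hyD (p₀ + (2 * α * (t + r)) • e - (2 * α * κ) • (y - x₀))
    (Real.sqrt α • e) (α * κ) (by positivity) (by
      filter_upwards [hnear] with z hz
      simp only [hW, hP] at hz
      have e1 : inner ℝ e (z - x₀) = t + inner ℝ e (z - y) := by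
        rw [ht, ← inner_add_right]; congr 1; abel
      have e2 : ‖z - x₀‖ ^ 2 = ‖y - x₀‖ ^ 2 + 2 * inner ℝ (y - x₀) (z - y) + ‖z - y‖ ^ 2 := by
        rw [← norm_add_sq_real]; congr 2; abel
      have e3 : inner ℝ p₀ (z - x₀) = inner ℝ p₀ (y - x₀) + inner ℝ p₀ (z - y) := by
        rw [← inner_add_right]; congr 1; abel
      rw [e1, e2, e3] at hz
      simp only [inner_sub_left, inner_add_left, real_inner_smul_left, mul_pow,
        Real.sq_sqrt hα0.le] at hz ⊢
      rw [← ht] at hz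
      nlinarith)
  have hgy := hG y (by simpa [dist_eq_norm] using hyb') hyV
  rw [norm_smul, hen, mul_one, Real.norm_eq_abs, sq_abs, Real.sq_sqrt hα0.le] at hbd
  have : θ * (α * κ) = α / 2 := by linear_combination (α / 2) * hκθ
  nlinarith

/-- A Lipschitz map expands Lebesgue measure at most by the `d`-th power of its constant. -/
theorem volume_image_le_of_lipschitzOnWith {d : ℕ} {K : ℝ≥0} {s : Set (EuclideanSpace ℝ (Fin d))}
    {T : EuclideanSpace ℝ (Fin d) → EuclideanSpace ℝ (Fin d)} (hT : LipschitzOnWith K T s) :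
    volume (T '' s) ≤ (K : ℝ≥0∞) ^ d * volume s := by
  have h := hT.hausdorffMeasure_image_le (d := (d : ℝ)) (by positivity)
  have hfr : Module.finrank ℝ (EuclideanSpace ℝ (Fin d)) = d := by simp
  have hH : Measure.IsAddHaarMeasure
      (Measure.hausdorffMeasure (d : ℝ) : Measure (EuclideanSpace ℝ (Fin d))) := by
    have := isAddHaarMeasure_hausdorffMeasure (E := EuclideanSpace ℝ (Fin d))
    rwa [hfr] at this
  have hv := Measure.isAddLeftInvariant_eq_smul (volume : Measure (EuclideanSpace ℝ (Fin d)))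
    (Measure.hausdorffMeasure (d : ℝ))
  rw [hv]
  simp only [Measure.smul_apply, ENNReal.smul_def, smul_eq_mul]
  rw [mul_left_comm]
  gcongr
  simpa using h

end WeightedPucci

/-! ### The Alexandrov–Bakelman–Pucci estimate -/

namespace WeightedPucci

/-- The measure of the slopes on a measurable piece of the contact set on which the slope map is
pointwise Lipschitz with a constant comparable to a given function. -/
theorem volume_image_le_lintegral {d : ℕ} {s : Set (EuclideanSpace ℝ (Fin d))}
    {T : EuclideanSpace ℝ (Fin d) → EuclideanSpace ℝ (Fin d)} {k : EuclideanSpace ℝ (Fin d) → ℝ}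
    (hs : MeasurableSet s) (hfin : volume s ≠ ∞)
    (hT : ∀ z ∈ s, ∀ x ∈ s, ∀ y ∈ s, ‖T y - T x‖ ≤ k z * ‖y - x‖) :
    volume (T '' s) ≤ ∫⁻ x in s, ENNReal.ofReal (k x) ^ d := by
  have key : ∀ z ∈ s, volume (T '' s) ≤ ENNReal.ofReal (k z) ^ d * volume s := fun z hz => by
    have hL : LipschitzOnWith (k z).toNNReal T s := by
      refine LipschitzOnWith.of_dist_le_mul fun x hx y hy => ?_
      rw [dist_eq_norm, dist_eq_norm]
      exact (hT z hz y hy x hx).trans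
        (mul_le_mul_of_nonneg_right (Real.le_coe_toNNReal _) (norm_nonneg _))
    exact volume_image_le_of_lipschitzOnWith hL
  rcases s.eq_empty_or_nonempty with rfl | ⟨z₀, hz₀⟩
  · simp
  rcases eq_or_ne (volume s) 0 with h0 | h0
  · have := key z₀ hz₀
    rw [h0, mul_zero] at this
    exact this.trans zero_le
  calc volume (T '' s) = volume (T '' s) / volume s * volume s :=
        (ENNReal.div_mul_cancel h0 hfin).symm
    _ = ∫⁻ _ in s, volume (T '' s) / volume s := by rw [setLIntegral_const]
    _ ≤ _ := by
      refine setLIntegral_mono' hs fun x hx => ?_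
      exact ENNReal.div_le_of_le_mul (key x hx)

/-- The Alexandrov–Bakelman–Pucci estimate in the form used here: if `w ≥ 0` on the sphere of
radius `R` and `w ≤ -1` somewhere inside, then every small slope is the slope of a plane supporting
`w` from below at a point of a compact set `A ⊆ {w < 0}`, and the slope map is locally Lipschitz on
`A` with constant controlled by `g`. -/
theorem exists_contact_set {d : ℕ} {θ R η : ℝ} {V : Set (EuclideanSpace ℝ (Fin d))}
    {g w : EuclideanSpace ℝ (Fin d) → ℝ} {z₀ x₁ : EuclideanSpace ℝ (Fin d)}
    (hθ : 1 ≤ θ) (hR : 0 < R) (hη : 0 < η)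
    (hV : IsOpen V) (hg : ContinuousOn g V) (hg0 : ∀ x ∈ V, 0 ≤ g x)
    (hw : ContinuousOn w (closedBall z₀ R))
    (htouch : ∀ x ∈ ball z₀ R, ∀ (p e : EuclideanSpace ℝ (Fin d)) (c : ℝ), 0 ≤ c →
      (∀ᶠ z in 𝓝 x, w x + inner ℝ p (z - x) + (inner ℝ e (z - x) ^ 2 - c * ‖z - x‖ ^ 2) ≤ w z) →
      x ∈ V ∧ ‖e‖ ^ 2 ≤ θ * c + g x)
    (hsph : ∀ x ∈ sphere z₀ R, 0 ≤ w x) (hx₁ : x₁ ∈ closedBall z₀ R) (hwx₁ : w x₁ ≤ -1) :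
    ∃ A : Set (EuclideanSpace ℝ (Fin d)), IsCompact A ∧ A ⊆ ball z₀ R ∩ V ∧ (∀ x ∈ A, w x < 0) ∧
      volume (closedBall (0 : EuclideanSpace ℝ (Fin d)) (1 / (4 * R))) ≤
        ∫⁻ x in A, ENNReal.ofReal (18 * (g x + 2 * η)) ^ d := by
  set B := closedBall z₀ R with hB
  set Q := closedBall (0 : EuclideanSpace ℝ (Fin d)) (1 / (4 * R)) with hQ
  have hBc : IsCompact B := isCompact_closedBall z₀ R
  set A : Set (EuclideanSpace ℝ (Fin d)) :=
    {x ∈ B | ∃ p ∈ Q, ∀ z ∈ B, w x + inner ℝ p (z - x) ≤ w z} with hA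
  have hsmall : ∀ p ∈ Q, ∀ x ∈ B, ∀ y ∈ B, |inner ℝ p (y - x)| ≤ 1 / 2 := by
    intro p hp x hx y hy
    have a1 : ‖p‖ ≤ 1 / (4 * R) := by simpa [hQ] using hp
    have a2 : ‖y - x‖ ≤ 2 * R := by
      rw [← dist_eq_norm]
      have := dist_triangle_right y x z₀
      have h1 : dist y z₀ ≤ R := hy
      have h2 : dist x z₀ ≤ R := hx
      linarith
    refine (abs_real_inner_le_norm _ _).trans ?_
    calc ‖p‖ * ‖y - x‖ ≤ 1 / (4 * R) * (2 * R) := by gcongr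
      _ = 1 / 2 := by field_simp; norm_num
  have hAneg : ∀ x ∈ A, w x < 0 := by
    rintro x ⟨hxB, p, hp, hpx⟩
    have := hpx x₁ hx₁
    have := abs_le.1 (hsmall p hp x hxB x₁ hx₁)
    linarith
  have hAB : A ⊆ ball z₀ R := by
    intro x hx
    have h1 : dist x z₀ ≤ R := hx.1
    refine lt_of_le_of_ne h1 fun h => ?_
    have := hsph x h
    have := hAneg x hx
    linarith
  have hAV : A ⊆ V := by
    rintro x hx
    obtain ⟨hxB, p, hp, hpx⟩ := id hx
    refine (htouch x (hAB hx) p 0 0 le_rfl ?_).1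
    filter_upwards [isOpen_ball.mem_nhds (hAB hx)] with z hz
    simpa using hpx z (ball_subset_closedBall hz)
  have hAc : IsCompact A := by
    -- `A` is the projection of a compact set of pairs (point, slope)
    have hcl : IsClosed {y : EuclideanSpace ℝ (Fin d) × EuclideanSpace ℝ (Fin d) |
        y ∈ B ×ˢ Q ∧ ∀ z ∈ B, w y.1 + inner ℝ y.2 (z - y.1) ≤ w z} := by
      have : {y : EuclideanSpace ℝ (Fin d) × EuclideanSpace ℝ (Fin d) |
        y ∈ B ×ˢ Q ∧ ∀ z ∈ B, w y.1 + inner ℝ y.2 (z - y.1) ≤ w z} =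
        (B ×ˢ Q) ∩ ⋂ z ∈ B, {y ∈ B ×ˢ Q | w y.1 + inner ℝ y.2 (z - y.1) ≤ w z} := by
        ext y
        simp only [mem_ofPred_eq, mem_inter_iff, mem_iInter]
        exact ⟨fun h => ⟨h.1, fun i hi => ⟨h.1, h.2 i hi⟩⟩,
          fun h => ⟨h.1, fun i hi => (h.2 i hi).2⟩⟩
      rw [this]
      have hcl0 : IsClosed (B ×ˢ Q) := isClosed_closedBall.prod isClosed_closedBall
      refine hcl0.inter (isClosed_biInter fun z _ => ?_)
      refine hcl0.isClosed_le ?_ continuousOn_const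
      refine (hw.comp continuous_fst.continuousOn fun y hy => hy.1).add ?_
      fun_prop
    have hK : IsCompact {y : EuclideanSpace ℝ (Fin d) × EuclideanSpace ℝ (Fin d) |
        y ∈ B ×ˢ Q ∧ ∀ z ∈ B, w y.1 + inner ℝ y.2 (z - y.1) ≤ w z} :=
      (hBc.prod (isCompact_closedBall _ _)).of_isClosed_subset hcl fun y hy => hy.1
    convert hK.image continuous_fst using 1
    ext x
    constructor
    · rintro ⟨hxB, p, hp, hpx⟩
      exact ⟨(x, p), ⟨⟨hxB, hp⟩, hpx⟩, rfl⟩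
    · rintro ⟨⟨x', p⟩, ⟨⟨hxB, hp⟩, hpx⟩, rfl⟩
      exact ⟨hxB, p, hp, hpx⟩
  refine ⟨A, hAc, subset_inter hAB hAV, hAneg, ?_⟩
  -- a uniform radius on which `g` oscillates by at most `η`
  have hWo : IsOpen (ball z₀ R ∩ V) := isOpen_ball.inter hV
  obtain ⟨δ, hδ, hδW⟩ := hAc.exists_cthickening_subset_open hWo (subset_inter hAB hAV)
  have hgu : UniformContinuousOn g (cthickening δ A) :=
    hAc.cthickening.uniformContinuousOn_of_continuous
      (hg.mono (hδW.trans inter_subset_right))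
  obtain ⟨δ', hδ', hgδ'⟩ := Metric.uniformContinuousOn_iff.1 hgu η hη
  set r₀ := min δ (δ' / 2) / (5 * θ) with hr₀
  have hr₀pos : 0 < r₀ := by positivity
  have hr₀1 : 5 * θ * r₀ ≤ δ := by
    rw [hr₀, mul_div_cancel₀ _ (by positivity)]; exact min_le_left _ _
  have hr₀2 : 5 * θ * r₀ < δ' := by
    rw [hr₀, mul_div_cancel₀ _ (by positivity)]
    exact lt_of_le_of_lt (min_le_right _ _) (by linarith)
  have hcb : ∀ x ∈ A, closedBall x (5 * θ * r₀) ⊆ cthickening δ A := fun x hx =>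
    (closedBall_subset_closedBall hr₀1).trans (closedBall_subset_cthickening hx δ)
  have hosc : ∀ x ∈ A, ∀ y ∈ closedBall x (5 * θ * r₀), |g y - g x| < η := fun x hx y hy => by
    rw [← Real.dist_eq]
    exact hgδ' y (hcb x hx hy) x (self_subset_cthickening A hx)
      (lt_of_le_of_lt hy hr₀2)
  choose! T hTQ hT using fun x (hx : x ∈ A) => hx.2
  have hball : ∀ z ∈ ball z₀ R, z ∈ B := fun z hz => ball_subset_closedBall hz
  have hlip : ∀ (x p x' p' : EuclideanSpace ℝ (Fin d)), x ∈ A → x' ∈ A →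
      (∀ z ∈ B, w x + inner ℝ p (z - x) ≤ w z) → (∀ z ∈ B, w x' + inner ℝ p' (z - x') ≤ w z) →
      ∀ r, 0 < r → r ≤ r₀ → ‖x' - x‖ ≤ r → ‖p' - p‖ ≤ 18 * r * (g x + η) := by
    intro x p x' p' hx hx' hp hp' r hr hrr hxx
    have hsub : closedBall x (5 * θ * r) ⊆ closedBall x (5 * θ * r₀) :=
      closedBall_subset_closedBall (by gcongr)
    refine norm_slope_sub_le hθ (hw.mono ball_subset_closedBall) htouch
      (fun z hz => hp z (hball z hz)) (fun z hz => hp' z (hball z hz)) hr hxx (hAB hx')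
      (hsub.trans ((hcb x hx).trans (hδW.trans inter_subset_left))) (fun z hz _ => ?_)
      (add_nonneg (hg0 x (hAV hx)) hη.le)
    have := abs_lt.1 (hosc x hx z (hsub hz))
    linarith
  -- letting `r → 0` in the slope estimate shows that the supporting plane at a point is unique
  have huniq : ∀ x ∈ A, ∀ p, (∀ z ∈ B, w x + inner ℝ p (z - x) ≤ w z) → p = T x := by
    intro x hx p hp
    have hlim : ∀ r, 0 < r → r ≤ r₀ → ‖p - T x‖ ≤ 18 * (g x + η) * r := fun r h1 h2 => by
      have := hlip x (T x) x p hx hx (hT x hx) hp r h1 h2 (by simpa using h1.le)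
      linarith
    have hten : Tendsto (fun r : ℝ => 18 * (g x + η) * r) (𝓝[>] 0) (𝓝 0) := by
      have : Tendsto (fun r : ℝ => 18 * (g x + η) * r) (𝓝 0) (𝓝 (18 * (g x + η) * 0)) :=
        (continuous_const.mul continuous_id).tendsto 0
      rw [mul_zero] at this
      exact this.mono_left nhdsWithin_le_nhds
    have hle : ‖p - T x‖ ≤ 0 := ge_of_tendsto hten (by
      filter_upwards [Ioc_mem_nhdsGT hr₀pos] with r hr
      exact hlim r hr.1 hr.2)
    exact sub_eq_zero.1 (norm_le_zero_iff.1 hle)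
  -- slide a plane of the given slope up until it touches `w`
  have hcover : Q ⊆ T '' A := by
    intro p hp
    have hne : B.Nonempty := ⟨x₁, hx₁⟩
    obtain ⟨x, hxB, hxm⟩ := hBc.exists_isMinOn hne
      (hw.sub (f := w) (g := fun z => inner ℝ p z) (by fun_prop))
    have hpx : ∀ z ∈ B, w x + inner ℝ p (z - x) ≤ w z := fun z hz => by
      have h : w x - inner ℝ p x ≤ w z - inner ℝ p z := hxm hz
      rw [inner_sub_right]; linarith
    have hxA : x ∈ A := ⟨hxB, p, hp, hpx⟩
    exact ⟨x, hxA, (huniq x hxA p hpx).symm⟩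
  have hpiece : ∀ S ⊆ A, MeasurableSet S → (∀ x ∈ S, ∀ y ∈ S, ‖y - x‖ ≤ r₀) →
      volume (T '' S) ≤ ∫⁻ x in S, ENNReal.ofReal (18 * (g x + 2 * η)) ^ d := by
    intro S hSA hSm hSd
    refine volume_image_le_lintegral hSm
      ((measure_mono (hSA.trans (hAB.trans ball_subset_closedBall))).trans_lt
        hBc.measure_lt_top).ne ?_
    intro z hz x hx y hy
    rcases eq_or_ne y x with rfl | hyx
    · simp
    have hpos : 0 < ‖y - x‖ := norm_pos_iff.2 (sub_ne_zero.2 hyx)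
    have h1 := hlip x (T x) y (T y) (hSA hx) (hSA hy) (hT x (hSA hx)) (hT y (hSA hy)) _ hpos
      (hSd x hx y hy) le_rfl
    have h2 := abs_lt.1 (hosc z (hSA hz) x (by
      rw [mem_closedBall, dist_eq_norm]
      refine (hSd z hz x hx).trans ?_
      nlinarith))
    nlinarith
  -- `A` is cut into finitely many measurable pieces of small diameter
  obtain ⟨t, ht⟩ := hAc.elim_nhds_subcover' (fun x _ => ball x (r₀ / 2))
    (fun x _ => ball_mem_nhds x (by positivity))
  have hfin : ∀ t : Finset A, volume (T '' (A ∩ ⋃ x ∈ t, ball (x : EuclideanSpace ℝ (Fin d))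
      (r₀ / 2))) ≤ ∫⁻ x in A ∩ ⋃ x ∈ t, ball (x : EuclideanSpace ℝ (Fin d)) (r₀ / 2),
        ENNReal.ofReal (18 * (g x + 2 * η)) ^ d := by
    classical
    intro t
    induction t using Finset.induction_on with
    | empty => simp
    | insert a t _ ih =>
      set U := ⋃ x ∈ t, ball (x : EuclideanSpace ℝ (Fin d)) (r₀ / 2) with hU
      have hUm : MeasurableSet U :=
        (isOpen_biUnion fun x _ => isOpen_ball).measurableSet
      have hsplit : A ∩ ⋃ x ∈ insert a t, ball (x : EuclideanSpace ℝ (Fin d)) (r₀ / 2) =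
          (A ∩ U) ∪ ((A ∩ ball (a : EuclideanSpace ℝ (Fin d)) (r₀ / 2)) \ U) := by
        rw [Finset.set_biUnion_insert]
        ext z
        simp only [mem_inter_iff, mem_union, Set.mem_sdiff]
        tauto
      have hm2 : MeasurableSet ((A ∩ ball (a : EuclideanSpace ℝ (Fin d)) (r₀ / 2)) \ U) :=
        (hAc.measurableSet.inter measurableSet_ball).diff hUm
      rw [hsplit, image_union, lintegral_union hm2
        (disjoint_left.2 fun z hz hz' => hz'.2 hz.2)]
      refine (measure_union_le _ _).trans (add_le_add ih (hpiece _ ?_ hm2 ?_))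
      · exact fun z hz => hz.1.1
      · intro x hx y hy
        have h1 : dist x a < r₀ / 2 := hx.1.2
        have h2 : dist y a < r₀ / 2 := hy.1.2
        rw [← dist_eq_norm]
        linarith [dist_triangle_right y x a]
  have hAt : A ∩ ⋃ x ∈ t, ball (x : EuclideanSpace ℝ (Fin d)) (r₀ / 2) = A :=
    inter_eq_left.2 ht
  have := hfin t
  rw [hAt] at this
  exact (measure_mono hcover).trans this

end WeightedPucci

/-! ### Viscosity supersolutions and the barrier -/

namespace WeightedPucci

/-- Viscosity supersolutions of the Pucci inequality `M⁻(D²v) ≤ g`, in matrix-free form. The test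
functions are the quadratic polynomials whose Hessian is a sum of two positive rank-one forms minus
`2c` times the identity; for those, `λ (‖e‖² + ‖e'‖²) - Λ d c` bounds half of `M⁻` from below, and
`θ` stands for `Λ d / λ`. The set `V` holds the points at which touching from below is possible at
all; `g` only matters on `V`. -/
structure IsPucciSuper {d : ℕ} (θ : ℝ) (V : Set (EuclideanSpace ℝ (Fin d)))
    (g : EuclideanSpace ℝ (Fin d) → ℝ) (U : Set (EuclideanSpace ℝ (Fin d)))
    (v : EuclideanSpace ℝ (Fin d) → ℝ) : Prop where
  continuousOn : ContinuousOn v U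
  touch : ∀ x ∈ U, ∀ (p e e' : EuclideanSpace ℝ (Fin d)) (c : ℝ), 0 ≤ c →
    (∀ᶠ z in 𝓝 x, v x + inner ℝ p (z - x) +
      (inner ℝ e (z - x) ^ 2 + inner ℝ e' (z - x) ^ 2 - c * ‖z - x‖ ^ 2) ≤ v z) →
    x ∈ V ∧ ‖e‖ ^ 2 + ‖e'‖ ^ 2 ≤ θ * c + g x

/-- Second-order lower Taylor bound for `u ↦ (1 + u)⁻ⁿ` at `0`. -/
theorem eventually_le_inv_one_add_pow (n : ℕ) (hn : 1 ≤ n) {ε : ℝ} (hε : 0 < ε) :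
    ∀ᶠ u : ℝ in 𝓝 0, 1 - n * u + (1 - ε) * (n * (n + 1) / 2) * u ^ 2 ≤ ((1 + u) ^ n)⁻¹ := by
  set f : ℝ → ℝ := fun u => (1 + u) ^ (-(n : ℤ)) -
    (1 - n * u + (1 - ε) * (n * (n + 1) / 2) * u ^ 2) with hf
  have hne : ∀ᶠ u : ℝ in 𝓝 0, 1 + u ≠ 0 := by
    have : Tendsto (fun u : ℝ => 1 + u) (𝓝 0) (𝓝 (1 + 0)) := (by fun_prop : Continuous _).tendsto 0
    exact this.eventually_ne (by norm_num)
  have hd1 : ∀ u : ℝ, 1 + u ≠ 0 → HasDerivAt f (-n * (1 + u) ^ (-(n : ℤ) - 1) -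
      (-n + (1 - ε) * (n * (n + 1)) * u)) u := by
    intro u hu
    have h1 : HasDerivAt (fun u : ℝ => (1 + u) ^ (-(n : ℤ)))
        (((-(n : ℤ) : ℤ) : ℝ) * (1 + u) ^ (-(n : ℤ) - 1) * 1) u :=
      (hasDerivAt_zpow (-(n : ℤ)) (1 + u) (Or.inl hu)).comp u ((hasDerivAt_id u).const_add 1)
    have h2 : HasDerivAt (fun u : ℝ => 1 - n * u + (1 - ε) * (n * (n + 1) / 2) * u ^ 2)
        (-(n * 1) + (1 - ε) * (n * (n + 1) / 2) * (2 * u)) u := by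
      have a := ((hasDerivAt_id u).const_mul (n : ℝ)).const_sub 1
      have b := (hasDerivAt_pow 2 u).const_mul ((1 - ε) * (n * (n + 1) / 2))
      exact (a.add b).congr_deriv (by norm_num)
    exact (h1.sub h2).congr_deriv (by push_cast; ring)
  have hder : deriv f =ᶠ[𝓝 0] fun u => -n * (1 + u) ^ (-(n : ℤ) - 1) -
      (-n + (1 - ε) * (n * (n + 1)) * u) := by
    filter_upwards [hne] with u hu using (hd1 u hu).deriv
  have hdd : deriv (deriv f) 0 = ε * (n * (n + 1)) := by
    rw [hder.deriv_eq]
    have h1 : HasDerivAt (fun u : ℝ => (1 + u) ^ (-(n : ℤ) - 1))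
        (((-(n : ℤ) - 1 : ℤ) : ℝ) * (1 + 0) ^ (-(n : ℤ) - 1 - 1) * 1) (0 : ℝ) :=
      (hasDerivAt_zpow (-(n : ℤ) - 1) (1 + (0 : ℝ)) (Or.inl (by norm_num))).comp 0
        ((hasDerivAt_id (0 : ℝ)).const_add 1)
    have h2 := ((hasDerivAt_id (0 : ℝ)).const_mul ((1 - ε) * (n * (n + 1)))).const_add (-(n : ℝ))
    have h3 := ((h1.const_mul (-(n : ℝ))).sub h2).deriv
    simp only [id] at h3
    refine Eq.trans ?_ (h3.trans ?_)
    · rfl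
    · push_cast; simp; ring
  have hd0 : deriv f 0 = 0 := by
    rw [(hd1 0 (by norm_num)).deriv]; simp
  have hn' : (0 : ℝ) < n := by exact_mod_cast hn
  have hmin := isLocalMin_of_deriv_deriv_pos (f := f) (x₀ := 0)
    (by rw [hdd]; positivity) hd0 (hd1 0 (by norm_num)).continuousAt
  filter_upwards [hmin] with u hu
  have hf0 : f 0 = 0 := by simp [hf]
  rw [hf0] at hu
  have : (1 + u) ^ (-(n : ℤ)) = ((1 + u) ^ n)⁻¹ := by rw [zpow_neg, zpow_natCast]
  simp only [hf, this] at hu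
  linarith

/-- The radial barrier `(1 + ‖x‖²)⁻ⁿ`. -/
noncomputable def barrier {d : ℕ} (n : ℕ) (x : EuclideanSpace ℝ (Fin d)) : ℝ :=
  ((1 + ‖x‖ ^ 2) ^ n)⁻¹

theorem continuous_barrier {d : ℕ} (n : ℕ) :
    Continuous (barrier n : EuclideanSpace ℝ (Fin d) → ℝ) := by
  unfold barrier
  exact Continuous.inv₀ (by fun_prop) fun x => by positivity

/-- Second-order lower Taylor bound for the barrier. -/
theorem eventually_le_barrier {d : ℕ} (n : ℕ) (hn : 1 ≤ n) {ε : ℝ} (hε : 0 < ε) (hε1 : ε < 1)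
    (x₀ : EuclideanSpace ℝ (Fin d)) :
    ∀ᶠ y in 𝓝 x₀, barrier n x₀ + inner ℝ ((-(2 * n * barrier (n + 1) x₀)) • x₀) (y - x₀) +
      ((1 - ε) * (2 * n * (n + 1)) * barrier (n + 2) x₀ * inner ℝ x₀ (y - x₀) ^ 2 -
        (n * barrier (n + 1) x₀ + ε) * ‖y - x₀‖ ^ 2) ≤ barrier n y := by
  set q : ℝ := 1 + ‖x₀‖ ^ 2 with hq
  have hq0 : 0 < q := by positivity
  set c : ℝ := (1 - ε) * (n * (n + 1) / 2) * barrier (n + 2) x₀ * (4 * ‖x₀‖) with hc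
  have hb2 : 0 ≤ barrier (n + 2) x₀ := by unfold barrier; positivity
  have hε' : 0 ≤ 1 - ε := by linarith
  have hc0 : 0 ≤ c := by positivity
  have t1 : Tendsto (fun y => (2 * inner ℝ x₀ (y - x₀) + ‖y - x₀‖ ^ 2) / q) (𝓝 x₀) (𝓝 0) := by
    have : Continuous fun y : EuclideanSpace ℝ (Fin d) =>
      (2 * inner ℝ x₀ (y - x₀) + ‖y - x₀‖ ^ 2) / q := by fun_prop
    simpa using this.tendsto x₀
  have t2 : Tendsto (fun y => c * ‖y - x₀‖) (𝓝 x₀) (𝓝 0) := by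
    have : Continuous fun y : EuclideanSpace ℝ (Fin d) => c * ‖y - x₀‖ := by fun_prop
    simpa using this.tendsto x₀
  filter_upwards [t1.eventually (eventually_le_inv_one_add_pow n hn hε),
    t2.eventually_lt_const hε] with y hy hy2
  set z := y - x₀ with hz
  set s := inner ℝ x₀ z with hs
  set u := (2 * s + ‖z‖ ^ 2) / q with hu
  have hyq : 1 + ‖y‖ ^ 2 = q * (1 + u) := by
    have : y = x₀ + z := by rw [hz]; abel
    rw [this, norm_add_sq_real, hu]
    field_simp
    ring
  have hby : barrier n y = barrier n x₀ * ((1 + u) ^ n)⁻¹ := by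
    unfold barrier; rw [hyq, mul_pow, mul_inv]
  have hb : barrier n x₀ = barrier (n + 2) x₀ * q ^ 2 := by
    unfold barrier; rw [pow_add, mul_inv, mul_assoc, inv_mul_cancel₀ (by positivity), mul_one]
  have hb' : barrier (n + 1) x₀ = barrier (n + 2) x₀ * q := by
    unfold barrier
    rw [pow_succ _ (n + 1), mul_inv, mul_assoc, inv_mul_cancel₀ (by positivity), mul_one]
  have huq : q * u = 2 * s + ‖z‖ ^ 2 := by rw [hu]; field_simp
  have hs3 : -(‖x₀‖ * ‖z‖) ≤ s := (abs_le.1 (abs_real_inner_le_norm x₀ z)).1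
  have h4 : 4 * s ^ 2 - 4 * ‖x₀‖ * ‖z‖ * ‖z‖ ^ 2 ≤ (q * u) ^ 2 := by
    rw [huq]; nlinarith [sq_nonneg ‖z‖, sq_nonneg (‖z‖ ^ 2)]
  have hmul := mul_le_mul_of_nonneg_left hy
    (by unfold barrier; positivity : 0 ≤ barrier n x₀)
  rw [← hby] at hmul
  refine le_trans ?_ hmul
  rw [real_inner_smul_left, ← hs, hb, hb']
  have h5 := mul_le_mul_of_nonneg_left h4
    (by positivity : 0 ≤ (1 - ε) * (n * (n + 1) / 2) * barrier (n + 2) x₀)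
  have h6 : c * ‖z‖ * ‖z‖ ^ 2 ≤ ε * ‖z‖ ^ 2 := mul_le_mul_of_nonneg_right hy2.le (by positivity)
  have h7 : barrier (n + 2) x₀ * q ^ 2 * (1 - n * u + (1 - ε) * (n * (n + 1) / 2) * u ^ 2) =
      barrier (n + 2) x₀ * q ^ 2 - n * (barrier (n + 2) x₀ * q) * (q * u) +
      (1 - ε) * (n * (n + 1) / 2) * barrier (n + 2) x₀ * (q * u) ^ 2 := by ring
  rw [h7]
  have h8 : n * (barrier (n + 2) x₀ * q) * (q * u) = n * (barrier (n + 2) x₀ * q) * (2 * s) +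
      n * (barrier (n + 2) x₀ * q) * ‖z‖ ^ 2 := by rw [huq]; ring
  rw [h8]
  rw [hc] at h6
  nlinarith

/-- Subtracting the barrier keeps the touching condition, at the cost of a right-hand side that
lives in the unit ball, provided `θ ≤ n + 1`. -/
theorem IsPucciSuper.sub_barrier {d : ℕ} {θ : ℝ} {V U : Set (EuclideanSpace ℝ (Fin d))}
    {g v : EuclideanSpace ℝ (Fin d) → ℝ} (hv : IsPucciSuper θ V g U v) {n : ℕ} (hn : 1 ≤ n)
    {M : ℝ} (hM : 0 ≤ M) (C : ℝ) :
    ∀ x ∈ U, ∀ (p e : EuclideanSpace ℝ (Fin d)) (c : ℝ), 0 ≤ c →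
      (∀ᶠ z in 𝓝 x, (v x - M * barrier n x + C) + inner ℝ p (z - x) +
        (inner ℝ e (z - x) ^ 2 - c * ‖z - x‖ ^ 2) ≤ v z - M * barrier n z + C) →
      x ∈ V ∧ ‖e‖ ^ 2 ≤ θ * c +
        (g x + M * n * max 0 (θ * (1 + ‖x‖ ^ 2) - 2 * (n + 1) * ‖x‖ ^ 2)) := by
  intro x hx p e c hc htouch
  set b := barrier (n + 2) x with hb
  have hb0 : 0 ≤ b := by rw [hb]; unfold barrier; positivity
  have hb1 : b ≤ 1 := by
    rw [hb]; unfold barrier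
    exact inv_le_one_of_one_le₀ (one_le_pow₀ (by nlinarith [sq_nonneg ‖x‖]))
  have hbq : barrier (n + 1) x = b * (1 + ‖x‖ ^ 2) := by
    rw [hb]; unfold barrier
    rw [pow_succ _ (n + 1), mul_inv, mul_assoc, inv_mul_cancel₀ (by positivity), mul_one]
  have hbq0 : 0 ≤ barrier (n + 1) x := by rw [hbq]; positivity
  have main : ∀ ε : ℝ, 0 < ε → ε < 1 → x ∈ V ∧
      ‖e‖ ^ 2 + M * ((1 - ε) * (2 * n * (n + 1)) * b) * ‖x‖ ^ 2 ≤
        θ * (c + M * (n * barrier (n + 1) x + ε)) + g x := by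
    intro ε hε hε1
    have hk : 0 ≤ M * ((1 - ε) * (2 * n * (n + 1)) * b) := by
      have : 0 ≤ 1 - ε := by linarith
      positivity
    have := hv.touch x hx (p + M • ((-(2 * n * barrier (n + 1) x)) • x)) e
      (Real.sqrt (M * ((1 - ε) * (2 * n * (n + 1)) * b)) • x)
      (c + M * (n * barrier (n + 1) x + ε)) (by positivity) (by
        filter_upwards [htouch, eventually_le_barrier n hn hε hε1 x] with z h1 h2
        have h3 := mul_le_mul_of_nonneg_left h2 hM
        rw [inner_add_left, real_inner_smul_left _ _ M,
          real_inner_smul_left _ _ (Real.sqrt _), mul_pow, Real.sq_sqrt hk]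
        rw [← hb] at h3
        nlinarith)
    rwa [norm_smul, mul_pow, Real.norm_eq_abs, sq_abs, Real.sq_sqrt hk] at this
  refine ⟨(main (1 / 2) (by norm_num) (by norm_num)).1, ?_⟩
  -- let `ε` tend to `0`
  have hlim : ‖e‖ ^ 2 + M * ((1 - 0) * (2 * n * (n + 1)) * b) * ‖x‖ ^ 2 ≤
      θ * (c + M * (n * barrier (n + 1) x + 0)) + g x := by
    have c1 : Tendsto (fun ε : ℝ => ‖e‖ ^ 2 + M * ((1 - ε) * (2 * n * (n + 1)) * b) * ‖x‖ ^ 2)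
        (𝓝[>] 0) (𝓝 (‖e‖ ^ 2 + M * ((1 - 0) * (2 * n * (n + 1)) * b) * ‖x‖ ^ 2)) :=
      ((by fun_prop : Continuous fun ε : ℝ =>
        ‖e‖ ^ 2 + M * ((1 - ε) * (2 * n * (n + 1)) * b) * ‖x‖ ^ 2).tendsto 0).mono_left
        nhdsWithin_le_nhds
    have c2 : Tendsto (fun ε : ℝ => θ * (c + M * (n * barrier (n + 1) x + ε)) + g x)
        (𝓝[>] 0) (𝓝 (θ * (c + M * (n * barrier (n + 1) x + 0)) + g x)) :=
      ((by fun_prop : Continuous fun ε : ℝ =>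
        θ * (c + M * (n * barrier (n + 1) x + ε)) + g x).tendsto 0).mono_left nhdsWithin_le_nhds
    refine le_of_tendsto_of_tendsto c1 c2 ?_
    filter_upwards [Ioo_mem_nhdsGT (zero_lt_one' ℝ)] with ε hε
    exact (main ε hε.1 hε.2).2
  rw [hbq] at hlim
  set m := max 0 (θ * (1 + ‖x‖ ^ 2) - 2 * (n + 1) * ‖x‖ ^ 2) with hm
  have m1 : θ * (1 + ‖x‖ ^ 2) - 2 * (n + 1) * ‖x‖ ^ 2 ≤ m := le_max_right _ _
  have m0 : 0 ≤ m := le_max_left _ _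
  have hMn : 0 ≤ M * n := by positivity
  have k1 := mul_le_mul_of_nonneg_left m1 (mul_nonneg hMn hb0)
  have k2 := mul_le_mul_of_nonneg_left hb1 (mul_nonneg hMn m0)
  nlinarith

end WeightedPucci

/-! ### The measure estimate -/

open scoped Pointwise

namespace WeightedPucci

/-- The basic measure estimate at unit scale: a nonnegative supersolution that is at most `1`
somewhere in the ball of radius `3` is bounded by `M` on a fixed proportion of the unit ball. -/
theorem exists_measure_estimate_unit {d : ℕ} (hd : 1 ≤ d) {θ : ℝ} (hθ : 1 ≤ θ) :
    ∃ ε M μ : ℝ, 0 < ε ∧ 1 < M ∧ 0 < μ ∧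
      ∀ (V U : Set (EuclideanSpace ℝ (Fin d))) (g v : EuclideanSpace ℝ (Fin d) → ℝ),
        IsPucciSuper θ V g U v → IsOpen V → ContinuousOn g V → (∀ x, 0 ≤ g x) →
        closedBall 0 4 ⊆ U → (∀ x ∈ closedBall 0 4, 0 ≤ v x) →
        (∃ x ∈ closedBall 0 3, v x ≤ 1) →
        ∫⁻ x in closedBall 0 4, ENNReal.ofReal (g x) ^ d ≤ ENNReal.ofReal ε ^ d →
        ENNReal.ofReal μ * volume (closedBall (0 : EuclideanSpace ℝ (Fin d)) 1) ≤
          volume (closedBall (0 : EuclideanSpace ℝ (Fin d)) 1 ∩ {x | v x ≤ M}) := by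
  obtain ⟨n, hn⟩ := exists_nat_ge θ
  have hn1 : 1 ≤ n := by exact_mod_cast hθ.trans hn
  set b : ℝ := (volume (closedBall (0 : EuclideanSpace ℝ (Fin d)) (1 / (4 * 4)))).toReal with hb
  have hbfin : volume (closedBall (0 : EuclideanSpace ℝ (Fin d)) (1 / (4 * 4))) ≠ ∞ :=
    measure_closedBall_lt_top.ne
  have hbpos : 0 < b := ENNReal.toReal_pos (measure_closedBall_pos _ _ (by norm_num)).ne' hbfin
  set v₁ : ℝ := (volume (closedBall (0 : EuclideanSpace ℝ (Fin d)) 1)).toReal with hv₁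
  have hv₁fin : volume (closedBall (0 : EuclideanSpace ℝ (Fin d)) 1) ≠ ∞ :=
    measure_closedBall_lt_top.ne
  have hv₁pos : 0 < v₁ := ENNReal.toReal_pos (measure_closedBall_pos _ _ (by norm_num)).ne' hv₁fin
  set v₄ : ℝ := (volume (closedBall (0 : EuclideanSpace ℝ (Fin d)) 4)).toReal with hv₄
  have hv₄fin : volume (closedBall (0 : EuclideanSpace ℝ (Fin d)) 4) ≠ ∞ :=
    measure_closedBall_lt_top.ne
  have hv₄0 : 0 ≤ v₄ := ENNReal.toReal_nonneg
  -- The barrier is at least `10⁻ⁿ` on the ball of radius `3` and equal to `17⁻ⁿ` on the sphere of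
  -- radius `4`. With `M D = 2` and the constant `C` below, `w = v - M barrier + C` is nonnegative on
  -- that sphere and at most `-1` at `x₁`.
  set D : ℝ := ((10 : ℝ) ^ n)⁻¹ - ((17 : ℝ) ^ n)⁻¹ with hD
  have hDpos : 0 < D := by
    rw [hD, sub_pos]
    exact inv_strictAnti₀ (by positivity) (pow_lt_pow_left₀ (by norm_num) (by norm_num) (by omega))
  have hD1 : D < 1 := by
    have : ((10 : ℝ) ^ n)⁻¹ ≤ 1 := inv_le_one_of_one_le₀ (one_le_pow₀ (by norm_num))
    have : 0 < ((17 : ℝ) ^ n)⁻¹ := by positivity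
    linarith
  set M : ℝ := 2 / D with hM
  have hM1 : 1 < M := by rw [hM, lt_div_iff₀ hDpos]; linarith
  have hMD : M * D = 2 := by rw [hM]; field_simp
  -- every `t ∈ [0, 1]` satisfies `t ^ d ≤ t`, so small bases suffice for small powers
  have hpow : ∀ t : ℝ, 0 ≤ t → t ≤ 1 → t ^ d ≤ t := fun t h0 h1 =>
    pow_le_of_le_one h0 h1 (by omega)
  set τ : ℝ := min 1 (b / 4) with hτ
  have hτ0 : 0 < τ := by positivity
  set σ : ℝ := min 1 (b / (4 * (v₄ + 1))) with hσ
  have hσ0 : 0 < σ := by positivity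
  set K : ℝ := (54 * (M * n * θ)) ^ d with hK
  have hK0 : 0 < K := by positivity
  refine ⟨τ / 54, M, b / (2 * K * v₁), by positivity, hM1, by positivity, ?_⟩
  intro V U g v hv hV hg hg0 hU hv0 ⟨x₁, hx₁, hvx₁⟩ hint
  set C : ℝ := M * ((17 : ℝ) ^ n)⁻¹ with hC
  set w : EuclideanSpace ℝ (Fin d) → ℝ := fun x => v x - M * barrier n x + C with hw
  set ξ : EuclideanSpace ℝ (Fin d) → ℝ :=
    fun x => M * n * max 0 (θ * (1 + ‖x‖ ^ 2) - 2 * (n + 1) * ‖x‖ ^ 2) with hξ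
  have hξc : Continuous ξ := by simp only [hξ]; fun_prop
  have hξ0 : ∀ x, 0 ≤ ξ x := fun x => by simp only [hξ]; positivity
  have hξ1 : ∀ x, ξ x ≤ (closedBall 0 1).indicator (fun _ => M * n * θ) x := fun x => by
    by_cases hx : x ∈ closedBall (0 : EuclideanSpace ℝ (Fin d)) 1
    · rw [indicator_of_mem hx]
      simp only [hξ]
      refine mul_le_mul_of_nonneg_left (max_le (by linarith) ?_) (by positivity)
      nlinarith [sq_nonneg ‖x‖]
    · rw [indicator_of_notMem hx]
      have hx' : 1 < ‖x‖ := by simpa using hx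
      have : θ * (1 + ‖x‖ ^ 2) - 2 * (n + 1) * ‖x‖ ^ 2 ≤ 0 := by
        have h1 : 1 ≤ ‖x‖ ^ 2 := one_le_pow₀ hx'.le
        nlinarith
      simp only [hξ]
      rw [max_eq_left this, mul_zero]
  have hxn : ‖x₁‖ ≤ 3 := by simpa using hx₁
  obtain ⟨A, hAc, hAsub, hAneg, hAvol⟩ := exists_contact_set (θ := θ) (R := 4) (η := σ / 108)
    (V := V) (g := fun x => g x + ξ x) (w := w) (z₀ := 0) (x₁ := x₁) hθ (by norm_num)
    (by positivity) hV (hg.add hξc.continuousOn) (fun x _ => add_nonneg (hg0 x) (hξ0 x))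
    (((hv.continuousOn.mono hU).sub (continuous_const.mul (continuous_barrier n)).continuousOn).add
      continuousOn_const)
    (fun x hx p e c hc h => hv.sub_barrier hn1 (by linarith) C x
      (hU (ball_subset_closedBall hx)) p e c hc h)
    (fun x hx => by
      have h1 : ‖x‖ = 4 := by simpa using hx
      have h2 := hv0 x (sphere_subset_closedBall hx)
      have h3 : barrier n x = ((17 : ℝ) ^ n)⁻¹ := by unfold barrier; rw [h1]; norm_num
      simp only [hw, h3, hC]; linarith)
    (closedBall_subset_closedBall (by norm_num) hx₁)
    (by
      have h3 : ((10 : ℝ) ^ n)⁻¹ ≤ barrier n x₁ := by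
        unfold barrier
        exact inv_anti₀ (by positivity)
          (pow_le_pow_left₀ (by positivity) (by nlinarith [norm_nonneg x₁]) n)
      have h4 := mul_le_mul_of_nonneg_left h3 (by linarith : 0 ≤ M)
      simp only [hw, hC]
      rw [hD] at hMD
      linarith)
  have hA4 : A ⊆ closedBall 0 4 := fun x hx => ball_subset_closedBall (hAsub hx).1
  have hAM : A ∩ closedBall 0 1 ⊆ closedBall 0 1 ∩ {x | v x ≤ M} := by
    rintro x ⟨hxA, hx1⟩
    refine ⟨hx1, ?_⟩
    have h1 := hAneg x hxA
    have h2 : barrier n x ≤ 1 := by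
      unfold barrier
      exact inv_le_one_of_one_le₀ (one_le_pow₀ (by nlinarith [sq_nonneg ‖x‖]))
    have h3 : 0 ≤ C := by positivity
    have h4 := mul_le_mul_of_nonneg_left h2 (by linarith : 0 ≤ M)
    simp only [hw] at h1
    show v x ≤ M
    linarith
  -- split the right-hand side into the three contributions
  have hpt : ∀ x, ENNReal.ofReal (18 * (g x + ξ x + 2 * (σ / 108))) ^ d ≤
      ENNReal.ofReal 54 ^ d * ENNReal.ofReal (g x) ^ d +
      ((closedBall (0 : EuclideanSpace ℝ (Fin d)) 1).indicator (fun _ => ENNReal.ofReal K) x +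
        ENNReal.ofReal σ) := fun x => by
    have hg' := hg0 x
    have hξ' := hξ0 x
    have h1 : 18 * (g x + ξ x + 2 * (σ / 108)) ≤
        max (54 * g x) (max (54 * ξ x) σ) := by
      have := le_max_left (54 * g x) (max (54 * ξ x) σ)
      have := le_max_right (54 * g x) (max (54 * ξ x) σ)
      have := le_max_left (54 * ξ x) σ
      have := le_max_right (54 * ξ x) σ
      linarith
    rw [← ENNReal.ofReal_pow (by positivity), ← ENNReal.ofReal_pow (by positivity),
      ← ENNReal.ofReal_pow (by positivity), ← ENNReal.ofReal_mul (by positivity), ← mul_pow]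
    have hi : (closedBall (0 : EuclideanSpace ℝ (Fin d)) 1).indicator
        (fun _ => ENNReal.ofReal K) x = ENNReal.ofReal
          ((closedBall (0 : EuclideanSpace ℝ (Fin d)) 1).indicator (fun _ => K) x) := by
      by_cases hx : x ∈ closedBall (0 : EuclideanSpace ℝ (Fin d)) 1
      · simp only [indicator_of_mem hx]
      · simp only [indicator_of_notMem hx, ENNReal.ofReal_zero]
    have hi0 : 0 ≤ (closedBall (0 : EuclideanSpace ℝ (Fin d)) 1).indicator (fun _ => K) x :=
      indicator_nonneg (fun _ _ => hK0.le) x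
    have hi1 : (54 * ξ x) ^ d ≤
        (closedBall (0 : EuclideanSpace ℝ (Fin d)) 1).indicator (fun _ => K) x := by
      have h2 := hξ1 x
      by_cases hx : x ∈ closedBall (0 : EuclideanSpace ℝ (Fin d)) 1
      · rw [indicator_of_mem hx] at h2 ⊢
        exact pow_le_pow_left₀ (by positivity) (by linarith) d
      · rw [indicator_of_notMem hx] at h2 ⊢
        have : ξ x = 0 := le_antisymm h2 hξ'
        rw [this, mul_zero, zero_pow (by omega)]
    rw [hi, ← ENNReal.ofReal_add hi0 hσ0.le, ← ENNReal.ofReal_add (by positivity) (by positivity)]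
    refine ENNReal.ofReal_le_ofReal ?_
    have hσd : σ ^ d ≤ σ := hpow σ hσ0.le (min_le_left _ _)
    have hgd : 0 ≤ (54 * g x) ^ d := by positivity
    refine (pow_le_pow_left₀ (by positivity) h1 d).trans ?_
    rcases max_choice (54 * g x) (max (54 * ξ x) σ) with h | h
    · rw [h]; linarith
    · rw [h]
      rcases max_choice (54 * ξ x) σ with h | h
      · rw [h]; linarith
      · rw [h]; linarith
  -- the first and the last contribution together cover at most half of the left-hand side
  have hI : volume (closedBall (0 : EuclideanSpace ℝ (Fin d)) (1 / (4 * 4))) ≤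
      ENNReal.ofReal (b / 4) + (ENNReal.ofReal K *
        volume (closedBall (0 : EuclideanSpace ℝ (Fin d)) 1 ∩ {x | v x ≤ M}) +
        ENNReal.ofReal (b / 4)) := by
    refine hAvol.trans ((lintegral_mono fun x => hpt x).trans ?_)
    have hmeas : Measurable fun x : EuclideanSpace ℝ (Fin d) =>
        ((closedBall (0 : EuclideanSpace ℝ (Fin d)) 1).indicator (fun _ => ENNReal.ofReal K) x +
        ENNReal.ofReal σ) :=
      (measurable_const.indicator measurableSet_closedBall).add_const _
    rw [lintegral_add_right _ hmeas, lintegral_add_right _ measurable_const,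
      lintegral_const_mul' _ _ (by finiteness), setLIntegral_const,
      lintegral_indicator measurableSet_closedBall, setLIntegral_const,
      Measure.restrict_apply measurableSet_closedBall]
    refine add_le_add ?_ (add_le_add ?_ ?_)
    · calc ENNReal.ofReal 54 ^ d * ∫⁻ x in A, ENNReal.ofReal (g x) ^ d
          ≤ ENNReal.ofReal 54 ^ d * ENNReal.ofReal (τ / 54) ^ d := by
            gcongr
            exact (lintegral_mono_set hA4).trans hint
        _ = ENNReal.ofReal (τ ^ d) := by
            rw [← mul_pow, ← ENNReal.ofReal_mul (by norm_num), ← ENNReal.ofReal_pow (by positivity)]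
            congr 2; ring
        _ ≤ ENNReal.ofReal (b / 4) := ENNReal.ofReal_le_ofReal
            ((hpow τ hτ0.le (min_le_left _ _)).trans (min_le_right _ _))
    · refine mul_le_mul_right (measure_mono ?_) _
      rw [inter_comm]
      exact hAM
    · calc ENNReal.ofReal σ * volume A
          ≤ ENNReal.ofReal σ * ENNReal.ofReal v₄ := by
            gcongr
            rw [hv₄, ENNReal.ofReal_toReal hv₄fin]
            exact measure_mono hA4
        _ = ENNReal.ofReal (σ * v₄) := (ENNReal.ofReal_mul hσ0.le).symm
        _ ≤ ENNReal.ofReal (b / 4) := by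
            refine ENNReal.ofReal_le_ofReal ?_
            calc σ * v₄ ≤ b / (4 * (v₄ + 1)) * (v₄ + 1) := by
                  gcongr
                  · exact min_le_right _ _
                  · linarith
              _ = b / 4 := by field_simp
  set X := volume (closedBall (0 : EuclideanSpace ℝ (Fin d)) 1 ∩ {x | v x ≤ M}) with hX
  have hXfin : X ≠ ∞ := ((measure_mono inter_subset_left).trans_lt measure_closedBall_lt_top).ne
  rw [← ENNReal.ofReal_toReal hbfin, ← hb, ← ENNReal.ofReal_toReal hXfin,
    ← ENNReal.ofReal_mul hK0.le, ← ENNReal.ofReal_add (by positivity) (by positivity),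
    ← ENNReal.ofReal_add (by positivity) (by positivity),
    ENNReal.ofReal_le_ofReal_iff (by positivity)] at hI
  rw [← ENNReal.ofReal_toReal hXfin, ← ENNReal.ofReal_toReal hv₁fin, ← hv₁,
    ← ENNReal.ofReal_mul (by positivity)]
  refine ENNReal.ofReal_le_ofReal ?_
  have : b / (2 * K * v₁) * v₁ = b / 2 / K := by field_simp
  rw [this, div_le_iff₀ hK0]
  linarith

/-- Rescaling of supersolutions. -/
theorem IsPucciSuper.rescale {d : ℕ} {θ : ℝ} {V U : Set (EuclideanSpace ℝ (Fin d))}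
    {g v : EuclideanSpace ℝ (Fin d) → ℝ} (hv : IsPucciSuper θ V g U v)
    (z : EuclideanSpace ℝ (Fin d)) {r m : ℝ} (hr : 0 < r) (hm : 0 < m) :
    IsPucciSuper θ ((fun x => z + r • x) ⁻¹' V) (fun x => r ^ 2 / m * g (z + r • x))
      ((fun x => z + r • x) ⁻¹' U) (fun x => v (z + r • x) / m) where
  continuousOn := by
    have h : ContinuousOn (fun x : EuclideanSpace ℝ (Fin d) => z + r • x)
        ((fun x => z + r • x) ⁻¹' U) := by fun_prop
    exact ContinuousOn.div_const (hv.continuousOn.comp h fun x hx => hx) _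
  touch := by
    intro x hx p e e' c hc h
    have hk : Real.sqrt m ^ 2 = m := Real.sq_sqrt hm.le
    have hinv : Tendsto (fun y : EuclideanSpace ℝ (Fin d) => r⁻¹ • (y - z))
        (𝓝 (z + r • x)) (𝓝 x) := by
      have hc : Continuous fun y : EuclideanSpace ℝ (Fin d) => r⁻¹ • (y - z) := by fun_prop
      have := hc.tendsto (z + r • x)
      rwa [add_sub_cancel_left, smul_smul, inv_mul_cancel₀ hr.ne', one_smul] at this
    obtain ⟨h1, h2⟩ := hv.touch (z + r • x) hx ((m / r) • p) ((Real.sqrt m / r) • e)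
      ((Real.sqrt m / r) • e') (m * c / r ^ 2) (by positivity) (by
        filter_upwards [hinv.eventually h] with y hy
        have hyz : z + r • (r⁻¹ • (y - z)) = y := by
          rw [smul_smul, mul_inv_cancel₀ hr.ne', one_smul]; abel
        have hyx : r⁻¹ • (y - z) - x = r⁻¹ • (y - (z + r • x)) := by
          rw [← sub_sub, smul_sub _ (y - z), smul_smul, inv_mul_cancel₀ hr.ne', one_smul]
        rw [hyz, hyx, le_div_iff₀ hm] at hy
        simp only [real_inner_smul_left, real_inner_smul_right, norm_smul, norm_inv,
          Real.norm_eq_abs, abs_of_pos hr] at hy ⊢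
        refine le_trans (le_of_eq ?_) hy
        field_simp
        rw [hk]
        ring)
    refine ⟨h1, ?_⟩
    rw [norm_smul, norm_smul, mul_pow, mul_pow, Real.norm_eq_abs, sq_abs, div_pow, hk] at h2
    have h3 := mul_le_mul_of_nonneg_left h2 (by positivity : 0 ≤ r ^ 2 / m)
    calc ‖e‖ ^ 2 + ‖e'‖ ^ 2 = r ^ 2 / m * (m / r ^ 2 * ‖e‖ ^ 2 + m / r ^ 2 * ‖e'‖ ^ 2) := by
          field_simp
      _ ≤ _ := h3
      _ = _ := by field_simp

theorem image_closedBall_zero {d : ℕ} (z : EuclideanSpace ℝ (Fin d)) {r : ℝ} (hr : 0 < r) (s : ℝ) :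
    (fun x => z + r • x) '' closedBall (0 : EuclideanSpace ℝ (Fin d)) s = closedBall z (r * s) := by
  ext y
  simp only [mem_image, mem_closedBall, dist_eq_norm, sub_zero]
  constructor
  · rintro ⟨x, hx, rfl⟩
    rw [add_sub_cancel_left, norm_smul, Real.norm_eq_abs, abs_of_pos hr]
    gcongr
  · intro hy
    refine ⟨r⁻¹ • (y - z), ?_, ?_⟩
    · rw [norm_smul, norm_inv, Real.norm_eq_abs, abs_of_pos hr, inv_mul_le_iff₀ hr]
      exact hy
    · rw [smul_smul, mul_inv_cancel₀ hr.ne', one_smul]; abel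

theorem lintegral_image_affine {d : ℕ} (z : EuclideanSpace ℝ (Fin d)) {r : ℝ} (hr : 0 < r)
    {s : Set (EuclideanSpace ℝ (Fin d))} (hs : MeasurableSet s)
    (F : EuclideanSpace ℝ (Fin d) → ℝ≥0∞) :
    ∫⁻ x in (fun x => z + r • x) '' s, F x =
      ENNReal.ofReal r ^ d * ∫⁻ x in s, F (z + r • x) := by
  have hf' : ∀ x ∈ s, HasFDerivWithinAt (fun x : EuclideanSpace ℝ (Fin d) => z + r • x)
      (r • ContinuousLinearMap.id ℝ (EuclideanSpace ℝ (Fin d))) s x := fun x _ =>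
    (((hasFDerivAt_id x).const_smul r).const_add z).hasFDerivWithinAt
  have hinj : InjOn (fun x : EuclideanSpace ℝ (Fin d) => z + r • x) s := fun x _ y _ h =>
    smul_right_injective _ hr.ne' (add_left_cancel h)
  rw [lintegral_image_eq_lintegral_abs_det_fderiv_mul volume hs hf' hinj]
  have hdet : |(r • ContinuousLinearMap.id ℝ (EuclideanSpace ℝ (Fin d))).det| = r ^ d := by
    have : (r • ContinuousLinearMap.id ℝ (EuclideanSpace ℝ (Fin d))).det = r ^ d := by
      simp [ContinuousLinearMap.det]
    rw [this, abs_of_pos (by positivity)]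
  rw [hdet, lintegral_const_mul' _ _ ENNReal.ofReal_ne_top, ENNReal.ofReal_pow hr.le]

/-- The basic measure estimate on balls of any radius and for any height. -/
theorem exists_measure_estimate {d : ℕ} (hd : 1 ≤ d) {θ : ℝ} (hθ : 1 ≤ θ) :
    ∃ ε M μ : ℝ, 0 < ε ∧ 1 < M ∧ 0 < μ ∧
      ∀ (V U : Set (EuclideanSpace ℝ (Fin d))) (g v : EuclideanSpace ℝ (Fin d) → ℝ),
        IsPucciSuper θ V g U v → IsOpen V → ContinuousOn g V → (∀ x, 0 ≤ g x) →
        ∀ (z : EuclideanSpace ℝ (Fin d)) (r m : ℝ), 0 < r → 0 < m →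
        closedBall z (4 * r) ⊆ U → (∀ x ∈ closedBall z (4 * r), 0 ≤ v x) →
        (∃ x ∈ closedBall z (3 * r), v x ≤ m) →
        ENNReal.ofReal r ^ d * ∫⁻ x in closedBall z (4 * r), ENNReal.ofReal (g x) ^ d ≤
          ENNReal.ofReal (ε * m) ^ d →
        ENNReal.ofReal μ * volume (closedBall z r) ≤
          volume (closedBall z r ∩ {x | v x ≤ M * m}) := by
  obtain ⟨ε, M, μ, hε, hM, hμ, H⟩ := exists_measure_estimate_unit hd hθ
  refine ⟨ε, M, μ, hε, hM, hμ, ?_⟩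
  intro V U g v hv hV hg hg0 z r m hr hm hU hv0 ⟨x₁, hx₁, hvx₁⟩ hint
  have hcont : Continuous fun x : EuclideanSpace ℝ (Fin d) => z + r • x := by fun_prop
  have hmaps : ∀ s x, x ∈ closedBall (0 : EuclideanSpace ℝ (Fin d)) s →
      z + r • x ∈ closedBall z (s * r) := fun s x hx => by
    rw [mul_comm, ← image_closedBall_zero z hr s]
    exact mem_image_of_mem _ hx
  have hgm : ∀ x, 0 ≤ r ^ 2 / m * g (z + r • x) := fun x => mul_nonneg (by positivity) (hg0 _)
  have key := H _ _ _ _ (hv.rescale z hr hm) (hV.preimage hcont)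
    (continuousOn_const.mul (hg.comp hcont.continuousOn fun x hx => hx)) hgm
    (fun x hx => hU (hmaps 4 x hx))
    (fun x hx => div_nonneg (hv0 _ (hmaps 4 x hx)) hm.le)
    (by
      rw [mul_comm, ← image_closedBall_zero z hr 3] at hx₁
      obtain ⟨y, hy, rfl⟩ := hx₁
      exact ⟨y, hy, (div_le_one hm).2 hvx₁⟩)
    (by
      have h1 := lintegral_image_affine z hr (measurableSet_closedBall (x := (0 :
        EuclideanSpace ℝ (Fin d))) (ε := 4)) fun x => ENNReal.ofReal (g x) ^ d
      rw [image_closedBall_zero z hr 4, mul_comm r 4] at h1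
      rw [h1, ← mul_assoc, ← mul_pow, ← ENNReal.ofReal_mul hr.le] at hint
      calc ∫⁻ x in closedBall (0 : EuclideanSpace ℝ (Fin d)) 4,
            ENNReal.ofReal (r ^ 2 / m * g (z + r • x)) ^ d
          = ENNReal.ofReal m⁻¹ ^ d * (ENNReal.ofReal (r * r) ^ d *
            ∫⁻ x in closedBall (0 : EuclideanSpace ℝ (Fin d)) 4,
              ENNReal.ofReal (g (z + r • x)) ^ d) := by
            rw [← mul_assoc, ← mul_pow, ← ENNReal.ofReal_mul (by positivity),
              ← lintegral_const_mul' _ _ (by finiteness)]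
            refine lintegral_congr fun x => ?_
            rw [← mul_pow, ← ENNReal.ofReal_mul (by positivity)]
            congr 2; field_simp
        _ ≤ ENNReal.ofReal m⁻¹ ^ d * ENNReal.ofReal (ε * m) ^ d := by gcongr
        _ = ENNReal.ofReal ε ^ d := by
            rw [← mul_pow, ← ENNReal.ofReal_mul (by positivity)]
            congr 2; field_simp)
  have hvol : ∀ s : Set (EuclideanSpace ℝ (Fin d)),
      volume ((fun x => z + r • x) '' s) = ENNReal.ofReal r ^ d * volume s := fun s => by
    have : (fun x : EuclideanSpace ℝ (Fin d) => z + r • x) '' s =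
        (fun x => z + x) '' (r • s) := by rw [← image_smul, image_image]
    rw [this, image_add_left, measure_preimage_add, Measure.addHaar_smul_of_nonneg _ hr.le]
    simp [ENNReal.ofReal_pow hr.le]
  have himg : (fun x => z + r • x) '' (closedBall (0 : EuclideanSpace ℝ (Fin d)) 1 ∩
      {x | v (z + r • x) / m ≤ M}) ⊆ closedBall z r ∩ {x | v x ≤ M * m} := by
    rintro _ ⟨x, ⟨hx1, hx2⟩, rfl⟩
    exact ⟨by simpa using hmaps 1 x hx1, (div_le_iff₀ hm).1 hx2⟩
  have hB : volume (closedBall z r) =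
      ENNReal.ofReal r ^ d * volume (closedBall (0 : EuclideanSpace ℝ (Fin d)) 1) := by
    rw [← hvol, image_closedBall_zero z hr 1, mul_one]
  calc ENNReal.ofReal μ * volume (closedBall z r)
      = ENNReal.ofReal r ^ d *
        (ENNReal.ofReal μ * volume (closedBall (0 : EuclideanSpace ℝ (Fin d)) 1)) := by
        rw [hB]; ring
    _ ≤ ENNReal.ofReal r ^ d * volume (closedBall (0 : EuclideanSpace ℝ (Fin d)) 1 ∩
      {x | v (z + r • x) / m ≤ M}) := by gcongr
    _ ≤ _ := by rw [← hvol]; exact measure_mono himg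

end WeightedPucci

/-! ### Growing ink spots and the lower bound -/

namespace WeightedPucci

/-- The growing ink-spots lemma. Every ball in which `E` has large density is, together with its
threefold enlargement, absorbed by `F`; then `F` is larger than `E` by a definite factor. The balls
through a given point `x` are tilted towards the centre `z` so that they stay in the big ball. -/
theorem ink_spots {d : ℕ} {z : EuclideanSpace ℝ (Fin d)} {ρ μ : ℝ} (hρ : 0 < ρ) (hμ : 0 < μ)
    (hμ1 : μ < 1) {E F : Set (EuclideanSpace ℝ (Fin d))} (hE : MeasurableSet E)
    (hF : MeasurableSet F) (hEB : E ⊆ closedBall z ρ)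
    (hEF : ∀ x r, 0 < r → r ≤ ρ → x ∈ closedBall z ρ →
      ENNReal.ofReal (1 - μ) * volume (closedBall x r) < volume (closedBall x r ∩ E) →
      closedBall x (3 * r) ∩ closedBall z ρ ⊆ F)
    (hsmall : volume E ≤ ENNReal.ofReal (1 - μ) * volume (closedBall z ρ)) :
    ENNReal.ofReal μ * volume E ≤ 5 ^ d * volume (F \ E) := by
  set r : ℕ → ℝ := fun k => ρ * (1 / 2) ^ k with hr
  set c : ℕ → EuclideanSpace ℝ (Fin d) → EuclideanSpace ℝ (Fin d) :=
    fun k x => x - ((1 / 2 : ℝ) ^ k) • (x - z) with hc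
  have hrpos : ∀ k, 0 < r k := fun k => by positivity
  have hrρ : ∀ k, r k ≤ ρ := fun k =>
    mul_le_of_le_one_right hρ.le (pow_le_one₀ (by norm_num) (by norm_num))
  have hcx : ∀ k, ∀ x ∈ closedBall z ρ, x ∈ closedBall (c k x) (r k) := fun k x hx => by
    rw [mem_closedBall, dist_eq_norm] at hx ⊢
    simp only [hc, hr, sub_sub_cancel, norm_smul, norm_pow, Real.norm_eq_abs]
    rw [abs_of_pos (by norm_num : (0 : ℝ) < 1 / 2), mul_comm]
    gcongr
  have hcz : ∀ k, ∀ x ∈ closedBall z ρ, dist (c k x) z + r k ≤ ρ := fun k x hx => by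
    rw [mem_closedBall, dist_eq_norm] at hx
    have h1 : (1 / 2 : ℝ) ^ k ≤ 1 := pow_le_one₀ (by norm_num) (by norm_num)
    have : c k x - z = (1 - (1 / 2 : ℝ) ^ k) • (x - z) := by
      simp only [hc, sub_smul, one_smul]; abel
    rw [dist_eq_norm, this, norm_smul, Real.norm_eq_abs, abs_of_nonneg (by linarith)]
    have := mul_le_mul_of_nonneg_left hx (by linarith : 0 ≤ 1 - (1 / 2 : ℝ) ^ k)
    simp only [hr]; linarith
  have hsub : ∀ k, ∀ x ∈ closedBall z ρ, closedBall (c k x) (r k) ⊆ closedBall z ρ :=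
    fun k x hx => closedBall_subset_closedBall' (by linarith [hcz k x hx])
  -- almost every point of `E` sees a ball of high density
  have hdens : ∀ᵐ x ∂(volume.restrict E), ∃ k,
      ENNReal.ofReal (1 - μ) * volume (closedBall (c k x) (r k)) <
        volume (closedBall (c k x) (r k) ∩ E) := by
    filter_upwards [IsUnifLocDoublingMeasure.ae_tendsto_measure_inter_div volume E 1,
      ae_restrict_mem hE] with x hx hxE
    have hr0 : Tendsto r atTop (𝓝[>] 0) := by
      refine tendsto_nhdsWithin_iff.2 ⟨?_, Eventually.of_forall hrpos⟩
      have := (tendsto_pow_atTop_nhds_zero_of_lt_one (by norm_num : (0 : ℝ) ≤ 1 / 2)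
        (by norm_num)).const_mul ρ
      rwa [mul_zero] at this
    have h1 := hx (fun k => c k x) r hr0 (Eventually.of_forall fun k => by
      rw [one_mul]; exact hcx k x (hEB hxE))
    have h2 : ENNReal.ofReal (1 - μ) < 1 := by
      rw [← ENNReal.ofReal_one]
      exact (ENNReal.ofReal_lt_ofReal_iff one_pos).2 (by linarith)
    obtain ⟨k, hk⟩ := (h1.eventually_const_lt h2).exists
    refine ⟨k, ?_⟩
    rw [inter_comm]
    exact ENNReal.mul_lt_of_lt_div hk
  -- the parent of the first such ball is contained in `F` and has low density
  have hball : ∀ᵐ x ∂(volume.restrict E), ∃ j,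
      closedBall (c j x) (r j) ⊆ F ∧
      ENNReal.ofReal μ * volume (closedBall (c j x) (r j)) ≤
        volume (closedBall (c j x) (r j) ∩ (F \ E)) := by
    filter_upwards [hdens, ae_restrict_mem hE] with x hx hxE
    classical
    have hxB := hEB hxE
    have hk := Nat.find_spec hx
    set k := Nat.find hx with hkdef
    have hk0 : k ≠ 0 := by
      intro h0
      rw [h0] at hk
      have e1 : c 0 x = z := by simp [hc]
      have e2 : r 0 = ρ := by simp [hr]
      rw [e1, e2, inter_eq_right.2 hEB] at hk
      exact absurd hsmall (not_le.2 hk)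
    obtain ⟨j, hj⟩ := Nat.exists_eq_succ_of_ne_zero hk0
    have hjlow : volume (closedBall (c j x) (r j) ∩ E) ≤
        ENNReal.ofReal (1 - μ) * volume (closedBall (c j x) (r j)) :=
      not_lt.1 (Nat.find_min hx (by omega : j < Nat.find hx))
    have hF3 := hEF (c k x) (r k) (hrpos k) (hrρ k)
      (by
        rw [mem_closedBall]
        linarith [hcz k x hxB, hrpos k]) hk
    have hjk : closedBall (c j x) (r j) ⊆ closedBall (c k x) (3 * r k) := by
      refine closedBall_subset_closedBall' ?_
      have e1 : r j = 2 * r k := by simp only [hr, hj, pow_succ]; ring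
      have e2 : c j x - c k x = (-(1 / 2 : ℝ) ^ k) • (x - z) := by
        simp only [hc, hj, pow_succ]
        rw [sub_sub_sub_cancel_left, ← sub_smul]; congr 1; ring
      rw [e1, dist_eq_norm, e2, norm_smul, norm_neg, norm_pow, Real.norm_eq_abs,
        abs_of_pos (by norm_num : (0 : ℝ) < 1 / 2)]
      have : ‖x - z‖ ≤ ρ := by simpa [dist_eq_norm] using hxB
      have := mul_le_mul_of_nonneg_left this (by positivity : 0 ≤ (1 / 2 : ℝ) ^ k)
      simp only [hr]; linarith
    have hjF : closedBall (c j x) (r j) ⊆ F := (subset_inter hjk (hsub j x hxB)).trans hF3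
    refine ⟨j, hjF, ?_⟩
    set B := closedBall (c j x) (r j) with hB
    have hBfin : volume B ≠ ∞ := measure_closedBall_lt_top.ne
    have hdiff : B ∩ (F \ E) = B \ E := by
      ext y; exact ⟨fun h => ⟨h.1, h.2.2⟩, fun h => ⟨h.1, hjF h.1, h.2⟩⟩
    rw [hdiff]
    have h1 : volume B = volume (B ∩ E) + volume (B \ E) := (measure_inter_add_sdiff B hE).symm
    have h2 : volume B = ENNReal.ofReal (1 - μ) * volume B + ENNReal.ofReal μ * volume B := by
      rw [← add_mul, ← ENNReal.ofReal_add (by linarith) hμ.le, sub_add_cancel, ENNReal.ofReal_one,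
        one_mul]
    have h3 : ENNReal.ofReal (1 - μ) * volume B + ENNReal.ofReal μ * volume B ≤
        ENNReal.ofReal (1 - μ) * volume B + volume (B \ E) := by
      rw [← h2]
      calc volume B = volume (B ∩ E) + volume (B \ E) := h1
        _ ≤ _ := by gcongr
    exact (ENNReal.add_le_add_iff_left (by finiteness)).1 h3
  set t : Set (EuclideanSpace ℝ (Fin d)) := {x ∈ E | ∃ j, closedBall (c j x) (r j) ⊆ F ∧
      ENNReal.ofReal μ * volume (closedBall (c j x) (r j)) ≤
        volume (closedBall (c j x) (r j) ∩ (F \ E))} with ht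
  have htE : volume E ≤ volume t := by
    have : E ≤ᵐ[volume] t := by
      rw [ae_restrict_iff' hE] at hball
      filter_upwards [hball] with x hx hxE using ⟨hxE, hx hxE⟩
    exact measure_mono_ae this
  choose! j hjF hjμ using fun x (hx : x ∈ t) => hx.2
  obtain ⟨u, hut, hudisj, hucov⟩ := Vitali.exists_disjoint_subfamily_covering_enlargement_closedBall
    t (fun x => c (j x) x) (fun x => r (j x)) ρ (fun x _ => hrρ _) 5 (by norm_num)
  have hucount : u.Countable := hudisj.countable_of_nonempty_interior fun x _ => by
    refine Nonempty.mono (ball_subset_interior_closedBall) ?_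
    exact nonempty_ball.2 (hrpos _)
  have hcov : t ⊆ ⋃ b ∈ u, closedBall (c (j b) b) (5 * r (j b)) := fun x hx => by
    obtain ⟨b, hb, hxb⟩ := hucov x hx
    exact mem_biUnion hb (hxb (hcx (j x) x (hEB hx.1)))
  have h5 : ∀ b, volume (closedBall (c (j b) b) (5 * r (j b))) =
      5 ^ d * volume (closedBall (c (j b) b) (r (j b))) := fun b => by
    rw [Measure.addHaar_closedBall_mul volume _ (by norm_num : (0 : ℝ) ≤ 5) (hrpos _).le,
      Measure.addHaar_closedBall_center volume (c (j b) b)]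
    congr 1
    rw [finrank_euclideanSpace_fin, ENNReal.ofReal_pow (by norm_num)]
    norm_num
  calc ENNReal.ofReal μ * volume E
      ≤ ENNReal.ofReal μ * ∑' b : u, volume (closedBall (c (j b) (b : EuclideanSpace ℝ (Fin d)))
          (5 * r (j b))) := by
        gcongr
        exact htE.trans ((measure_mono hcov).trans (measure_biUnion_le _ hucount _))
    _ = 5 ^ d * ∑' b : u, ENNReal.ofReal μ *
          volume (closedBall (c (j b) (b : EuclideanSpace ℝ (Fin d))) (r (j b))) := by
        simp_rw [h5]
        rw [ENNReal.tsum_mul_left, ENNReal.tsum_mul_left]; ring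
    _ ≤ 5 ^ d * ∑' b : u, volume (closedBall (c (j b) (b : EuclideanSpace ℝ (Fin d))) (r (j b)) ∩
          (F \ E)) := by
        gcongr with b
        exact hjμ b (hut b.2)
    _ = 5 ^ d * volume (⋃ b ∈ u, closedBall (c (j b) b) (r (j b)) ∩ (F \ E)) := by
        rw [measure_biUnion hucount]
        · exact hudisj.mono fun x => inter_subset_left
        · exact fun b _ => measurableSet_closedBall.inter (hF.diff hE)
    _ ≤ 5 ^ d * volume (F \ E) := by
        gcongr
        exact iUnion₂_subset fun b _ => inter_subset_right

/-- A nonnegative supersolution that is at least `m` on half of a ball is at least `c m` on the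
whole ball. -/
theorem exists_lower_bound_of_half {d : ℕ} (hd : 1 ≤ d) {θ : ℝ} (hθ : 1 ≤ θ) :
    ∃ ε c : ℝ, 0 < ε ∧ 0 < c ∧ c < 1 ∧
      ∀ (V U : Set (EuclideanSpace ℝ (Fin d))) (g v : EuclideanSpace ℝ (Fin d) → ℝ),
        IsPucciSuper θ V g U v → IsOpen V → ContinuousOn g V → (∀ x, 0 ≤ g x) →
        ∀ (z : EuclideanSpace ℝ (Fin d)) (ρ m : ℝ), 0 < ρ → 0 < m →
        closedBall z (5 * ρ) ⊆ U → (∀ x ∈ closedBall z (5 * ρ), 0 ≤ v x) →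
        volume (closedBall z ρ) ≤ 2 * volume (closedBall z ρ ∩ {x | m ≤ v x}) →
        ENNReal.ofReal ρ ^ d * ∫⁻ x in closedBall z (5 * ρ), ENNReal.ofReal (g x) ^ d ≤
          ENNReal.ofReal (ε * m) ^ d →
        ∀ x ∈ closedBall z ρ, c * m ≤ v x := by
  obtain ⟨ε, M, μ₀, hε, hM, hμ₀, H⟩ := exists_measure_estimate hd hθ
  set μ : ℝ := min μ₀ (1 / 2) with hμdef
  have hμ : 0 < μ := by positivity
  have hμ1 : μ < 1 := lt_of_le_of_lt (min_le_right _ _) (by norm_num)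
  -- While the superlevel sets have density at most `1 - μ`, each of them is larger than the previous
  -- one by the factor `γ`; starting from half of the ball, this can happen fewer than `K` times.
  set γ : ℝ := 1 + μ / 5 ^ d with hγ
  have hγ1 : 1 < γ := by have : 0 < μ / 5 ^ d := by positivity
                         linarith
  obtain ⟨K, hK⟩ := pow_unbounded_of_one_lt 2 hγ1
  have hM0 : 0 < M := by linarith
  have hMK1 : (M⁻¹) ^ (K + 1) ≤ 1 := pow_le_one₀ (by positivity) (inv_le_one_of_one_le₀ hM.le)
  refine ⟨ε * ((M⁻¹) ^ (K + 1) / 2), (M⁻¹) ^ (K + 1) / 2, by positivity, by positivity,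
    by linarith, ?_⟩
  intro V U g v hv hV hg hg0 z ρ m hρ hm hU hv0 hhalf hint
  set t : ℕ → ℝ := fun k => (M⁻¹) ^ k / 2 * m with ht
  have htpos : ∀ k, 0 < t k := fun k => by positivity
  have htM : ∀ k, M * t (k + 1) = t k := fun k => by simp only [ht, pow_succ]; field_simp
  have htK : ∀ k ≤ K, t (K + 1) ≤ t (k + 1) := fun k hk => by
    simp only [ht]
    have := pow_le_pow_of_le_one (by positivity : 0 ≤ M⁻¹) (inv_le_one_of_one_le₀ hM.le)
      (by omega : k + 1 ≤ K + 1)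
    gcongr
  set B := closedBall z ρ with hB
  have hBfin : volume B ≠ ∞ := measure_closedBall_lt_top.ne
  have hBpos : volume B ≠ 0 := (measure_closedBall_pos _ _ hρ).ne'
  have hB5 : B ⊆ closedBall z (5 * ρ) := closedBall_subset_closedBall (by linarith)
  set A : ℕ → Set (EuclideanSpace ℝ (Fin d)) := fun k => B ∩ {x | t k < v x} with hA
  have hAm : ∀ k, MeasurableSet (A k) := fun k => by
    have h1 : IsClosed (B ∩ v ⁻¹' Iic (t k)) :=
      (hv.continuousOn.mono (hB5.trans hU)).preimage_isClosed_of_isClosed isClosed_closedBall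
        isClosed_Iic
    have h2 : A k = B \ (B ∩ v ⁻¹' Iic (t k)) := by
      ext x
      simp only [hA, mem_inter_iff, Set.mem_sdiff, mem_ofPred_eq, mem_preimage, mem_Iic, not_and,
        not_le]
      exact ⟨fun h => ⟨h.1, fun _ => h.2⟩, fun h => ⟨h.1, h.2 h.1⟩⟩
    rw [h2]
    exact measurableSet_closedBall.diff h1.measurableSet
  -- large density at one level gives a pointwise bound at the next level
  have hprop : ∀ k ≤ K, ∀ x r, 0 < r → r ≤ ρ → x ∈ B →
      ENNReal.ofReal (1 - μ) * volume (closedBall x r) < volume (closedBall x r ∩ A k) →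
      ∀ y ∈ closedBall x (3 * r), t (k + 1) < v y := by
    intro k hk x r hr hrρ hx hdens y hy
    by_contra hcon
    push Not at hcon
    have h45 : closedBall x (4 * r) ⊆ closedBall z (5 * ρ) :=
      closedBall_subset_closedBall' (by have : dist x z ≤ ρ := hx; linarith)
    have := H V U g v hv hV hg hg0 x r (t (k + 1)) hr (htpos _) (h45.trans hU)
      (fun w hw => hv0 w (h45 hw)) ⟨y, hy, hcon⟩ (by
        calc ENNReal.ofReal r ^ d * ∫⁻ x in closedBall x (4 * r), ENNReal.ofReal (g x) ^ d
            ≤ ENNReal.ofReal ρ ^ d * ∫⁻ x in closedBall z (5 * ρ), ENNReal.ofReal (g x) ^ d := by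
              gcongr
          _ ≤ _ := hint
          _ ≤ _ := by
            have := htK k hk
            refine pow_le_pow_left' (ENNReal.ofReal_le_ofReal ?_) d
            rw [mul_assoc]
            exact mul_le_mul_of_nonneg_left this hε.le)
    rw [htM] at this
    set b := closedBall x r with hb
    have hbfin : volume b ≠ ∞ := measure_closedBall_lt_top.ne
    have hdisj : volume (b ∩ {x | v x ≤ t k}) + volume (b ∩ A k) ≤ volume b := by
      rw [← measure_union ?_ (measurableSet_closedBall.inter (hAm k))]
      · exact measure_mono (union_subset inter_subset_left inter_subset_left)
      · refine disjoint_left.2 fun w h1 h2 => ?_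
        have a1 : v w ≤ t k := h1.2
        have a2 : t k < v w := h2.2.2
        linarith
    have h2 : volume b = ENNReal.ofReal μ * volume b + ENNReal.ofReal (1 - μ) * volume b := by
      rw [← add_mul, ← ENNReal.ofReal_add hμ.le (by linarith), add_sub_cancel, ENNReal.ofReal_one,
        one_mul]
    have h3 : ENNReal.ofReal μ * volume b ≤ ENNReal.ofReal μ₀ * volume b := by
      gcongr
      exact min_le_left _ _
    have h4 : ENNReal.ofReal μ * volume b + ENNReal.ofReal (1 - μ) * volume b < volume b :=
      lt_of_lt_of_le (ENNReal.add_lt_add_of_le_of_lt (by finiteness) (h3.trans this) hdens) hdisj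
    exact absurd h4 (by rw [← h2]; exact lt_irrefl _)
  by_cases hex : ∃ k ≤ K, ENNReal.ofReal (1 - μ) * volume B < volume (A k)
  · obtain ⟨k, hk, hAk⟩ := hex
    intro x hx
    have := hprop k hk z ρ hρ le_rfl (mem_closedBall_self hρ.le)
      (by rwa [inter_eq_right.2 inter_subset_left]) x
      (closedBall_subset_closedBall (by linarith) hx)
    exact (htK k hk).trans this.le
  · exfalso
    push Not at hex
    have hgrow : ∀ k ≤ K, ENNReal.ofReal (γ ^ k) * volume (A 0) ≤ volume (A k) := by
      intro k
      induction k with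
      | zero => intro _; simp
      | succ k ih =>
        intro hk
        have hmono : A k ⊆ A (k + 1) := fun x hx => ⟨hx.1, by
          have h1 : t k < v x := hx.2
          have h2 := htM k
          have h3 := htpos (k + 1)
          show t (k + 1) < v x
          nlinarith⟩
        have hs := ink_spots hρ hμ hμ1 (hAm k) (hAm (k + 1)) inter_subset_left
          (fun x r hr hrρ hx hdens y hy => ⟨hy.2, hprop k (by omega) x r hr hrρ hx hdens y hy.1⟩)
          (hex k (by omega))
        have hs' : ENNReal.ofReal (μ / 5 ^ d) * volume (A k) ≤ volume (A (k + 1) \ A k) := by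
          have h5 : (5 : ℝ≥0∞) ^ d = ENNReal.ofReal (5 ^ d) := by
            rw [ENNReal.ofReal_pow (by norm_num)]; norm_num
          rw [h5] at hs
          calc ENNReal.ofReal (μ / 5 ^ d) * volume (A k)
              = ENNReal.ofReal ((5 ^ d)⁻¹) * (ENNReal.ofReal μ * volume (A k)) := by
                rw [← mul_assoc, ← ENNReal.ofReal_mul (by positivity), div_eq_inv_mul]
            _ ≤ ENNReal.ofReal ((5 ^ d)⁻¹) * (ENNReal.ofReal (5 ^ d) *
                volume (A (k + 1) \ A k)) := by gcongr
            _ = volume (A (k + 1) \ A k) := by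
                rw [← mul_assoc, ← ENNReal.ofReal_mul (by positivity),
                  inv_mul_cancel₀ (by positivity), ENNReal.ofReal_one, one_mul]
        calc ENNReal.ofReal (γ ^ (k + 1)) * volume (A 0)
            = ENNReal.ofReal γ * (ENNReal.ofReal (γ ^ k) * volume (A 0)) := by
              rw [pow_succ', ENNReal.ofReal_mul (by linarith), mul_assoc]
          _ ≤ ENNReal.ofReal γ * volume (A k) := by
              gcongr
              exact ih (by omega)
          _ = volume (A k) + ENNReal.ofReal (μ / 5 ^ d) * volume (A k) := by
              rw [hγ, ENNReal.ofReal_add (by norm_num) (by positivity), add_mul, ENNReal.ofReal_one,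
                one_mul]
          _ ≤ volume (A k) + volume (A (k + 1) \ A k) := by gcongr
          _ = volume (A (k + 1)) := by
              rw [measure_add_sdiff (hAm k).nullMeasurableSet, union_eq_self_of_subset_left hmono]
    have hA0 : volume B ≤ 2 * volume (A 0) := by
      refine hhalf.trans ?_
      gcongr
      refine inter_subset_inter_right _ fun x hx => ?_
      have : m ≤ v x := hx
      show t 0 < v x
      simp only [ht, pow_zero]; linarith
    have h1 := hgrow K le_rfl
    have h2 : volume (A K) ≤ volume B := measure_mono inter_subset_left
    have hA0pos : volume (A 0) ≠ 0 := fun h => hBpos (by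
      rw [h, mul_zero] at hA0; exact le_antisymm hA0 zero_le)
    have hA0fin : volume (A 0) ≠ ∞ :=
      ((measure_mono inter_subset_left).trans_lt measure_closedBall_lt_top).ne
    have h3 : ENNReal.ofReal (γ ^ K) * volume (A 0) ≤ 2 * volume (A 0) := (h1.trans h2).trans hA0
    rw [ENNReal.mul_le_mul_iff_left hA0pos hA0fin] at h3
    have h4 : (2 : ℝ≥0∞) = ENNReal.ofReal 2 := by norm_num
    rw [h4, ENNReal.ofReal_le_ofReal_iff (by norm_num)] at h3
    linarith

end WeightedPucci

/-! ### Oscillation decay and the Hölder estimate -/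

namespace WeightedPucci

theorem IsPucciSuper.add_const {d : ℕ} {θ : ℝ} {V U : Set (EuclideanSpace ℝ (Fin d))}
    {g v : EuclideanSpace ℝ (Fin d) → ℝ} (hv : IsPucciSuper θ V g U v) (b : ℝ) :
    IsPucciSuper θ V g U fun x => v x + b where
  continuousOn := hv.continuousOn.add continuousOn_const
  touch x hx p e e' c hc h := hv.touch x hx p e e' c hc (by
    filter_upwards [h] with z hz
    linarith)

/-- `v` is a uniform limit of supersolutions `v - ψ` whose right-hand sides tend to `g`. -/
def IsApproxSuper {d : ℕ} (θ : ℝ) (V : Set (EuclideanSpace ℝ (Fin d)))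
    (g : EuclideanSpace ℝ (Fin d) → ℝ) (U : Set (EuclideanSpace ℝ (Fin d)))
    (v : EuclideanSpace ℝ (Fin d) → ℝ) : Prop :=
  ∀ η > 0, ∃ ψ : EuclideanSpace ℝ (Fin d) → ℝ, (∀ x ∈ U, |ψ x| ≤ η) ∧
    IsPucciSuper θ V (fun x => g x + η) U fun x => v x - ψ x

theorem IsApproxSuper.add_const {d : ℕ} {θ : ℝ} {V U : Set (EuclideanSpace ℝ (Fin d))}
    {g v : EuclideanSpace ℝ (Fin d) → ℝ} (hv : IsApproxSuper θ V g U v) (b : ℝ) :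
    IsApproxSuper θ V g U fun x => v x + b := fun η hη => by
  obtain ⟨ψ, h1, h2⟩ := hv η hη
  refine ⟨ψ, h1, ?_⟩
  have := h2.add_const b
  convert this using 2
  ring

/-- The lower bound for supersolutions that are large on half of a ball is stable under uniform
limits. -/
theorem exists_approx_lower_bound_of_half {d : ℕ} (hd : 1 ≤ d) {θ : ℝ} (hθ : 1 ≤ θ) :
    ∃ ε c : ℝ, 0 < ε ∧ 0 < c ∧ c < 1 ∧
      ∀ (V U : Set (EuclideanSpace ℝ (Fin d))) (g v : EuclideanSpace ℝ (Fin d) → ℝ),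
        IsApproxSuper θ V g U v → IsOpen V → ContinuousOn g V → (∀ x, 0 ≤ g x) →
        ∀ (z : EuclideanSpace ℝ (Fin d)) (ρ m : ℝ), 0 < ρ → 0 < m →
        closedBall z (5 * ρ) ⊆ U → (∀ x ∈ closedBall z (5 * ρ), 0 ≤ v x) →
        volume (closedBall z ρ) ≤ 2 * volume (closedBall z ρ ∩ {x | m ≤ v x}) →
        ENNReal.ofReal ρ ^ d * ∫⁻ x in closedBall z (5 * ρ), ENNReal.ofReal (g x) ^ d ≤
          ENNReal.ofReal (ε * m) ^ d →
        ∀ x ∈ closedBall z ρ, c * m ≤ v x := by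
  obtain ⟨ε, c, hε, hc, hc1, H⟩ := exists_lower_bound_of_half hd hθ
  refine ⟨ε / 4, c, by positivity, hc, hc1, ?_⟩
  intro V U g v hv hV hg hg0 z ρ m hρ hm hU hv0 hhalf hint x hx
  set L : ℝ := (ENNReal.ofReal ρ ^ d * volume (closedBall z (5 * ρ))).toReal with hL
  have hLfin : ENNReal.ofReal ρ ^ d * volume (closedBall z (5 * ρ)) ≠ ∞ :=
    ENNReal.mul_ne_top (by finiteness) measure_closedBall_lt_top.ne
  have hL0 : 0 ≤ L := ENNReal.toReal_nonneg
  -- `η₀` is so small that the additional right-hand side `η` adds at most `κ ^ d` to the integral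
  set κ : ℝ := ε / 4 * m with hκ
  have hκ0 : 0 < κ := by positivity
  set η₀ : ℝ := min 1 (κ ^ d / (L + 1)) with hη₀
  have hη₀pos : 0 < η₀ := by positivity
  have key : ∀ η, 0 < η → η ≤ η₀ → c * m ≤ v x + 2 * η := by
    intro η hη hηle
    obtain ⟨ψ, h1, h2⟩ := hv η hη
    have hηL : η ^ d * L ≤ κ ^ d := by
      have a1 : η ^ d ≤ η := pow_le_of_le_one hη.le (hηle.trans (min_le_left _ _)) (by omega)
      calc η ^ d * L ≤ κ ^ d / (L + 1) * (L + 1) := by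
            gcongr
            · exact (a1.trans hηle).trans (min_le_right _ _)
            · linarith
        _ = κ ^ d := by field_simp
    have hpt : ∀ y, ENNReal.ofReal (g y + η) ^ d ≤
        ENNReal.ofReal 2 ^ d * (ENNReal.ofReal (g y) ^ d + ENNReal.ofReal η ^ d) := fun y => by
      have hgy := hg0 y
      rw [← ENNReal.ofReal_pow (by positivity), ← ENNReal.ofReal_pow (by positivity),
        ← ENNReal.ofReal_pow (by positivity), ← ENNReal.ofReal_pow (by positivity),
        ← ENNReal.ofReal_add (by positivity) (by positivity), ← ENNReal.ofReal_mul (by positivity)]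
      refine ENNReal.ofReal_le_ofReal ?_
      have a2 : g y + η ≤ 2 * max (g y) η := by
        have := le_max_left (g y) η
        have := le_max_right (g y) η
        linarith
      refine (pow_le_pow_left₀ (by positivity) a2 d).trans ?_
      rw [mul_pow]
      refine mul_le_mul_of_nonneg_left ?_ (by positivity)
      have p1 : 0 ≤ g y ^ d := by positivity
      have p2 : 0 ≤ η ^ d := by positivity
      rcases max_choice (g y) η with h | h <;> rw [h] <;> linarith
    have hint' : ENNReal.ofReal ρ ^ d *
        ∫⁻ x in closedBall z (5 * ρ), ENNReal.ofReal (g x + η) ^ d ≤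
          ENNReal.ofReal (ε * m) ^ d := by
      have b1 : ∫⁻ x in closedBall z (5 * ρ), ENNReal.ofReal (g x + η) ^ d ≤
          ENNReal.ofReal 2 ^ d * ((∫⁻ x in closedBall z (5 * ρ), ENNReal.ofReal (g x) ^ d) +
            ENNReal.ofReal η ^ d * volume (closedBall z (5 * ρ))) := by
        refine (lintegral_mono fun y => hpt y).trans (le_of_eq ?_)
        rw [lintegral_const_mul' _ _ (by finiteness), lintegral_add_right _ measurable_const,
          setLIntegral_const]
      have b2 : ENNReal.ofReal ρ ^ d * (ENNReal.ofReal η ^ d * volume (closedBall z (5 * ρ))) ≤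
          ENNReal.ofReal κ ^ d := by
        rw [mul_left_comm, ← ENNReal.ofReal_toReal hLfin, ← hL, ← ENNReal.ofReal_pow hη.le,
          ← ENNReal.ofReal_mul (by positivity), ← ENNReal.ofReal_pow hκ0.le]
        exact ENNReal.ofReal_le_ofReal hηL
      calc ENNReal.ofReal ρ ^ d * ∫⁻ x in closedBall z (5 * ρ), ENNReal.ofReal (g x + η) ^ d
          ≤ ENNReal.ofReal 2 ^ d * ((ENNReal.ofReal ρ ^ d *
              ∫⁻ x in closedBall z (5 * ρ), ENNReal.ofReal (g x) ^ d) +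
              ENNReal.ofReal ρ ^ d * (ENNReal.ofReal η ^ d * volume (closedBall z (5 * ρ)))) := by
            refine (mul_le_mul_right b1 _).trans (le_of_eq ?_)
            ring
        _ ≤ ENNReal.ofReal 2 ^ d * (ENNReal.ofReal κ ^ d + ENNReal.ofReal κ ^ d) := by
            gcongr
        _ ≤ ENNReal.ofReal (ε * m) ^ d := by
            rw [← ENNReal.ofReal_pow (by positivity), ← ENNReal.ofReal_pow (by positivity),
              ← ENNReal.ofReal_pow (by positivity), ← ENNReal.ofReal_add (by positivity)
              (by positivity), ← ENNReal.ofReal_mul (by positivity)]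
            refine ENNReal.ofReal_le_ofReal ?_
            have e1 : ε * m = 2 * 2 * κ := by rw [hκ]; ring
            have e2 : (2 : ℝ) ≤ 2 ^ d := by
              calc (2 : ℝ) = 2 ^ 1 := by norm_num
                _ ≤ 2 ^ d := pow_le_pow_right₀ (by norm_num) hd
            rw [e1, mul_pow (2 * 2) κ, mul_pow 2 2]
            have : 0 < (2 : ℝ) ^ d * κ ^ d := by positivity
            nlinarith
    have hpos : ∀ y ∈ closedBall z (5 * ρ), v y ≤ v y - ψ y + η := fun y hy => by
      have := (abs_le.1 (h1 y (hU hy))).2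
      linarith
    have hB5 : closedBall z ρ ⊆ closedBall z (5 * ρ) := closedBall_subset_closedBall (by linarith)
    have := H V U _ _ (h2.add_const η) hV (hg.add continuousOn_const)
      (fun y => add_nonneg (hg0 y) hη.le) z ρ m hρ hm hU
      (fun y hy => (hv0 y hy).trans (hpos y hy))
      (hhalf.trans (by
        gcongr 2 * volume ?_
        rintro y ⟨hy1, hy2⟩
        exact ⟨hy1, le_trans hy2 (hpos y (hB5 hy1))⟩)) hint' x hx
    have := (abs_le.1 (h1 x (hU (hB5 hx)))).1
    linarith
  refine le_of_forall_pos_le_add fun δ hδ => ?_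
  have := key (min η₀ (δ / 2)) (by positivity) (min_le_left _ _)
  have := min_le_right η₀ (δ / 2)
  linarith

/-- Interior Hölder estimate for functions `u` such that both `u` and `-u` are uniform limits of
supersolutions. -/
theorem exists_holder_estimate {d : ℕ} (hd : 1 ≤ d) {θ : ℝ} (hθ : 1 ≤ θ) :
    ∃ α C : ℝ, 0 < α ∧ α < 1 ∧ 0 < C ∧
      ∀ (V : Set (EuclideanSpace ℝ (Fin d))) (g u : EuclideanSpace ℝ (Fin d) → ℝ),
        IsOpen V → ContinuousOn g V → (∀ x, 0 ≤ g x) →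
        IsApproxSuper θ V g (ball 0 (3 / 4)) u →
        IsApproxSuper θ V g (ball 0 (3 / 4)) (fun x => -u x) →
        ∀ S G : ℝ, 0 ≤ S → 0 ≤ G → (∀ x ∈ ball 0 (3 / 4), |u x| ≤ S) →
        ∫⁻ x in ball 0 (3 / 4), ENNReal.ofReal (g x) ^ d ≤ ENNReal.ofReal G ^ d →
        ∀ x ∈ ball (0 : EuclideanSpace ℝ (Fin d)) (1 / 2),
          ∀ y ∈ ball (0 : EuclideanSpace ℝ (Fin d)) (1 / 2),
          |u x - u y| ≤ C * (S + G) * ‖x - y‖ ^ α := by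
  obtain ⟨ε, c, hε, hc, hc1, H⟩ := exists_approx_lower_bound_of_half hd hθ
  set β : ℝ := max (1 - c / 2) (1 / 2) with hβ
  have hβ1 : β < 1 := max_lt (by linarith) (by norm_num)
  have hβ2 : 1 / 2 ≤ β := le_max_right _ _
  have hβc : 1 - c / 2 ≤ β := le_max_left _ _
  have hβ0 : 0 < β := by linarith
  -- the exponent is chosen so that `(1 / 5) ^ α = β`
  set α : ℝ := Real.log β / Real.log (1 / 5) with hα
  have hlog5 : Real.log (1 / 5) < 0 := Real.log_neg (by norm_num) (by norm_num)
  have hα0 : 0 < α := div_pos_of_neg_of_neg (Real.log_neg hβ0 hβ1) hlog5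
  have hα1 : α < 1 := by
    rw [hα, div_lt_one_of_neg hlog5]
    exact Real.log_lt_log (by norm_num) (by linarith)
  have hαβ : (1 / 5 : ℝ) ^ α = β := by
    rw [Real.rpow_def_of_pos (by norm_num), hα, mul_div_cancel₀ _ hlog5.ne, Real.exp_log hβ0]
  refine ⟨α, 16 * (2 + 2 / ε), hα0, hα1, by positivity, ?_⟩
  intro V g u hV hg hg0 hu hnu S G hS hG hub hint x hx y hy
  set N : ℝ := 2 * S + 2 / ε * G with hN
  have hN0 : 0 ≤ N := by positivity
  have hNle : N ≤ (2 + 2 / ε) * (S + G) := by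
    have : 0 ≤ 2 * G + 2 / ε * S := by positivity
    rw [hN]; linarith
  have hhalf34 : ball (0 : EuclideanSpace ℝ (Fin d)) (1 / 2) ⊆ ball 0 (3 / 4) :=
    ball_subset_ball (by norm_num)
  rcases eq_or_lt_of_le hN0 with hN0' | hNpos
  · have hS0 : S = 0 := by
      have : 0 ≤ 2 / ε * G := by positivity
      linarith
    have h1 := hub x (hhalf34 hx)
    have h2 := hub y (hhalf34 hy)
    rw [hS0, abs_nonpos_iff] at h1 h2
    rw [h1, h2, sub_zero, abs_zero]
    positivity
  have hNG : G ≤ ε * N / 2 := by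
    have : ε * N / 2 = ε * S + G := by rw [hN]; field_simp
    rw [this]; linarith [mul_nonneg hε.le hS]
  set r : ℕ → ℝ := fun k => (1 / 5) ^ k / 8 with hr
  have hrpos : ∀ k, 0 < r k := fun k => by positivity
  have hr8 : ∀ k, r k ≤ 1 / 8 := fun k => by
    simp only [hr]
    have : (1 / 5 : ℝ) ^ k ≤ 1 := pow_le_one₀ (by norm_num) (by norm_num)
    linarith
  have hsub : ∀ k, closedBall x (r k) ⊆ ball 0 (3 / 4) := fun k w hw => by
    have h1 : dist x 0 < 1 / 2 := hx
    have h2 : dist w x ≤ r k := hw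
    rw [mem_ball]
    linarith [dist_triangle w x 0, hr8 k]
  -- `u` oscillates by at most `N βᵏ` on the ball of radius `r k`: on half of the next smaller ball
  -- `u` is above the middle of its range, or it is below, and the lower bound applies to `u - a` or
  -- to its reflection
  have hosc : ∀ k, ∃ a, ∀ w ∈ closedBall x (r k), a ≤ u w ∧ u w ≤ a + N * β ^ k := by
    intro k
    induction k with
    | zero =>
      refine ⟨-S, fun w hw => ?_⟩
      have := abs_le.1 (hub w (hsub 0 hw))
      have : 0 ≤ 2 / ε * G := by positivity
      rw [pow_zero, mul_one, hN]
      constructor <;> linarith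
    | succ k ih =>
      obtain ⟨a, ha⟩ := ih
      set m : ℝ := N * β ^ k / 2 with hm
      have hm0 : 0 < m := by positivity
      have h5 : 5 * r (k + 1) = r k := by simp only [hr, pow_succ]; ring
      have hint' : ENNReal.ofReal (r (k + 1)) ^ d *
          ∫⁻ x in closedBall x (5 * r (k + 1)), ENNReal.ofReal (g x) ^ d ≤
          ENNReal.ofReal (ε * m) ^ d := by
        calc ENNReal.ofReal (r (k + 1)) ^ d *
              ∫⁻ x in closedBall x (5 * r (k + 1)), ENNReal.ofReal (g x) ^ d
            ≤ ENNReal.ofReal (r (k + 1)) ^ d * ENNReal.ofReal G ^ d := by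
              gcongr
              refine le_trans (lintegral_mono_set ?_) hint
              rw [h5]; exact hsub k
          _ = ENNReal.ofReal (r (k + 1) * G) ^ d := by
              rw [← mul_pow, ← ENNReal.ofReal_mul (hrpos _).le]
          _ ≤ ENNReal.ofReal (ε * m) ^ d := by
              refine pow_le_pow_left' (ENNReal.ofReal_le_ofReal ?_) d
              have e1 : r (k + 1) ≤ β ^ k := by
                have : (1 / 5 : ℝ) ^ k ≤ β ^ k := pow_le_pow_left₀ (by norm_num) (by linarith) k
                have : 0 < (1 / 5 : ℝ) ^ k := by positivity
                simp only [hr, pow_succ]; linarith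
              calc r (k + 1) * G ≤ β ^ k * (ε * N / 2) := by gcongr
                _ = ε * m := by rw [hm]; ring
      set B := closedBall x (r (k + 1)) with hB
      have hBsub : B ⊆ closedBall x (r k) := closedBall_subset_closedBall (by
        rw [← h5]; linarith [hrpos (k + 1)])
      have hcov : volume B ≤ volume (B ∩ {w | m ≤ u w + -a}) +
          volume (B ∩ {w | m ≤ -u w + (a + 2 * m)}) := by
        refine (measure_mono fun w hw => ?_).trans (measure_union_le _ _)
        by_cases h : m ≤ u w + -a
        · exact Or.inl ⟨hw, h⟩
        · refine Or.inr ⟨hw, ?_⟩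
          show m ≤ -u w + (a + 2 * m)
          linarith
      have hstep : (2 - c) * m ≤ N * β ^ (k + 1) := by
        have : (2 - c) * m = N * β ^ k * (1 - c / 2) := by rw [hm]; ring
        rw [this, pow_succ, ← mul_assoc]
        gcongr
      have hm2 : a + 2 * m = a + N * β ^ k := by rw [hm]; ring
      rcases le_total (volume (B ∩ {w | m ≤ -u w + (a + 2 * m)}))
          (volume (B ∩ {w | m ≤ u w + -a})) with hle | hle
      · have := H V _ g _ (hu.add_const (-a)) hV hg hg0 x (r (k + 1)) m (hrpos _) hm0
          (by rw [h5]; exact hsub k)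
          (fun w hw => by rw [h5] at hw; linarith [(ha w hw).1])
          (hcov.trans (by rw [two_mul (volume _)]; exact add_le_add le_rfl hle)) hint'
        refine ⟨a + c * m, fun w hw => ⟨by linarith [this w hw], ?_⟩⟩
        linarith [(ha w (hBsub hw)).2]
      · have := H V _ g _ (hnu.add_const (a + 2 * m)) hV hg hg0 x (r (k + 1)) m (hrpos _) hm0
          (by rw [h5]; exact hsub k)
          (fun w hw => by rw [h5] at hw; linarith [(ha w hw).2])
          (hcov.trans (by rw [two_mul (volume _)]; exact add_le_add hle le_rfl)) hint'
        refine ⟨a, fun w hw => ⟨(ha w (hBsub hw)).1, ?_⟩⟩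
        linarith [this w hw]
  -- from dyadic oscillation to the Hölder quotient
  have hfin : ∀ t : ℝ, 0 ≤ t → (8 * t) ^ α ≤ 8 * t ^ α := fun t ht => by
    rw [Real.mul_rpow (by norm_num) ht]
    gcongr
    calc (8 : ℝ) ^ α ≤ 8 ^ (1 : ℝ) := Real.rpow_le_rpow_of_exponent_le (by norm_num) hα1.le
      _ = 8 := Real.rpow_one 8
  have main : |u x - u y| ≤ 2 * N * (8 * ‖x - y‖) ^ α := by
    rcases eq_or_ne x y with rfl | hxy
    · rw [sub_self, abs_zero]; positivity
    have hδ : 0 < ‖x - y‖ := norm_pos_iff.2 (sub_ne_zero.2 hxy)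
    rcases le_or_gt (8 * ‖x - y‖) 1 with hle | hgt
    · obtain ⟨k, hk1, hk2⟩ := exists_nat_pow_near_of_lt_one (x := 8 * ‖x - y‖) (y := (1 / 5 : ℝ))
        (by positivity) hle (by norm_num) (by norm_num)
      obtain ⟨a, ha⟩ := hosc k
      have h1 := ha x (mem_closedBall_self (hrpos k).le)
      have h2 := ha y (by
        rw [mem_closedBall, dist_comm, dist_eq_norm]; simp only [hr]; linarith)
      have h3 : |u x - u y| ≤ N * β ^ k := by rw [abs_le]; constructor <;> linarith
      have h4 : β ^ (k + 1) ≤ (8 * ‖x - y‖) ^ α := by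
        rw [← hαβ, ← Real.rpow_natCast, ← Real.rpow_mul (by norm_num), mul_comm α,
          Real.rpow_mul (by norm_num), Real.rpow_natCast]
        exact Real.rpow_le_rpow (by positivity) hk1.le hα0.le
      have h5 : β ^ k ≤ 2 * β ^ (k + 1) := by
        rw [pow_succ]
        have : 0 < β ^ k := by positivity
        nlinarith
      calc |u x - u y| ≤ N * β ^ k := h3
        _ ≤ N * (2 * (8 * ‖x - y‖) ^ α) := by gcongr; linarith
        _ = _ := by ring
    · have h1 := abs_le.1 (hub x (hhalf34 hx))
      have h2 := abs_le.1 (hub y (hhalf34 hy))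
      have h3 : 1 ≤ (8 * ‖x - y‖) ^ α := Real.one_le_rpow hgt.le hα0.le
      have h4 : |u x - u y| ≤ N := by
        have : 0 ≤ 2 / ε * G := by positivity
        rw [abs_le]; constructor <;> linarith
      nlinarith
  calc |u x - u y| ≤ 2 * N * (8 * ‖x - y‖) ^ α := main
    _ ≤ 2 * ((2 + 2 / ε) * (S + G)) * (8 * ‖x - y‖ ^ α) := by
        gcongr
        exact hfin _ (norm_nonneg _)
    _ = _ := by ring

end WeightedPucci

/-! ### The singular kernel and its primitives -/

namespace WeightedPucci

theorem intervalIntegrable_abs_rpow_neg {a : ℝ} (ha : a < 1) (s t : ℝ) :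
    IntervalIntegrable (fun x : ℝ => |x| ^ (-a)) volume s t := by
  have hpos : ∀ t : ℝ, 0 ≤ t → IntervalIntegrable (fun x : ℝ => |x| ^ (-a)) volume 0 t := by
    intro t ht
    refine (intervalIntegral.intervalIntegrable_rpow' (by linarith : -1 < -a)
      (a := 0) (b := t)).congr ?_
    intro x hx
    rw [uIoc_of_le ht] at hx
    simp only [abs_of_pos hx.1]
  have hall : ∀ t : ℝ, IntervalIntegrable (fun x : ℝ => |x| ^ (-a)) volume 0 t := by
    intro t
    rcases le_total 0 t with ht | ht
    · exact hpos t ht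
    · have h := (IntervalIntegrable.iff_comp_neg (f := fun x : ℝ => |x| ^ (-a)) (a := 0)
        (b := t)).2
      refine h ?_
      simp only [neg_zero, abs_neg]
      exact hpos (-t) (by linarith)
  exact (hall s).symm.trans (hall t)

/-- The kernel `(|t|⁻ᵃ - δ⁻ᵃ)⁺`, with the singularity at `0` cut off at distance `τ`; for `τ = 0`
it is the singular kernel itself (with value `0` at `0`). -/
noncomputable def kernel (a δ τ t : ℝ) : ℝ := max ((max |t| τ) ^ (-a) - δ ^ (-a)) 0

/-- The first primitive of the kernel. -/
noncomputable def kernelInt (a δ τ t : ℝ) : ℝ := ∫ s in (0 : ℝ)..t, kernel a δ τ s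

/-- The second primitive of the kernel. -/
noncomputable def kernelInt₂ (a δ τ t : ℝ) : ℝ := ∫ s in (0 : ℝ)..t, kernelInt a δ τ s

/-- A bound for the integral of the kernel; it tends to `0` with `δ` because `a < 1`. -/
noncomputable def kernelMass (a δ : ℝ) : ℝ := ∫ s in Icc (-δ) δ, |s| ^ (-a)

section Kernel

variable {a δ τ : ℝ}

theorem kernel_nonneg (t : ℝ) : 0 ≤ kernel a δ τ t := le_max_right _ _

theorem measurable_kernel : Measurable (kernel a δ τ) := by
  unfold kernel
  fun_prop

theorem continuous_kernel (hτ : 0 < τ) : Continuous (kernel a δ τ) := by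
  unfold kernel
  refine ((Continuous.rpow_const (by fun_prop) fun x => Or.inl ?_).sub
    continuous_const).max continuous_const
  exact (lt_max_of_lt_right hτ).ne'

theorem kernel_le (ha : 0 < a) (hδ : 0 < δ) {t : ℝ} (ht : t ≠ 0) :
    kernel a δ τ t ≤ (Icc (-δ) δ).indicator (fun s => |s| ^ (-a)) t := by
  have ht' : 0 < |t| := abs_pos.2 ht
  have h1 : (max |t| τ) ^ (-a) ≤ |t| ^ (-a) :=
    Real.rpow_le_rpow_of_nonpos ht' (le_max_left _ _) (by linarith)
  have h2 : 0 < δ ^ (-a) := Real.rpow_pos_of_pos hδ _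
  by_cases h : t ∈ Icc (-δ) δ
  · rw [indicator_of_mem h]
    exact max_le (by linarith) (by positivity)
  · rw [indicator_of_notMem h]
    have hδt : δ ≤ |t| := by
      by_contra hcon
      push Not at hcon
      exact h (abs_le.1 hcon.le)
    have : |t| ^ (-a) ≤ δ ^ (-a) := Real.rpow_le_rpow_of_nonpos hδ hδt (by linarith)
    exact max_le (by linarith) le_rfl

theorem kernel_le_abs_rpow (ha : 0 < a) (hδ : 0 < δ) {t : ℝ} (ht : t ≠ 0) :
    kernel a δ τ t ≤ |t| ^ (-a) :=
  (kernel_le ha hδ ht).trans (indicator_le_self' (fun s _ => by positivity) t)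

theorem kernel_zero_le (ha : 0 < a) {t : ℝ} (ht : t ≠ 0) : kernel a δ τ t ≤ kernel a δ 0 t := by
  have ht' : 0 < |t| := abs_pos.2 ht
  unfold kernel
  rw [max_eq_left ht'.le]
  have h1 : (max |t| τ) ^ (-a) ≤ |t| ^ (-a) :=
    Real.rpow_le_rpow_of_nonpos ht' (le_max_left _ _) (by linarith)
  gcongr

theorem tendsto_kernel {t : ℝ} (ht : t ≠ 0) :
    Tendsto (fun n : ℕ => kernel a δ (1 / (n + 1)) t) atTop (𝓝 (kernel a δ 0 t)) := by
  have ht' : 0 < |t| := abs_pos.2 ht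
  refine tendsto_const_nhds.congr' ?_
  filter_upwards [(tendsto_one_div_add_atTop_nhds_zero_nat (𝕜 := ℝ)).eventually_lt_const ht']
    with n hn
  unfold kernel
  rw [max_eq_left ht'.le, max_eq_left hn.le]

theorem integrable_indicator_abs_rpow (ha1 : a < 1) :
    Integrable ((Icc (-δ) δ).indicator fun s : ℝ => |s| ^ (-a)) := by
  rw [integrable_indicator_iff measurableSet_Icc]
  rcases le_or_gt 0 δ with h | h
  · have := intervalIntegrable_abs_rpow_neg ha1 (-δ) δ
    rwa [intervalIntegrable_iff_integrableOn_Icc_of_le (by linarith)] at this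
  · rw [Icc_eq_empty (by linarith)]; exact integrableOn_empty

theorem ae_ne_zero : ∀ᵐ t : ℝ, t ≠ 0 := by
  simp [ae_iff]

theorem integrable_kernel (ha : 0 < a) (ha1 : a < 1) (hδ : 0 < δ) :
    Integrable (kernel a δ τ) := by
  refine (integrable_indicator_abs_rpow (δ := δ) ha1).mono'
    measurable_kernel.aestronglyMeasurable ?_
  filter_upwards [ae_ne_zero] with t ht
  rw [Real.norm_of_nonneg (kernel_nonneg t)]
  exact kernel_le ha hδ ht

theorem continuous_kernelInt (ha : 0 < a) (ha1 : a < 1) (hδ : 0 < δ) :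
    Continuous (kernelInt a δ τ) :=
  intervalIntegral.continuous_primitive
    (fun _ _ => (integrable_kernel ha ha1 hδ).intervalIntegrable) 0

theorem kernelMass_nonneg : 0 ≤ kernelMass a δ :=
  setIntegral_nonneg measurableSet_Icc fun s _ => by positivity

theorem abs_kernelInt_le (ha : 0 < a) (ha1 : a < 1) (hδ : 0 < δ) (t : ℝ) :
    |kernelInt a δ τ t| ≤ kernelMass a δ := by
  have hi := integrable_kernel (τ := τ) ha ha1 hδ
  unfold kernelInt kernelMass
  rw [← Real.norm_eq_abs]
  refine (intervalIntegral.norm_integral_le_integral_norm_uIoc).trans ?_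
  refine (setIntegral_le_integral hi.norm (Eventually.of_forall fun _ => norm_nonneg _)).trans ?_
  rw [← integral_indicator measurableSet_Icc]
  refine integral_mono_ae hi.norm (integrable_indicator_abs_rpow ha1) ?_
  filter_upwards [ae_ne_zero] with t ht
  rw [Real.norm_of_nonneg (kernel_nonneg t)]
  exact kernel_le ha hδ ht

theorem abs_kernelInt₂_le (ha : 0 < a) (ha1 : a < 1) (hδ : 0 < δ) (t : ℝ) :
    |kernelInt₂ a δ τ t| ≤ kernelMass a δ * |t| := by
  have := intervalIntegral.norm_integral_le_of_norm_le_const (f := kernelInt a δ τ)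
    (a := 0) (b := t) (C := kernelMass a δ) fun x _ => abs_kernelInt_le ha ha1 hδ x
  simpa [kernelInt₂] using this

theorem continuous_kernelInt₂ (ha : 0 < a) (ha1 : a < 1) (hδ : 0 < δ) :
    Continuous (kernelInt₂ a δ τ) :=
  intervalIntegral.continuous_primitive
    (fun _ _ => (continuous_kernelInt ha ha1 hδ).intervalIntegrable _ _) 0

theorem hasDerivAt_kernelInt (hτ : 0 < τ) (t : ℝ) :
    HasDerivAt (kernelInt a δ τ) (kernel a δ τ t) t :=
  (continuous_kernel hτ).integral_hasStrictDerivAt 0 t |>.hasDerivAt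

theorem hasDerivAt_kernelInt₂ (ha : 0 < a) (ha1 : a < 1) (hδ : 0 < δ) (t : ℝ) :
    HasDerivAt (kernelInt₂ a δ τ) (kernelInt a δ τ t) t :=
  (continuous_kernelInt ha ha1 hδ).integral_hasStrictDerivAt 0 t |>.hasDerivAt

theorem tendsto_kernelInt (ha : 0 < a) (ha1 : a < 1) (hδ : 0 < δ) (t : ℝ) :
    Tendsto (fun n : ℕ => kernelInt a δ (1 / (n + 1)) t) atTop (𝓝 (kernelInt a δ 0 t)) := by
  refine intervalIntegral.tendsto_integral_filter_of_dominated_convergence (kernel a δ 0)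
    (Eventually.of_forall fun n => measurable_kernel.aestronglyMeasurable)
    (Eventually.of_forall fun n => ?_) (integrable_kernel ha ha1 hδ).intervalIntegrable ?_
  · filter_upwards [ae_ne_zero] with s hs _
    rw [Real.norm_of_nonneg (kernel_nonneg s)]
    exact kernel_zero_le ha hs
  · filter_upwards [ae_ne_zero] with s hs _ using tendsto_kernel hs

theorem tendsto_kernelInt₂ (ha : 0 < a) (ha1 : a < 1) (hδ : 0 < δ) (t : ℝ) :
    Tendsto (fun n : ℕ => kernelInt₂ a δ (1 / (n + 1)) t) atTop (𝓝 (kernelInt₂ a δ 0 t)) := by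
  refine intervalIntegral.tendsto_integral_filter_of_dominated_convergence
    (fun _ => kernelMass a δ)
    (Eventually.of_forall fun n => (continuous_kernelInt ha ha1 hδ).aestronglyMeasurable)
    (Eventually.of_forall fun n => ?_) intervalIntegrable_const ?_
  · exact Eventually.of_forall fun s _ => abs_kernelInt_le ha ha1 hδ s
  · exact Eventually.of_forall fun s _ => tendsto_kernelInt ha ha1 hδ s

end Kernel

theorem exists_kernelMass_lt {a : ℝ} (ha1 : a < 1) {η : ℝ} (hη : 0 < η) :
    ∃ δ : ℝ, 0 < δ ∧ kernelMass a δ < η := by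
  have hi : Integrable ((Icc (-1 : ℝ) 1).indicator fun s : ℝ => |s| ^ (-a)) :=
    integrable_indicator_abs_rpow ha1
  have hs : Tendsto (fun δ : ℝ => volume (Icc (-δ) δ)) (𝓝[>] 0) (𝓝 0) := by
    simp only [Real.volume_Icc]
    have : Tendsto (fun δ : ℝ => ENNReal.ofReal (δ - -δ)) (𝓝 0) (𝓝 (ENNReal.ofReal (0 - -0))) :=
      (ENNReal.continuous_ofReal.comp (by fun_prop : Continuous fun δ : ℝ => δ - -δ)).tendsto 0
    simp only [neg_zero, sub_zero, ENNReal.ofReal_zero] at this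
    exact this.mono_left nhdsWithin_le_nhds
  have ht := hi.tendsto_setIntegral_nhds_zero hs
  obtain ⟨δ, hδ1, hδ2⟩ := ((ht.eventually_lt_const hη).and
    (Ioc_mem_nhdsGT (zero_lt_one' ℝ))).exists
  refine ⟨δ, hδ2.1, ?_⟩
  rw [setIntegral_congr_fun (g := fun s : ℝ => |s| ^ (-a)) measurableSet_Icc] at hδ1
  · exact hδ1
  · intro s hs
    exact indicator_of_mem (show s ∈ Icc (-1 : ℝ) 1 from
      ⟨by linarith [hs.1, hδ2.2], by linarith [hs.2, hδ2.2]⟩) _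

/-- Negative powers larger than `-1` of a function without critical points are integrable: average
over translations in a direction of growth and change variables on each line. -/
theorem lintegral_rpow_neg_lt_top {d : ℕ} {s c M ρ : ℝ} (hs : s < 1) (hc : 0 < c)
    {x₀ e : EuclideanSpace ℝ (Fin d)} {g : EuclideanSpace ℝ (Fin d) → ℝ} (hg : Continuous g)
    (hdiff : ∀ x ∈ ball x₀ ρ, DifferentiableAt ℝ g x) (hge : ∀ x ∈ ball x₀ ρ, c ≤ fderiv ℝ g x e)
    (hgM : ∀ x ∈ ball x₀ ρ, |g x| ≤ M) :
    ∫⁻ x in ball x₀ ρ, (ENNReal.ofReal |g x|) ^ (-s) < ∞ := by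
  set w : ℝ → ℝ≥0∞ := fun t => (ENNReal.ofReal |t|) ^ (-s) with hw
  have hwm : Measurable w := by simp only [hw]; fun_prop
  set W : ℝ≥0∞ := ∫⁻ t in Icc (-M) M, w t with hW
  have hWfin : W < ∞ := by
    have h1 := (integrable_indicator_abs_rpow (δ := M) hs).2
    rw [HasFiniteIntegral] at h1
    refine lt_of_le_of_lt (le_of_eq ?_) h1
    rw [hW, ← lintegral_indicator measurableSet_Icc]
    refine lintegral_congr_ae ?_
    filter_upwards [ae_ne_zero] with t ht
    by_cases h : t ∈ Icc (-M) M
    · simp only [indicator_of_mem h, hw]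
      rw [ENNReal.ofReal_rpow_of_pos (abs_pos.2 ht), Real.enorm_of_nonneg (by positivity)]
    · simp only [indicator_of_notMem h, enorm_zero]
  set f : EuclideanSpace ℝ (Fin d) → ℝ≥0∞ := (ball x₀ ρ).indicator fun x => w (g x) with hf
  have hfm : Measurable f := (hwm.comp hg.measurable).indicator measurableSet_ball
  have hline : ∀ x, ∫⁻ t in Ioo (0 : ℝ) 1, f (x + t • e) ≤
      (ball x₀ (ρ + ‖e‖)).indicator (fun _ => ENNReal.ofReal c⁻¹ * W) x := by
    intro x
    set I : Set ℝ := Ioo (0 : ℝ) 1 ∩ (fun t : ℝ => x + t • e) ⁻¹' ball x₀ ρ with hI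
    have hIm : MeasurableSet I := measurableSet_Ioo.inter
      (isOpen_ball.preimage (by fun_prop)).measurableSet
    have hIconv : Convex ℝ I := (convex_Ioo 0 1).inter (by
      have : Convex ℝ (ball x₀ ρ) := convex_ball x₀ ρ
      have h2 := this.affine_preimage (AffineMap.lineMap (k := ℝ) x (x + e))
      refine (congrArg (Convex ℝ) ?_).mp h2
      ext t
      simp only [mem_preimage, AffineMap.lineMap_apply, vsub_eq_sub, add_sub_cancel_left,
        vadd_eq_add]
      rw [add_comm])
    have heq : ∫⁻ t in Ioo (0 : ℝ) 1, f (x + t • e) = ∫⁻ t in I, w (g (x + t • e)) := by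
      rw [hI, inter_comm, ← Measure.restrict_restrict
        (isOpen_ball.preimage (by fun_prop)).measurableSet, ← lintegral_indicator
        (isOpen_ball.preimage (by fun_prop)).measurableSet]
      rfl
    rw [heq]
    by_cases hx : x ∈ ball x₀ (ρ + ‖e‖)
    · rw [indicator_of_mem hx]
      set h : ℝ → ℝ := fun t => g (x + t • e) with hh
      set h' : ℝ → ℝ := fun t => fderiv ℝ g (x + t • e) e with hh'
      have hder : ∀ t ∈ I, HasDerivAt h (h' t) t := fun t ht => by
        have h1 : HasDerivAt (fun t : ℝ => x + t • e) e t := by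
          simpa using ((hasDerivAt_id t).smul_const e).const_add x
        exact (hdiff _ ht.2).hasFDerivAt.comp_hasDerivAt t h1
      have hmono : StrictMonoOn h I := by
        refine strictMonoOn_of_deriv_pos hIconv
          (fun t ht => (hder t ht).continuousAt.continuousWithinAt) fun t ht => ?_
        have ht' := interior_subset ht
        rw [(hder t ht').deriv]
        exact lt_of_lt_of_le hc (hge _ ht'.2)
      have hch := lintegral_image_eq_lintegral_abs_deriv_mul hIm
        (fun t ht => (hder t ht).hasDerivWithinAt) hmono.injOn w
      calc ∫⁻ t in I, w (g (x + t • e))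
          ≤ ∫⁻ t in I, ENNReal.ofReal c⁻¹ * (ENNReal.ofReal |h' t| * w (h t)) := by
            refine setLIntegral_mono' hIm fun t ht => ?_
            have h1 : c ≤ |h' t| := (hge _ ht.2).trans (le_abs_self _)
            rw [← mul_assoc, ← ENNReal.ofReal_mul (by positivity)]
            have h2 : 1 ≤ ENNReal.ofReal (c⁻¹ * |h' t|) := by
              rw [ENNReal.one_le_ofReal, inv_mul_eq_div, one_le_div hc]
              exact h1
            calc w (g (x + t • e)) = 1 * w (h t) := by rw [one_mul]
              _ ≤ _ := by gcongr
        _ = ENNReal.ofReal c⁻¹ * ∫⁻ t in h '' I, w t := by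
            rw [lintegral_const_mul' _ _ ENNReal.ofReal_ne_top, hch]
        _ ≤ ENNReal.ofReal c⁻¹ * W := by
            gcongr
            refine lintegral_mono_set ?_
            rintro _ ⟨t, ht, rfl⟩
            exact abs_le.1 (hgM _ ht.2)
    · rw [indicator_of_notMem hx]
      have : I = ∅ := by
        refine eq_empty_of_forall_notMem fun t ht => hx ?_
        have h1 : dist (x + t • e) x₀ < ρ := ht.2
        have h2 : dist x (x + t • e) ≤ ‖e‖ := by
          rw [dist_self_add_right, norm_smul, Real.norm_eq_abs, abs_of_pos ht.1.1]
          exact mul_le_of_le_one_left (norm_nonneg _) ht.1.2.le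
        rw [mem_ball]
        linarith [dist_triangle x (x + t • e) x₀]
      rw [this]; simp
  have hshift : ∀ t : ℝ, ∫⁻ x, f (x + t • e) = ∫⁻ x, f x := fun t =>
    lintegral_add_right_eq_self f (t • e)
  have hunc : AEMeasurable (Function.uncurry fun (t : ℝ) (x : EuclideanSpace ℝ (Fin d)) =>
      f (x + t • e)) ((volume.restrict (Ioo (0 : ℝ) 1)).prod volume) := by
    refine (hfm.comp ?_).aemeasurable
    fun_prop
  calc ∫⁻ x in ball x₀ ρ, (ENNReal.ofReal |g x|) ^ (-s)
      = ∫⁻ x, f x := by rw [hf, lintegral_indicator measurableSet_ball]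
    _ = ∫⁻ t in Ioo (0 : ℝ) 1, ∫⁻ x, f (x + t • e) := by
        simp_rw [hshift]
        rw [setLIntegral_const]; simp
    _ = ∫⁻ x, ∫⁻ t in Ioo (0 : ℝ) 1, f (x + t • e) := lintegral_lintegral_swap hunc
    _ ≤ ∫⁻ x, (ball x₀ (ρ + ‖e‖)).indicator (fun _ => ENNReal.ofReal c⁻¹ * W) x :=
        lintegral_mono hline
    _ < ∞ := by
        rw [lintegral_indicator measurableSet_ball, setLIntegral_const]
        exact ENNReal.mul_lt_top (ENNReal.mul_lt_top ENNReal.ofReal_lt_top hWfin)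
          measure_ball_lt_top

/-- Weak derivatives pass to dominated limits. -/
theorem isWeakPartial_of_tendsto {d : ℕ} {U : Set (EuclideanSpace ℝ (Fin d))} {i : Fin d}
    {Φ : ℕ → EuclideanSpace ℝ (Fin d) → ℝ} {φ g b : EuclideanSpace ℝ (Fin d) → ℝ}
    (hΦ : ∀ n, ContDiff ℝ 1 (Φ n)) (hb : LocallyIntegrable b)
    (hφb : ∀ n, ∀ᵐ x, |Φ n x| ≤ b x)
    (hgb : ∀ n, ∀ᵐ x, |fderiv ℝ (Φ n) x (EuclideanSpace.single i 1)| ≤ b x)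
    (hφ : ∀ᵐ x, Tendsto (fun n => Φ n x) atTop (𝓝 (φ x)))
    (hg : ∀ᵐ x, Tendsto (fun n => fderiv ℝ (Φ n) x (EuclideanSpace.single i 1)) atTop (𝓝 (g x))) :
    IsWeakPartial U i φ g := by
  intro ψ hψ hψc hψU
  have hψ1 : ContDiff ℝ 1 ψ := hψ.of_le (by exact_mod_cast le_top)
  have hψd : Continuous fun x => fderiv ℝ ψ x (EuclideanSpace.single i 1) :=
    (hψ1.continuous_fderiv one_ne_zero).clm_apply continuous_const
  have hψdc : HasCompactSupport fun x => fderiv ℝ ψ x (EuclideanSpace.single i 1) :=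
    hψc.fderiv_apply ℝ _
  have hoff : ∀ x, x ∉ U → ψ x = 0 := fun x hx => image_eq_zero_of_notMem_tsupport
    fun h => hx (hψU h)
  have hoffd : ∀ x, x ∉ U → fderiv ℝ ψ x (EuclideanSpace.single i 1) = 0 := fun x hx => by
    have : x ∉ tsupport ψ := fun h => hx (hψU h)
    rw [fderiv_of_notMem_tsupport ℝ this]; simp
  rw [setIntegral_eq_integral_of_forall_compl_eq_zero (fun x hx => by rw [hoffd x hx, mul_zero]),
    setIntegral_eq_integral_of_forall_compl_eq_zero (fun x hx => by rw [hoff x hx, mul_zero])]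
  have hΦd : ∀ n, Continuous fun x => fderiv ℝ (Φ n) x (EuclideanSpace.single i 1) := fun n =>
    ((hΦ n).continuous_fderiv one_ne_zero).clm_apply continuous_const
  have hparts : ∀ n, ∫ x, Φ n x * fderiv ℝ ψ x (EuclideanSpace.single i 1) =
      -∫ x, fderiv ℝ (Φ n) x (EuclideanSpace.single i 1) * ψ x := fun n =>
    integral_mul_fderiv_eq_neg_fderiv_mul_of_integrable
      (((hΦd n).mul hψ.continuous).integrable_of_hasCompactSupport hψc.mul_left)
      (((hΦ n).continuous.mul hψd).integrable_of_hasCompactSupport hψdc.mul_left)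
      (((hΦ n).continuous.mul hψ.continuous).integrable_of_hasCompactSupport hψc.mul_left)
      (fun x _ => (hΦ n).differentiable one_ne_zero x)
      (fun x _ => hψ1.differentiable one_ne_zero x)
  have l1 : Tendsto (fun n => ∫ x, Φ n x * fderiv ℝ ψ x (EuclideanSpace.single i 1)) atTop
      (𝓝 (∫ x, φ x * fderiv ℝ ψ x (EuclideanSpace.single i 1))) := by
    refine tendsto_integral_of_dominated_convergence
      (fun x => |fderiv ℝ ψ x (EuclideanSpace.single i 1)| • b x)
      (fun n => ((hΦ n).continuous.mul hψd).aestronglyMeasurable)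
      (hb.integrable_smul_left_of_hasCompactSupport hψd.abs hψdc.abs) (fun n => ?_) ?_
    · filter_upwards [hφb n] with x hx
      rw [norm_mul, Real.norm_eq_abs, Real.norm_eq_abs, smul_eq_mul, mul_comm]
      gcongr
    · filter_upwards [hφ] with x hx using hx.mul_const _
  have l2 : Tendsto (fun n => ∫ x, fderiv ℝ (Φ n) x (EuclideanSpace.single i 1) * ψ x) atTop
      (𝓝 (∫ x, g x * ψ x)) := by
    refine tendsto_integral_of_dominated_convergence (fun x => |ψ x| • b x)
      (fun n => ((hΦd n).mul hψ.continuous).aestronglyMeasurable)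
      (hb.integrable_smul_left_of_hasCompactSupport hψ.continuous.abs hψc.abs) (fun n => ?_) ?_
    · filter_upwards [hgb n] with x hx
      rw [norm_mul, Real.norm_eq_abs, Real.norm_eq_abs, smul_eq_mul, mul_comm]
      gcongr
    · filter_upwards [hg] with x hx using hx.mul_const _
  refine tendsto_nhds_unique l1 ?_
  simp_rw [hparts]
  exact l2.neg

end WeightedPucci

/-! ### Partial derivatives, elliptic matrices, and local equations of hypersurfaces -/

namespace WeightedPucci

/-- The partial derivative in the `i`-th coordinate direction. -/
noncomputable def partialDeriv {d : ℕ} (i : Fin d) (f : EuclideanSpace ℝ (Fin d) → ℝ)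
    (x : EuclideanSpace ℝ (Fin d)) : ℝ :=
  fderiv ℝ f x (EuclideanSpace.single i 1)

section PartialDeriv

variable {d : ℕ} {i : Fin d} {f g : EuclideanSpace ℝ (Fin d) → ℝ} {x : EuclideanSpace ℝ (Fin d)}

theorem contDiff_partialDeriv {n m : WithTop ℕ∞} (hf : ContDiff ℝ n f) (hmn : m + 1 ≤ n) :
    ContDiff ℝ m (partialDeriv i f) :=
  (hf.fderiv_right hmn).clm_apply contDiff_const

theorem continuous_partialDeriv {n : WithTop ℕ∞} (hf : ContDiff ℝ n f) (hn : 1 ≤ n) :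
    Continuous (partialDeriv i f) :=
  (contDiff_partialDeriv (m := 0) hf (by simpa using hn)).continuous

theorem partialDeriv_add (hf : DifferentiableAt ℝ f x) (hg : DifferentiableAt ℝ g x) :
    partialDeriv i (fun y => f y + g y) x = partialDeriv i f x + partialDeriv i g x := by
  have := (hf.hasFDerivAt.add hg.hasFDerivAt).fderiv
  unfold partialDeriv
  rw [show (fun y => f y + g y) = f + g from rfl, this]
  simp

theorem partialDeriv_mul (hf : DifferentiableAt ℝ f x) (hg : DifferentiableAt ℝ g x) :
    partialDeriv i (fun y => f y * g y) x =
      partialDeriv i f x * g x + f x * partialDeriv i g x := by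
  have := (hf.hasFDerivAt.mul hg.hasFDerivAt).fderiv
  unfold partialDeriv
  rw [show (fun y => f y * g y) = f * g from rfl, this]
  simp
  ring

theorem partialDeriv_comp {F : ℝ → ℝ} {F' : ℝ} (hF : HasDerivAt F F' (g x))
    (hg : DifferentiableAt ℝ g x) :
    partialDeriv i (fun y => F (g y)) x = F' * partialDeriv i g x := by
  have := (hF.comp_hasFDerivAt x hg.hasFDerivAt).fderiv
  unfold partialDeriv
  rw [show (fun y => F (g y)) = F ∘ g from rfl, this]
  simp

theorem partialDeriv_eq_zero (hx : x ∉ tsupport f) : partialDeriv i f x = 0 := by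
  unfold partialDeriv
  rw [fderiv_of_notMem_tsupport ℝ hx]; simp

theorem tsupport_partialDeriv_subset : tsupport (partialDeriv i f) ⊆ tsupport f := by
  refine closure_minimal (fun x hx => ?_) (isClosed_tsupport f)
  by_contra h
  exact hx (partialDeriv_eq_zero h)

theorem fderiv_apply_eq_sum (e : EuclideanSpace ℝ (Fin d)) :
    fderiv ℝ f x e = ∑ i, e i * partialDeriv i f x := by
  conv_lhs => rw [← (EuclideanSpace.basisFun (Fin d) ℝ).sum_repr e]
  simp [partialDeriv]

end PartialDeriv

section Elliptic

variable {d : ℕ} {lam Lam : ℝ} {A : Matrix (Fin d) (Fin d) ℝ}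

theorem mul_dotProduct_le_of_mem_ellipticMatrices (hA : A ∈ ellipticMatrices d lam Lam)
    (v : Fin d → ℝ) :
    lam * (v ⬝ᵥ v) ≤ v ⬝ᵥ A.mulVec v ∧ v ⬝ᵥ A.mulVec v ≤ Lam * (v ⬝ᵥ v) := by
  have h1 := hA.1.dotProduct_mulVec_nonneg v
  have h2 := hA.2.dotProduct_mulVec_nonneg v
  simp only [star_trivial, Matrix.sub_mulVec, Matrix.smul_mulVec, Matrix.one_mulVec,
    dotProduct_sub, dotProduct_smul, smul_eq_mul] at h1 h2
  constructor <;> linarith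

theorem abs_apply_le_of_mem_ellipticMatrices (hlam : 0 < lam) (hA : A ∈ ellipticMatrices d lam Lam)
    (i j : Fin d) : |A i j| ≤ Lam := by
  have hsymm : A j i = A i j := by
    have h1 := hA.1.isHermitian
    have h2 : A.IsHermitian := by
      have := h1.add ((Matrix.isHermitian_one (n := Fin d) (α := ℝ)).smul
        (show IsSelfAdjoint lam from rfl))
      simpa using this
    simpa using h2.apply i j
  have hdiag : ∀ i, lam ≤ A i i ∧ A i i ≤ Lam := fun i => by
    have := mul_dotProduct_le_of_mem_ellipticMatrices hA (Pi.single i 1)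
    simpa using this
  rcases eq_or_ne i j with rfl | hij
  · rw [abs_of_nonneg (hlam.le.trans (hdiag i).1)]
    exact (hdiag i).2
  have hp := (mul_dotProduct_le_of_mem_ellipticMatrices hA (Pi.single i 1 + Pi.single j 1)).1
  have hm := (mul_dotProduct_le_of_mem_ellipticMatrices hA (Pi.single i 1 - Pi.single j 1)).1
  simp only [Matrix.mulVec_add, Matrix.mulVec_sub, add_dotProduct, dotProduct_add, sub_dotProduct,
    dotProduct_sub, single_one_dotProduct, Matrix.mulVec_single_one, Matrix.col_apply,
    Pi.single_eq_same, Pi.single_eq_of_ne hij, Pi.single_eq_of_ne hij.symm, hsymm] at hp hm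
  have h1 := hdiag i
  have h2 := hdiag j
  rw [abs_le]
  constructor <;> linarith

theorem abs_trace_mul_le (hlam : 0 < lam) (hA : A ∈ ellipticMatrices d lam Lam)
    {R : Matrix (Fin d) (Fin d) ℝ} {s : ℝ} (hR : ∀ i j, |R i j| ≤ s) :
    |(A * R).trace| ≤ d * (d * (Lam * s)) := by
  simp only [Matrix.trace, Matrix.diag, Matrix.mul_apply]
  refine (Finset.abs_sum_le_sum_abs _ _).trans ?_
  calc ∑ i, |∑ j, A i j * R j i| ≤ ∑ _i : Fin d, ∑ _j : Fin d, Lam * s := by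
        refine Finset.sum_le_sum fun i _ => (Finset.abs_sum_le_sum_abs _ _).trans ?_
        refine Finset.sum_le_sum fun j _ => ?_
        rw [abs_mul]
        have h1 := abs_apply_le_of_mem_ellipticMatrices hlam hA i j
        exact mul_le_mul h1 (hR j i) (abs_nonneg _) ((abs_nonneg _).trans h1)
    _ = _ := by simp

theorem trace_mul_vecMulVec_self (v : Fin d → ℝ) :
    (A * Matrix.vecMulVec v v).trace = v ⬝ᵥ A.mulVec v := by
  rw [Matrix.mul_vecMulVec, Matrix.trace_vecMulVec, dotProduct_comm]

theorem trace_le_of_mem_ellipticMatrices (hlam : 0 < lam) (hA : A ∈ ellipticMatrices d lam Lam) :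
    A.trace ≤ d * Lam := by
  simp only [Matrix.trace, Matrix.diag]
  calc ∑ i, A i i ≤ ∑ _i : Fin d, Lam := Finset.sum_le_sum fun i _ =>
        (le_abs_self _).trans (abs_apply_le_of_mem_ellipticMatrices hlam hA i i)
    _ = _ := by simp

theorem smul_one_mem_ellipticMatrices (hLam : lam ≤ Lam) :
    lam • (1 : Matrix (Fin d) (Fin d) ℝ) ∈ ellipticMatrices d lam Lam := by
  refine ⟨by rw [sub_self]; exact Matrix.PosSemidef.zero, ?_⟩
  rw [← sub_smul]
  exact Matrix.PosSemidef.one.smul (by linarith)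

end Elliptic

/-- Near each of its points, a smooth hypersurface is contained in the zero set of a globally
smooth function that grows at a definite rate in a fixed direction. -/
theorem IsSmoothHypersurface.exists_local_function {d : ℕ} {Γ : Set (EuclideanSpace ℝ (Fin d))}
    (hΓ : IsSmoothHypersurface Γ) {x₀ : EuclideanSpace ℝ (Fin d)} (hx₀ : x₀ ∈ Γ) :
    ∃ (g : EuclideanSpace ℝ (Fin d) → ℝ) (e : EuclideanSpace ℝ (Fin d)) (ρ c M L : ℝ),
      ContDiff ℝ 2 g ∧ 0 < ρ ∧ 0 < c ∧ 0 < L ∧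
      (∀ x ∈ ball x₀ ρ, c ≤ fderiv ℝ g x e) ∧ (∀ x ∈ ball x₀ ρ, |g x| ≤ M) ∧
      (∀ x ∈ ball x₀ ρ, ∀ y ∈ ball x₀ ρ, |g x - g y| ≤ L * ‖x - y‖) ∧
      ∀ x ∈ Γ ∩ ball x₀ ρ, g x = 0 := by
  obtain ⟨U, g₀, hU, hxU, hg₀, hne, hΓU⟩ := hΓ x₀ hx₀
  obtain ⟨R, hR, hRU⟩ := Metric.isOpen_iff.1 hU x₀ hxU
  let b : ContDiffBump x₀ := ⟨R / 4, R / 2, by positivity, by linarith⟩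
  have hbU : tsupport b ⊆ U := by
    rw [b.tsupport_eq]
    exact (closedBall_subset_ball (by show R / 2 < R; linarith)).trans hRU
  set g : EuclideanSpace ℝ (Fin d) → ℝ := fun x => b x * g₀ x with hg
  have hgs : ContDiff ℝ 2 g := by
    rw [contDiff_iff_contDiffAt]
    intro x
    by_cases hx : x ∈ U
    · refine b.contDiff.contDiffAt.mul ((hg₀.contDiffAt (hU.mem_nhds hx)).of_le ?_)
      exact_mod_cast (le_top : (2 : ℕ∞) ≤ ⊤)
    · have h0 : ∀ᶠ y in 𝓝 x, g y = 0 := by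
        have : (tsupport b)ᶜ ∈ 𝓝 x :=
          (isClosed_tsupport _).isOpen_compl.mem_nhds fun h => hx (hbU h)
        filter_upwards [this] with y hy
        simp only [hg, image_eq_zero_of_notMem_tsupport hy, zero_mul]
      exact contDiffAt_const.congr_of_eventuallyEq h0
  have hgg : ∀ x ∈ ball x₀ (R / 4), g x = g₀ x := fun x hx => by
    simp only [hg]
    rw [b.one_of_mem_closedBall (ball_subset_closedBall hx), one_mul]
  have hfd : fderiv ℝ g x₀ = fderiv ℝ g₀ x₀ := by
    refine Filter.EventuallyEq.fderiv_eq ?_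
    filter_upwards [ball_mem_nhds x₀ (by positivity : 0 < R / 4)] with x hx using hgg x hx
  obtain ⟨e, he⟩ : ∃ e, 0 < fderiv ℝ g x₀ e := by
    obtain ⟨e, he⟩ : ∃ e, fderiv ℝ g x₀ e ≠ 0 := by
      by_contra hcon
      push Not at hcon
      exact hne x₀ hxU (by rw [← hfd]; ext y; simp [hcon y])
    rcases lt_or_gt_of_ne he with h | h
    · exact ⟨-e, by rw [map_neg]; linarith⟩
    · exact ⟨e, h⟩
  have hcont : Continuous fun x => fderiv ℝ g x e :=
    (hgs.continuous_fderiv two_ne_zero).clm_apply continuous_const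
  have hev : ∀ᶠ x in 𝓝 x₀, fderiv ℝ g x₀ e / 2 < fderiv ℝ g x e :=
    hcont.continuousAt.eventually_const_lt (by linarith)
  obtain ⟨r, hr, hrb⟩ := Metric.eventually_nhds_iff_ball.1 hev
  obtain ⟨M, hM⟩ := (isCompact_closedBall x₀ (min r (R / 4))).exists_bound_of_continuousOn
    hgs.continuous.continuousOn
  obtain ⟨L, hL⟩ := (isCompact_closedBall x₀ (min r (R / 4))).exists_bound_of_continuousOn
    (hgs.continuous_fderiv two_ne_zero).continuousOn
  refine ⟨g, e, min r (R / 4), fderiv ℝ g x₀ e / 2, M, max L 1, hgs, by positivity, by positivity,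
    by positivity, fun x hx => (hrb x (ball_subset_ball (min_le_left _ _) hx)).le,
    fun x hx => hM x (ball_subset_closedBall hx), ?_, ?_⟩
  · intro x hx y hy
    exact (convex_ball x₀ _).norm_image_sub_le_of_norm_fderiv_le
      (fun z _ => hgs.differentiable two_ne_zero z)
      (fun z hz => (hL z (ball_subset_closedBall hz)).trans (le_max_left _ _)) hy hx
  · rintro x ⟨hxΓ, hx⟩
    have hx4 := ball_subset_ball (min_le_right r (R / 4)) hx
    rw [hgg x hx4]
    have : x ∈ Γ ∩ U := ⟨hxΓ, hRU (ball_subset_ball (by linarith) hx4)⟩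
    rw [hΓU] at this
    exact this.2

end WeightedPucci

/-! ### A test function with singular Hessian near a hypersurface -/

namespace WeightedPucci

/-- The correction `χ · F(g)`, where `F''` is the kernel: it vanishes with the first derivatives of
`F` as `δ → 0`, while its Hessian blows up like `|g|⁻ᵃ` in the direction of `∇g`. -/
noncomputable def patch {d : ℕ} (χ g : EuclideanSpace ℝ (Fin d) → ℝ) (a δ τ : ℝ)
    (x : EuclideanSpace ℝ (Fin d)) : ℝ :=
  χ x * kernelInt₂ a δ τ (g x)

/-- The gradient of `patch`. -/
noncomputable def patchGrad {d : ℕ} (χ g : EuclideanSpace ℝ (Fin d) → ℝ) (a δ τ : ℝ) (i : Fin d)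
    (x : EuclideanSpace ℝ (Fin d)) : ℝ :=
  partialDeriv i χ x * kernelInt₂ a δ τ (g x) +
    χ x * (kernelInt a δ τ (g x) * partialDeriv i g x)

/-- The part of the Hessian of `patch` that contains the two primitives of the kernel only. -/
noncomputable def patchHessReg {d : ℕ} (χ g : EuclideanSpace ℝ (Fin d) → ℝ) (a δ τ : ℝ)
    (x : EuclideanSpace ℝ (Fin d)) (i j : Fin d) : ℝ :=
  partialDeriv j (partialDeriv i χ) x * kernelInt₂ a δ τ (g x) +
    (partialDeriv i χ x * partialDeriv j g x + partialDeriv j χ x * partialDeriv i g x +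
      χ x * partialDeriv j (partialDeriv i g) x) * kernelInt a δ τ (g x)

/-- The Hessian of `patch`. -/
noncomputable def patchHess {d : ℕ} (χ g : EuclideanSpace ℝ (Fin d) → ℝ) (a δ τ : ℝ)
    (x : EuclideanSpace ℝ (Fin d)) : Matrix (Fin d) (Fin d) ℝ :=
  Matrix.of (patchHessReg χ g a δ τ x) + (χ x * kernel a δ τ (g x)) •
    Matrix.vecMulVec (fun i => partialDeriv i g x) fun i => partialDeriv i g x

section Patch

variable {d : ℕ} {χ g : EuclideanSpace ℝ (Fin d) → ℝ} {a δ τ : ℝ}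

theorem patchHess_apply (x : EuclideanSpace ℝ (Fin d)) (i j : Fin d) :
    patchHess χ g a δ τ x i j = patchHessReg χ g a δ τ x i j +
      χ x * kernel a δ τ (g x) * (partialDeriv i g x * partialDeriv j g x) := by
  simp [patchHess, Matrix.vecMulVec_apply]

theorem contDiff_kernelInt (hτ : 0 < τ) : ContDiff ℝ 1 (kernelInt a δ τ) := by
  rw [contDiff_one_iff_deriv]
  refine ⟨fun t => (hasDerivAt_kernelInt hτ t).differentiableAt, ?_⟩
  rw [funext fun t => (hasDerivAt_kernelInt (a := a) (δ := δ) hτ t).deriv]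
  exact continuous_kernel hτ

theorem contDiff_kernelInt₂ (ha : 0 < a) (ha1 : a < 1) (hδ : 0 < δ) :
    ContDiff ℝ 1 (kernelInt₂ a δ τ) := by
  rw [contDiff_one_iff_deriv]
  refine ⟨fun t => (hasDerivAt_kernelInt₂ ha ha1 hδ t).differentiableAt, ?_⟩
  rw [funext fun t => (hasDerivAt_kernelInt₂ (a := a) (δ := δ) (τ := τ) ha ha1 hδ t).deriv]
  exact continuous_kernelInt ha ha1 hδ

theorem contDiff_patch (ha : 0 < a) (ha1 : a < 1) (hδ : 0 < δ) (hχ : ContDiff ℝ 2 χ)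
    (hg : ContDiff ℝ 2 g) : ContDiff ℝ 1 (patch χ g a δ τ) :=
  (hχ.of_le one_le_two).mul ((contDiff_kernelInt₂ ha ha1 hδ).comp (hg.of_le one_le_two))

theorem contDiff_patchGrad (ha : 0 < a) (ha1 : a < 1) (hδ : 0 < δ) (hτ : 0 < τ)
    (hχ : ContDiff ℝ 2 χ) (hg : ContDiff ℝ 2 g) (i : Fin d) :
    ContDiff ℝ 1 (patchGrad χ g a δ τ i) := by
  have h1 : ContDiff ℝ 1 (partialDeriv i χ) := contDiff_partialDeriv hχ (by norm_num)
  have h2 : ContDiff ℝ 1 (partialDeriv i g) := contDiff_partialDeriv hg (by norm_num)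
  exact (h1.mul ((contDiff_kernelInt₂ ha ha1 hδ).comp (hg.of_le one_le_two))).add
    ((hχ.of_le one_le_two).mul (((contDiff_kernelInt hτ).comp (hg.of_le one_le_two)).mul h2))

theorem partialDeriv_patch (ha : 0 < a) (ha1 : a < 1) (hδ : 0 < δ) (hχ : ContDiff ℝ 2 χ)
    (hg : ContDiff ℝ 2 g) (i : Fin d) (x : EuclideanSpace ℝ (Fin d)) :
    partialDeriv i (patch χ g a δ τ) x = patchGrad χ g a δ τ i x := by
  have hgd := hg.differentiable two_ne_zero x
  have hF := hasDerivAt_kernelInt₂ (τ := τ) ha ha1 hδ (g x)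
  have hFg : DifferentiableAt ℝ (fun y => kernelInt₂ a δ τ (g y)) x :=
    hF.differentiableAt.comp x hgd
  unfold patch patchGrad
  rw [partialDeriv_mul (hχ.differentiable two_ne_zero x) hFg, partialDeriv_comp hF hgd]

theorem partialDeriv_patchGrad (ha : 0 < a) (ha1 : a < 1) (hδ : 0 < δ) (hτ : 0 < τ)
    (hχ : ContDiff ℝ 2 χ) (hg : ContDiff ℝ 2 g) (i j : Fin d) (x : EuclideanSpace ℝ (Fin d)) :
    partialDeriv j (patchGrad χ g a δ τ i) x = patchHess χ g a δ τ x i j := by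
  have hχd := hχ.differentiable two_ne_zero x
  have hgd := hg.differentiable two_ne_zero x
  have hF := hasDerivAt_kernelInt₂ (τ := τ) ha ha1 hδ (g x)
  have hF' := hasDerivAt_kernelInt (a := a) (δ := δ) hτ (g x)
  have hχi : DifferentiableAt ℝ (partialDeriv i χ) x :=
    (contDiff_partialDeriv (m := 1) hχ (by norm_num)).differentiable one_ne_zero x
  have hgi : DifferentiableAt ℝ (partialDeriv i g) x :=
    (contDiff_partialDeriv (m := 1) hg (by norm_num)).differentiable one_ne_zero x
  have hFg : DifferentiableAt ℝ (fun y => kernelInt₂ a δ τ (g y)) x :=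
    hF.differentiableAt.comp x hgd
  have hF'g : DifferentiableAt ℝ (fun y => kernelInt a δ τ (g y)) x :=
    hF'.differentiableAt.comp x hgd
  have h1 : DifferentiableAt ℝ (fun y => partialDeriv i χ y * kernelInt₂ a δ τ (g y)) x :=
    hχi.mul hFg
  have h2 : DifferentiableAt ℝ (fun y => kernelInt a δ τ (g y) * partialDeriv i g y) x :=
    hF'g.mul hgi
  have h3 : DifferentiableAt ℝ
      (fun y => χ y * (kernelInt a δ τ (g y) * partialDeriv i g y)) x := hχd.mul h2
  rw [patchHess_apply]
  unfold patchGrad patchHessReg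
  rw [partialDeriv_add h1 h3, partialDeriv_mul hχi hFg, partialDeriv_mul hχd h2,
    partialDeriv_mul hF'g hgi, partialDeriv_comp hF hgd,
    partialDeriv_comp hF' hgd]
  ring

/-- A common bound, uniform in the cut-off and linear in the kernel mass, for the correction and
the regular part of its Hessian. -/
theorem exists_patch_bound (ha : 0 < a) (ha1 : a < 1) (hχ : ContDiff ℝ 2 χ)
    (hχc : HasCompactSupport χ) (hg : ContDiff ℝ 2 g) :
    ∃ B : ℝ, 0 ≤ B ∧ ∀ δ τ, 0 < δ → ∀ x, |patch χ g a δ τ x| ≤ kernelMass a δ * B ∧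
      ∀ i j, |patchHessReg χ g a δ τ x i j| ≤ kernelMass a δ * B := by
  have hχi : ∀ i, Continuous (partialDeriv i χ) := fun i => continuous_partialDeriv hχ one_le_two
  have hgi : ∀ i, Continuous (partialDeriv i g) := fun i => continuous_partialDeriv hg one_le_two
  have hχij : ∀ i j, Continuous (partialDeriv j (partialDeriv i χ)) := fun i j =>
    continuous_partialDeriv (contDiff_partialDeriv (m := 1) hχ (by norm_num)) le_rfl
  have hgij : ∀ i j, Continuous (partialDeriv j (partialDeriv i g)) := fun i j =>
    continuous_partialDeriv (contDiff_partialDeriv (m := 1) hg (by norm_num)) le_rfl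
  have hχ0 := hχ.continuous
  have hg0 := hg.continuous
  set m : Fin d → Fin d → EuclideanSpace ℝ (Fin d) → ℝ := fun i j x =>
    |partialDeriv j (partialDeriv i χ) x| * |g x| +
      (|partialDeriv i χ x| * |partialDeriv j g x| + |partialDeriv j χ x| * |partialDeriv i g x| +
      |χ x| * |partialDeriv j (partialDeriv i g) x|) with hm
  have hm0 : ∀ i j x, 0 ≤ m i j x := fun i j x => by simp only [hm]; positivity
  set s : EuclideanSpace ℝ (Fin d) → ℝ := fun x => |χ x| * |g x| + ∑ i, ∑ j, m i j x with hs
  have hsc : Continuous s := by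
    simp only [hs, hm]
    refine (hχ0.abs.mul hg0.abs).add (continuous_finsetSum _ fun i _ =>
      continuous_finsetSum _ fun j _ => ?_)
    exact ((hχij i j).abs.mul hg0.abs).add ((((hχi i).abs.mul (hgi j).abs).add
      ((hχi j).abs.mul (hgi i).abs)).add (hχ0.abs.mul (hgij i j).abs))
  have hss : HasCompactSupport s := HasCompactSupport.intro hχc fun x hx => by
    have e1 : χ x = 0 := image_eq_zero_of_notMem_tsupport hx
    have e2 : ∀ i, partialDeriv i χ x = 0 := fun i => partialDeriv_eq_zero hx
    have e3 : ∀ i j, partialDeriv j (partialDeriv i χ) x = 0 := fun i j =>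
      partialDeriv_eq_zero fun h => hx (tsupport_partialDeriv_subset h)
    simp [hs, hm, e1, e2, e3]
  obtain ⟨B, hB⟩ := hss.exists_bound_of_continuous hsc
  have hmB : ∀ i j x, m i j x ≤ B := fun i j x => by
    refine le_trans ?_ ((le_abs_self _).trans (hB x))
    have h1 : m i j x ≤ ∑ j, m i j x :=
      Finset.single_le_sum (f := fun j => m i j x) (fun j _ => hm0 i j x) (Finset.mem_univ j)
    have h2 : ∑ j, m i j x ≤ ∑ i, ∑ j, m i j x :=
      Finset.single_le_sum (f := fun i => ∑ j, m i j x)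
        (fun i _ => Finset.sum_nonneg fun j _ => hm0 i j x) (Finset.mem_univ i)
    have h3 : 0 ≤ |χ x| * |g x| := by positivity
    simp only [hs]; linarith
  have hχB : ∀ x, |χ x| * |g x| ≤ B := fun x => by
    refine le_trans ?_ ((le_abs_self _).trans (hB x))
    have : 0 ≤ ∑ i, ∑ j, m i j x :=
      Finset.sum_nonneg fun i _ => Finset.sum_nonneg fun j _ => hm0 i j x
    simp only [hs]; linarith
  refine ⟨B, (norm_nonneg _).trans (hB 0), fun δ τ hδ x => ?_⟩
  have k2 := abs_kernelInt₂_le (τ := τ) ha ha1 hδ (g x)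
  have k1 := abs_kernelInt_le (τ := τ) ha ha1 hδ (g x)
  have k0 := kernelMass_nonneg (a := a) (δ := δ)
  refine ⟨?_, fun i j => ?_⟩
  · unfold patch
    rw [abs_mul]
    calc |χ x| * |kernelInt₂ a δ τ (g x)| ≤ |χ x| * (kernelMass a δ * |g x|) := by gcongr
      _ = kernelMass a δ * (|χ x| * |g x|) := by ring
      _ ≤ _ := by gcongr; exact hχB x
  · unfold patchHessReg
    calc _ ≤ |partialDeriv j (partialDeriv i χ) x| * (kernelMass a δ * |g x|) +
          (|partialDeriv i χ x| * |partialDeriv j g x| +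
            |partialDeriv j χ x| * |partialDeriv i g x| +
            |χ x| * |partialDeriv j (partialDeriv i g) x|) * kernelMass a δ := by
          refine (abs_add_le _ _).trans ?_
          rw [abs_mul, abs_mul]
          gcongr
          refine (abs_add_three _ _ _).trans (le_of_eq ?_)
          simp only [abs_mul]
      _ = kernelMass a δ * m i j x := by simp only [hm]; ring
      _ ≤ _ := by gcongr; exact hmB i j x

end Patch

theorem memLpLoc_of_continuous {d : ℕ} {p : ℝ} {U : Set (EuclideanSpace ℝ (Fin d))}
    {f : EuclideanSpace ℝ (Fin d) → ℝ} (hf : Continuous f) : MemLpLoc p U f := by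
  intro K _ hK
  obtain ⟨C, hC⟩ := hK.exists_bound_of_continuousOn hf.continuousOn
  have : IsFiniteMeasure (volume.restrict K) := ⟨by
    rw [Measure.restrict_apply_univ]; exact hK.measure_lt_top⟩
  exact MemLp.of_bound hf.aestronglyMeasurable C
    ((ae_restrict_iff' hK.measurableSet).2 (Eventually.of_forall fun x hx => hC x hx))

theorem memLpLoc_of_memLp {d : ℕ} {p : ℝ} {U : Set (EuclideanSpace ℝ (Fin d))}
    {f : EuclideanSpace ℝ (Fin d) → ℝ} (hf : MemLp f (ENNReal.ofReal p) volume) :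
    MemLpLoc p U f := fun _ _ _ => hf.restrict _

theorem MemLpLoc.add {d : ℕ} {p : ℝ} {U : Set (EuclideanSpace ℝ (Fin d))}
    {f g : EuclideanSpace ℝ (Fin d) → ℝ} (hf : MemLpLoc p U f) (hg : MemLpLoc p U g) :
    MemLpLoc p U fun x => f x + g x := fun K hK hKc => (hf K hK hKc).add (hg K hK hKc)

section PatchSobolev

variable {d : ℕ} {χ g : EuclideanSpace ℝ (Fin d) → ℝ} {a δ ρ c M : ℝ}
  {x₀ e : EuclideanSpace ℝ (Fin d)}

/-- The level set `{g = 0}` is negligible in the ball. -/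
theorem ae_ne_zero_of_fderiv (hg : ContDiff ℝ 2 g) (hc : 0 < c)
    (hge : ∀ x ∈ ball x₀ ρ, c ≤ fderiv ℝ g x e) (hgM : ∀ x ∈ ball x₀ ρ, |g x| ≤ M) :
    ∀ᵐ x, x ∈ ball x₀ ρ → g x ≠ 0 := by
  have h := lintegral_rpow_neg_lt_top (s := 1 / 2) (by norm_num) hc hg.continuous
    (fun x _ => hg.differentiable two_ne_zero x) hge hgM
  have hm : Measurable fun x => (ENNReal.ofReal |g x|) ^ (-(1 / 2 : ℝ)) := by
    have := hg.continuous.measurable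
    fun_prop
  have := ae_lt_top hm h.ne
  rw [ae_restrict_iff' measurableSet_ball] at this
  filter_upwards [this] with x hx hxb h0
  have h1 := hx hxb
  rw [h0, abs_zero, ENNReal.ofReal_zero, ENNReal.zero_rpow_of_neg (by norm_num)] at h1
  exact lt_irrefl _ h1

/-- The singular part of the Hessian of the correction is `p`-integrable as soon as `a p < 1`. -/
theorem memLp_singular (ha : 0 < a) (hδ : 0 < δ) (hχ : ContDiff ℝ 2 χ)
    (hχc : HasCompactSupport χ) (hχs : Function.support χ ⊆ ball x₀ ρ) (hg : ContDiff ℝ 2 g)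
    (hc : 0 < c) (hge : ∀ x ∈ ball x₀ ρ, c ≤ fderiv ℝ g x e)
    (hgM : ∀ x ∈ ball x₀ ρ, |g x| ≤ M) {p : ℝ} (hp : 1 ≤ p) (hap : a * p < 1) (i j : Fin d) :
    MemLp (fun x => χ x * kernel a δ 0 (g x) * (partialDeriv i g x * partialDeriv j g x))
      (ENNReal.ofReal p) volume := by
  have hgi : ∀ i, Continuous (partialDeriv i g) := fun i => continuous_partialDeriv hg one_le_two
  have hgm := hg.continuous.measurable
  have hD : MemLp ((ball x₀ ρ).indicator fun x => |g x| ^ (-a)) (ENNReal.ofReal p) volume := by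
    refine ⟨?_, ?_⟩
    · refine (Measurable.indicator ?_ measurableSet_ball).aestronglyMeasurable
      fun_prop
    · have hp0 : ENNReal.ofReal p ≠ 0 := by
        rw [Ne, ENNReal.ofReal_eq_zero]; linarith
      rw [eLpNorm_lt_top_iff_lintegral_rpow_enorm_lt_top hp0 ENNReal.ofReal_ne_top,
        ENNReal.toReal_ofReal (by linarith)]
      refine lt_of_le_of_lt ?_ (lintegral_rpow_neg_lt_top hap hc hg.continuous
        (fun x _ => hg.differentiable two_ne_zero x) hge hgM)
      rw [← lintegral_indicator measurableSet_ball]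
      refine lintegral_mono fun x => ?_
      by_cases hx : x ∈ ball x₀ ρ
      · simp only [indicator_of_mem hx]
        rcases eq_or_ne (g x) 0 with h0 | h0
        · rw [h0, abs_zero, Real.zero_rpow (by linarith), enorm_zero,
            ENNReal.zero_rpow_of_pos (by linarith)]
          exact zero_le
        · rw [Real.enorm_of_nonneg (by positivity), ← ENNReal.ofReal_rpow_of_pos (abs_pos.2 h0),
            ← ENNReal.rpow_mul, neg_mul]
      · simp only [indicator_of_notMem hx, enorm_zero]
        rw [ENNReal.zero_rpow_of_pos (by linarith)]
  have hq : Continuous fun x => χ x * (partialDeriv i g x * partialDeriv j g x) :=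
    hχ.continuous.mul ((hgi i).mul (hgi j))
  obtain ⟨C, hC⟩ := (hχc.mul_right (f' := fun x => partialDeriv i g x *
    partialDeriv j g x)).exists_bound_of_continuous hq
  refine hD.of_le_mul (c := C) ?_ (Eventually.of_forall fun x => ?_)
  · have h1 := hχ.continuous.measurable
    have h2 := (hgi i).measurable
    have h3 := (hgi j).measurable
    have h4 := (measurable_kernel (a := a) (δ := δ) (τ := 0)).comp hgm
    exact ((h1.mul h4).mul (h2.mul h3)).aestronglyMeasurable
  · have hC' : ‖χ x * (partialDeriv i g x * partialDeriv j g x)‖ ≤ C := hC x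
    have e1 : χ x * kernel a δ 0 (g x) * (partialDeriv i g x * partialDeriv j g x) =
        (χ x * (partialDeriv i g x * partialDeriv j g x)) * kernel a δ 0 (g x) := by ring
    rw [e1, norm_mul]
    by_cases hx : x ∈ ball x₀ ρ
    · rw [indicator_of_mem hx]
      refine mul_le_mul hC' ?_ (norm_nonneg _) ((norm_nonneg _).trans hC')
      rw [Real.norm_of_nonneg (kernel_nonneg _), Real.norm_of_nonneg (by positivity)]
      rcases eq_or_ne (g x) 0 with h0 | h0
      · rw [h0]
        unfold kernel
        rw [abs_zero, max_self, Real.zero_rpow (by linarith)]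
        exact max_le (by linarith [Real.rpow_pos_of_pos hδ (-a)]) le_rfl
      · exact kernel_le_abs_rpow ha hδ h0
    · have : χ x = 0 := by
        by_contra h
        exact hx (hχs h)
      rw [this]; simp [indicator_of_notMem hx]

/-- The correction built from the singular kernel has the expected weak derivatives: they are the
dominated limits of the classical ones for the regularized kernels. -/
theorem isW2pLoc_patch (ha : 0 < a) (ha1 : a < 1) (hδ : 0 < δ) (hχ : ContDiff ℝ 2 χ)
    (hχc : HasCompactSupport χ) (hχs : Function.support χ ⊆ ball x₀ ρ) (hg : ContDiff ℝ 2 g)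
    (hc : 0 < c) (hge : ∀ x ∈ ball x₀ ρ, c ≤ fderiv ℝ g x e)
    (hgM : ∀ x ∈ ball x₀ ρ, |g x| ≤ M) {p : ℝ} (hp : 1 ≤ p) (hap : a * p < 1)
    (U : Set (EuclideanSpace ℝ (Fin d))) :
    IsW2pLoc p U (patch χ g a δ 0) (patchGrad χ g a δ 0) (patchHess χ g a δ 0) := by
  have hχi : ∀ i, Continuous (partialDeriv i χ) := fun i => continuous_partialDeriv hχ one_le_two
  have hgi : ∀ i, Continuous (partialDeriv i g) := fun i => continuous_partialDeriv hg one_le_two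
  have hχij : ∀ i j, Continuous (partialDeriv j (partialDeriv i χ)) := fun i j =>
    continuous_partialDeriv (contDiff_partialDeriv (m := 1) hχ (by norm_num)) le_rfl
  have hgij : ∀ i j, Continuous (partialDeriv j (partialDeriv i g)) := fun i j =>
    continuous_partialDeriv (contDiff_partialDeriv (m := 1) hg (by norm_num)) le_rfl
  have hχ0 := hχ.continuous
  have hg0 := hg.continuous
  have hK1 := (continuous_kernelInt (τ := 0) ha ha1 hδ).comp hg0
  have hK2 := (continuous_kernelInt₂ (τ := 0) ha ha1 hδ).comp hg0
  have hgradc : ∀ i, Continuous (patchGrad χ g a δ 0 i) := fun i =>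
    ((hχi i).mul hK2).add (hχ0.mul (hK1.mul (hgi i)))
  have hregc : ∀ i j, Continuous fun x => patchHessReg χ g a δ 0 x i j := fun i j =>
    ((hχij i j).mul hK2).add (((((hχi i).mul (hgi j)).add ((hχi j).mul (hgi i))).add
      (hχ0.mul (hgij i j))).mul hK1)
  obtain ⟨B, hB0, hB⟩ := exists_patch_bound ha ha1 hχ hχc hg
  have hpos : ∀ n : ℕ, (0 : ℝ) < 1 / (n + 1) := fun n => by positivity
  have hk0 := kernelMass_nonneg (a := a) (δ := δ)
  have hne : ∀ᵐ x, χ x ≠ 0 → g x ≠ 0 := by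
    filter_upwards [ae_ne_zero_of_fderiv hg hc hge hgM] with x hx h
    exact hx (hχs h)
  -- a locally integrable majorant of the regularized derivatives
  set b₁ : Fin d → EuclideanSpace ℝ (Fin d) → ℝ := fun i x =>
    kernelMass a δ * B + kernelMass a δ * (|partialDeriv i χ x| * |g x| +
      |χ x| * |partialDeriv i g x|) with hb₁
  have hb₁c : ∀ i, Continuous (b₁ i) := fun i =>
    continuous_const.add (continuous_const.mul (((hχi i).abs.mul hg0.abs).add
      (hχ0.abs.mul (hgi i).abs)))
  have hgradb : ∀ τ i x, |patchGrad χ g a δ τ i x| ≤ kernelMass a δ *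
      (|partialDeriv i χ x| * |g x| + |χ x| * |partialDeriv i g x|) := fun τ i x => by
    have k2 := abs_kernelInt₂_le (τ := τ) ha ha1 hδ (g x)
    have k1 := abs_kernelInt_le (τ := τ) ha ha1 hδ (g x)
    unfold patchGrad
    calc _ ≤ |partialDeriv i χ x| * (kernelMass a δ * |g x|) +
          |χ x| * (kernelMass a δ * |partialDeriv i g x|) := by
          refine (abs_add_le _ _).trans ?_
          rw [abs_mul, abs_mul, abs_mul (kernelInt a δ τ (g x))]
          gcongr
      _ = _ := by ring
  set T : Fin d → Fin d → EuclideanSpace ℝ (Fin d) → ℝ := fun i j x =>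
    χ x * kernel a δ 0 (g x) * (partialDeriv i g x * partialDeriv j g x) with hT
  have hTi : ∀ i j, Integrable (T i j) := fun i j => by
    have := memLp_singular (p := 1) ha hδ hχ hχc hχs hg hc hge hgM le_rfl (by linarith) i j
    rw [ENNReal.ofReal_one] at this
    exact memLp_one_iff_integrable.1 this
  refine ⟨(hχ0.mul hK2).continuousOn, fun i => memLpLoc_of_continuous (hgradc i), fun i j => ?_,
    fun i => ?_, fun i j => ?_⟩
  · have := (memLpLoc_of_continuous (p := p) (U := U) (hregc i j)).add
      (memLpLoc_of_memLp (memLp_singular ha hδ hχ hχc hχs hg hc hge hgM hp hap i j))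
    simpa only [patchHess_apply] using this
  · refine isWeakPartial_of_tendsto (Φ := fun n : ℕ => patch χ g a δ (1 / (n + 1))) (b := b₁ i)
      (fun n => contDiff_patch ha ha1 hδ hχ hg) (hb₁c i).locallyIntegrable
      (fun n => Eventually.of_forall fun x => ?_) (fun n => Eventually.of_forall fun x => ?_)
      (Eventually.of_forall fun x => ?_) (Eventually.of_forall fun x => ?_)
    · have h1 := (hB δ (1 / (n + 1)) hδ x).1
      have : 0 ≤ kernelMass a δ *
          (|partialDeriv i χ x| * |g x| + |χ x| * |partialDeriv i g x|) := by
        positivity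
      simp only [hb₁]; linarith
    · have h1 := partialDeriv_patch (τ := 1 / ((n : ℝ) + 1)) ha ha1 hδ hχ hg i x
      unfold partialDeriv at h1
      rw [h1]
      have := hgradb (1 / (n + 1)) i x
      have : 0 ≤ kernelMass a δ * B := by positivity
      simp only [hb₁]; linarith
    · exact (tendsto_kernelInt₂ ha ha1 hδ (g x)).const_mul _
    · have h1 := fun n : ℕ => partialDeriv_patch (τ := 1 / ((n : ℝ) + 1)) ha ha1 hδ hχ hg i x
      unfold partialDeriv at h1
      simp_rw [h1]
      exact ((tendsto_kernelInt₂ ha ha1 hδ (g x)).const_mul _).add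
        (((tendsto_kernelInt ha ha1 hδ (g x)).mul_const _).const_mul _)
  · have hder : ∀ (n : ℕ) (x : EuclideanSpace ℝ (Fin d)),
        fderiv ℝ (patchGrad χ g a δ (1 / ((n : ℝ) + 1)) i) x (EuclideanSpace.single j 1) =
          patchHess χ g a δ (1 / ((n : ℝ) + 1)) x i j := fun n x =>
      partialDeriv_patchGrad ha ha1 hδ (hpos n) hχ hg i j x
    refine isWeakPartial_of_tendsto (Φ := fun n : ℕ => patchGrad χ g a δ (1 / (n + 1)) i)
      (b := fun x => b₁ i x + |T i j x|)
      (fun n => contDiff_patchGrad ha ha1 hδ (hpos n) hχ hg i)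
      ((hb₁c i).locallyIntegrable.add (hTi i j).abs.locallyIntegrable)
      (fun n => Eventually.of_forall fun x => ?_) (fun n => ?_)
      (Eventually.of_forall fun x => ?_) ?_
    · have := hgradb (1 / (n + 1)) i x
      have : 0 ≤ kernelMass a δ * B := by positivity
      have := abs_nonneg (T i j x)
      simp only [hb₁]; linarith
    · filter_upwards [hne] with x hx
      rw [hder, patchHess_apply]
      refine (abs_add_le _ _).trans ?_
      have h1 := (hB δ (1 / (n + 1)) hδ x).2 i j
      have h2 : |χ x * kernel a δ (1 / (n + 1)) (g x) *
          (partialDeriv i g x * partialDeriv j g x)| ≤ |T i j x| := by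
        by_cases h0 : χ x = 0
        · simp [h0, hT]
        · simp only [hT, abs_mul, abs_of_nonneg (kernel_nonneg _)]
          gcongr
          exact kernel_zero_le ha (hx h0)
      have : 0 ≤ kernelMass a δ *
          (|partialDeriv i χ x| * |g x| + |χ x| * |partialDeriv i g x|) := by
        positivity
      simp only [hb₁]; linarith
    · exact ((tendsto_kernelInt₂ ha ha1 hδ (g x)).const_mul _).add
        (((tendsto_kernelInt ha ha1 hδ (g x)).mul_const _).const_mul _)
    · filter_upwards [hne] with x hx
      simp_rw [hder, patchHess_apply]
      refine Tendsto.add (((tendsto_kernelInt₂ ha ha1 hδ (g x)).const_mul _).add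
        ((tendsto_kernelInt ha ha1 hδ (g x)).const_mul _)) ?_
      by_cases h0 : χ x = 0
      · simp [h0]
      · exact ((tendsto_kernel (hx h0)).const_mul _).mul_const _

end PatchSobolev

end WeightedPucci

/-! ### Sobolev test functions and Pucci operators -/

namespace WeightedPucci


section Sobolev

variable {d : ℕ} {p : ℝ} {U : Set (EuclideanSpace ℝ (Fin d))}

theorem MemLpLoc.integrableOn {f : EuclideanSpace ℝ (Fin d) → ℝ} (hf : MemLpLoc p U f)
    (hp : 1 ≤ p) {K : Set (EuclideanSpace ℝ (Fin d))} (hK : K ⊆ U) (hKc : IsCompact K) :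
    IntegrableOn f K := by
  have : IsFiniteMeasure (volume.restrict K) := ⟨by
    rw [Measure.restrict_apply_univ]; exact hKc.measure_lt_top⟩
  exact (hf K hK hKc).integrable (ENNReal.one_le_ofReal.2 hp)

theorem MemLpLoc.const_mul {f : EuclideanSpace ℝ (Fin d) → ℝ} (hf : MemLpLoc p U f) (k : ℝ) :
    MemLpLoc p U fun x => k * f x := fun K hK hKc => (hf K hK hKc).const_mul k

theorem integrable_mul_of_tsupport_subset {f ψ : EuclideanSpace ℝ (Fin d) → ℝ}
    (hf : ∀ K ⊆ U, IsCompact K → IntegrableOn f K) (hψ : Continuous ψ)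
    (hψc : HasCompactSupport ψ) (hψU : tsupport ψ ⊆ U) : Integrable fun x => f x * ψ x := by
  have h := (hf _ hψU hψc).mul_continuousOn hψ.continuousOn hψc
  refine (integrableOn_iff_integrable_of_support_subset fun x hx => ?_).1 h
  exact subset_tsupport _ (right_ne_zero_of_mul hx)

theorem IsWeakPartial.add {i : Fin d} {φ₁ φ₂ g₁ g₂ : EuclideanSpace ℝ (Fin d) → ℝ}
    (h₁ : IsWeakPartial U i φ₁ g₁) (h₂ : IsWeakPartial U i φ₂ g₂)
    (hφ₁ : ∀ K ⊆ U, IsCompact K → IntegrableOn φ₁ K)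
    (hφ₂ : ∀ K ⊆ U, IsCompact K → IntegrableOn φ₂ K)
    (hg₁ : ∀ K ⊆ U, IsCompact K → IntegrableOn g₁ K)
    (hg₂ : ∀ K ⊆ U, IsCompact K → IntegrableOn g₂ K) :
    IsWeakPartial U i (fun x => φ₁ x + φ₂ x) fun x => g₁ x + g₂ x := by
  intro ψ hψ hψc hψU
  have hdc : Continuous fun x => fderiv ℝ ψ x (EuclideanSpace.single i 1) :=
    (hψ.continuous_fderiv (by simp)).clm_apply continuous_const
  have hds := hψc.fderiv_apply ℝ (EuclideanSpace.single i 1)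
  have hdU : tsupport (fun x => fderiv ℝ ψ x (EuclideanSpace.single i 1)) ⊆ U :=
    (tsupport_fderiv_apply_subset ℝ _).trans hψU
  simp only [add_mul]
  rw [integral_add (integrable_mul_of_tsupport_subset hφ₁ hdc hds hdU).integrableOn
      (integrable_mul_of_tsupport_subset hφ₂ hdc hds hdU).integrableOn,
    integral_add (integrable_mul_of_tsupport_subset hg₁ hψ.continuous hψc hψU).integrableOn
      (integrable_mul_of_tsupport_subset hg₂ hψ.continuous hψc hψU).integrableOn,
    h₁ ψ hψ hψc hψU, h₂ ψ hψ hψc hψU, neg_add]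

theorem IsWeakPartial.const_mul {i : Fin d} {φ g : EuclideanSpace ℝ (Fin d) → ℝ}
    (h : IsWeakPartial U i φ g) (k : ℝ) :
    IsWeakPartial U i (fun x => k * φ x) fun x => k * g x := by
  intro ψ hψ hψc hψU
  simp only [mul_assoc, integral_const_mul]
  rw [h ψ hψ hψc hψU, mul_neg]

variable {φ φ' : EuclideanSpace ℝ (Fin d) → ℝ} {G G' : Fin d → EuclideanSpace ℝ (Fin d) → ℝ}
  {H H' : EuclideanSpace ℝ (Fin d) → Matrix (Fin d) (Fin d) ℝ}

theorem IsW2pLoc.add (h : IsW2pLoc p U φ G H) (h' : IsW2pLoc p U φ' G' H') (hp : 1 ≤ p) :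
    IsW2pLoc p U (fun x => φ x + φ' x) (fun i x => G i x + G' i x) fun x => H x + H' x where
  continuousOn := h.continuousOn.add h'.continuousOn
  grad_memLp i := (h.grad_memLp i).add (h'.grad_memLp i)
  hess_memLp i j := (h.hess_memLp i j).add (h'.hess_memLp i j)
  grad_weak i := (h.grad_weak i).add (h'.grad_weak i)
    (fun _ hK hKc => (h.continuousOn.mono hK).integrableOn_compact hKc)
    (fun _ hK hKc => (h'.continuousOn.mono hK).integrableOn_compact hKc)
    (fun _ => (h.grad_memLp i).integrableOn hp) fun _ => (h'.grad_memLp i).integrableOn hp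
  hess_weak i j := (h.hess_weak i j).add (h'.hess_weak i j)
    (fun _ => (h.grad_memLp i).integrableOn hp) (fun _ => (h'.grad_memLp i).integrableOn hp)
    (fun _ => (h.hess_memLp i j).integrableOn hp) fun _ => (h'.hess_memLp i j).integrableOn hp

theorem IsW2pLoc.const_mul (h : IsW2pLoc p U φ G H) (k : ℝ) :
    IsW2pLoc p U (fun x => k * φ x) (fun i x => k * G i x) fun x => k • H x where
  continuousOn := continuousOn_const.mul h.continuousOn
  grad_memLp i := (h.grad_memLp i).const_mul k
  hess_memLp i j := (h.hess_memLp i j).const_mul k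
  grad_weak i := (h.grad_weak i).const_mul k
  hess_weak i j := (h.hess_weak i j).const_mul k

theorem isWeakPartial_of_contDiff (hφ : ContDiff ℝ 1 φ) (i : Fin d) :
    IsWeakPartial U i φ (partialDeriv i φ) := by
  have h1 := hφ.continuous
  have h2 := continuous_partialDeriv (i := i) hφ le_rfl
  refine isWeakPartial_of_tendsto (Φ := fun _ => φ) (b := fun x => |φ x| + |partialDeriv i φ x|)
    (fun _ => hφ) (h1.abs.add h2.abs).locallyIntegrable
    (fun _ => Eventually.of_forall fun x => ?_) (fun _ => Eventually.of_forall fun x => ?_)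
    (Eventually.of_forall fun x => tendsto_const_nhds)
    (Eventually.of_forall fun x => tendsto_const_nhds)
  · simp
  · change |partialDeriv i φ x| ≤ _
    simp

theorem isW2pLoc_of_contDiff (hφ : ContDiff ℝ 2 φ) :
    IsW2pLoc p U φ (fun i => partialDeriv i φ)
      fun x => Matrix.of fun i j => partialDeriv j (partialDeriv i φ) x where
  continuousOn := hφ.continuous.continuousOn
  grad_memLp _ := memLpLoc_of_continuous (continuous_partialDeriv hφ one_le_two)
  hess_memLp _ _ := memLpLoc_of_continuous
    (continuous_partialDeriv (contDiff_partialDeriv (m := 1) hφ (by norm_num)) le_rfl)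
  grad_weak i := isWeakPartial_of_contDiff (hφ.of_le one_le_two) i
  hess_weak i j := isWeakPartial_of_contDiff (contDiff_partialDeriv (m := 1) hφ (by norm_num)) j

theorem exists_isW2pLoc_quadratic (b : ℝ) (x q e e' : EuclideanSpace ℝ (Fin d)) (c : ℝ) :
    ∃ G : Fin d → EuclideanSpace ℝ (Fin d) → ℝ, IsW2pLoc p U
      (fun z => b + inner ℝ q (z - x) +
        (inner ℝ e (z - x) ^ 2 + inner ℝ e' (z - x) ^ 2 - c * ‖z - x‖ ^ 2)) G
      fun _ => (2 : ℝ) • (Matrix.vecMulVec e e + Matrix.vecMulVec e' e' - c • 1) := by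
  have hℓ : ∀ w z : EuclideanSpace ℝ (Fin d),
      HasFDerivAt (fun z => (inner ℝ w (z - x) : ℝ)) (innerSL ℝ w) z := fun w z =>
    (innerSL ℝ w).hasFDerivAt.comp z ((hasFDerivAt_id z).sub_const x)
  have hs : ContDiff ℝ 2 fun z => b + inner ℝ q (z - x) +
      (inner ℝ e (z - x) ^ 2 + inner ℝ e' (z - x) ^ 2 - c * ‖z - x‖ ^ 2) := by
    have hsub : ContDiff ℝ 2 fun z : EuclideanSpace ℝ (Fin d) => z - x :=
      contDiff_id.sub contDiff_const
    exact (contDiff_const.add (contDiff_const.inner ℝ hsub)).add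
      ((((contDiff_const.inner ℝ hsub).pow 2).add ((contDiff_const.inner ℝ hsub).pow 2)).sub
        (contDiff_const.mul (hsub.norm_sq ℝ)))
  refine ⟨_, (congrArg (IsW2pLoc p U _ _) (funext fun z => ?_)).mp (isW2pLoc_of_contDiff hs)⟩
  ext i j
  have hi : ∀ i, partialDeriv i (fun z => b + inner ℝ q (z - x) +
      (inner ℝ e (z - x) ^ 2 + inner ℝ e' (z - x) ^ 2 - c * ‖z - x‖ ^ 2)) = fun z =>
        q i + (2 * e i * inner ℝ e (z - x) + 2 * e' i * inner ℝ e' (z - x) -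
          2 * c * inner ℝ (EuclideanSpace.single i (1 : ℝ)) (z - x)) := by
    intro i
    funext z
    have hn := ((hasFDerivAt_id z).sub_const x).norm_sq
    have h := (((hasFDerivAt_const b z).add (hℓ q z)).add
      ((((hℓ e z).pow 2).add ((hℓ e' z).pow 2)).sub (hn.const_mul c))).fderiv
    unfold partialDeriv
    refine (congrArg (fun L => L (EuclideanSpace.single i (1 : ℝ))) h).trans ?_
    simp [EuclideanSpace.inner_single_left, EuclideanSpace.inner_single_right]
    ring
  have h := (((hℓ e z).const_mul (2 * e i)).add ((hℓ e' z).const_mul (2 * e' i))).sub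
    ((hℓ (EuclideanSpace.single i (1 : ℝ)) z).const_mul (2 * c))
  have h := (h.const_add (q i)).fderiv
  simp only [Matrix.of_apply, hi]
  unfold partialDeriv
  refine (congrArg (fun L => L (EuclideanSpace.single j (1 : ℝ))) h).trans ?_
  rcases eq_or_ne i j with rfl | hij
  · simp [EuclideanSpace.inner_single_right, Matrix.vecMulVec_apply]
    ring
  · simp [EuclideanSpace.inner_single_right, Matrix.vecMulVec_apply, hij, hij.symm]
    ring

end Sobolev

section Pucci

variable {d : ℕ} {lam Lam : ℝ}

theorem le_pucciInf (hLam : lam ≤ Lam) {M : Matrix (Fin d) (Fin d) ℝ} {s : ℝ}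
    (h : ∀ A ∈ ellipticMatrices d lam Lam, s ≤ (A * M).trace) : s ≤ pucciInf lam Lam M := by
  refine le_csInf ⟨_, mem_image_of_mem _ (smul_one_mem_ellipticMatrices hLam)⟩ ?_
  rintro _ ⟨A, hA, rfl⟩
  exact h A hA

theorem pucciSup_neg (M : Matrix (Fin d) (Fin d) ℝ) :
    pucciSup lam Lam (-M) = -pucciInf lam Lam M := by
  unfold pucciSup pucciInf
  rw [← Real.sSup_neg, ← image_neg_eq_neg, image_image]
  simp

/-- The Hessian of the quadratic test functions, seen by the Pucci operator. -/
theorem le_trace_mul_quadratic (hlam : 0 < lam) {A : Matrix (Fin d) (Fin d) ℝ}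
    (hA : A ∈ ellipticMatrices d lam Lam) (e e' : EuclideanSpace ℝ (Fin d)) {c : ℝ} (hc : 0 ≤ c) :
    2 * lam * (‖e‖ ^ 2 + ‖e'‖ ^ 2) - 2 * (d * Lam * c) ≤
      (A * ((2 : ℝ) • (Matrix.vecMulVec e e + Matrix.vecMulVec e' e' - c • 1))).trace := by
  have hn : ∀ v : EuclideanSpace ℝ (Fin d), (v : Fin d → ℝ) ⬝ᵥ v = ‖v‖ ^ 2 := fun v => by
    rw [EuclideanSpace.real_norm_sq_eq]
    simp [dotProduct, sq]
  have h1 := (mul_dotProduct_le_of_mem_ellipticMatrices hA e).1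
  have h2 := (mul_dotProduct_le_of_mem_ellipticMatrices hA e').1
  have h3 := mul_le_mul_of_nonneg_left (trace_le_of_mem_ellipticMatrices hlam hA) hc
  rw [hn] at h1 h2
  rw [Matrix.mul_smul, Matrix.trace_smul, Matrix.mul_sub, Matrix.mul_add, Matrix.trace_sub,
    Matrix.trace_add, trace_mul_vecMulVec_self, trace_mul_vecMulVec_self, Matrix.mul_smul,
    mul_one, Matrix.trace_smul, smul_eq_mul, smul_eq_mul]
  linarith

theorem neg_mem_SUpper {p : ℝ} {w f u : EuclideanSpace ℝ (Fin d) → ℝ}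
    {U : Set (EuclideanSpace ℝ (Fin d))} (hu : u ∈ SLower p lam Lam w (fun x => -f x) U) :
    (fun x => -u x) ∈ SUpper p lam Lam w f U := by
  refine ⟨hu.1.neg, fun φ G H hφ x₀ hx₀ hmin => ?_⟩
  have hmax : IsLocalMax (fun x => u x - -1 * φ x) x₀ := by
    filter_upwards [hmin] with x hx
    linarith
  have h := hu.2 _ _ _ (hφ.const_mul (-1)) x₀ hx₀ hmax
  unfold essLimsupAt at h
  unfold essLiminfAt
  rw [← EReal.neg_le_neg_iff, neg_zero, ← EReal.limsup_neg]
  refine h.trans (le_of_eq (congrArg (fun v => limsup v _) (funext fun x => ?_)))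
  simp only [neg_smul, one_smul, pucciSup_neg, Pi.neg_apply]
  rw [← EReal.coe_neg]
  congr 1
  ring

end Pucci

end WeightedPucci

/-! ### Reduction to the uniformly elliptic inequality -/

namespace WeightedPucci


/-- Arbitrarily small continuous functions in `W^{2,p}_loc`, for all admissible `p` at once, whose
Hessian is almost nonnegative for the Pucci operator and at the points of `Γ ∩ s` outweighs the
degeneracy of the weight. Adding such a function to a test function shows that nothing can touch a
supersolution from below on `Γ ∩ s`. -/
def HasCorrections {d : ℕ} (lam Lam a : ℝ) (Γ s : Set (EuclideanSpace ℝ (Fin d))) : Prop :=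
  ∀ F η : ℝ, 0 < η → ∃ (ψ : EuclideanSpace ℝ (Fin d) → ℝ)
    (G : Fin d → EuclideanSpace ℝ (Fin d) → ℝ)
    (H : EuclideanSpace ℝ (Fin d) → Matrix (Fin d) (Fin d) ℝ),
    (∀ x, |ψ x| ≤ η) ∧ (∀ (p : ℝ) U, 1 ≤ p → a * p < 1 → IsW2pLoc p U ψ G H) ∧
    (∀ᵐ x, ∀ A ∈ ellipticMatrices d lam Lam, -η ≤ (A * H x).trace) ∧
    ∀ z ∈ Γ ∩ s, ∀ᶠ x in 𝓝 z ⊓ ae volume, ∀ A ∈ ellipticMatrices d lam Lam,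
      F ≤ weight Γ a x * (A * H x).trace

section Corrections

variable {d : ℕ} {lam Lam a : ℝ} {Γ : Set (EuclideanSpace ℝ (Fin d))}

theorem weight_nonneg (x : EuclideanSpace ℝ (Fin d)) : 0 ≤ weight Γ a x :=
  Real.rpow_nonneg infDist_nonneg a

theorem continuous_weight (ha : 0 < a) : Continuous (weight Γ a) :=
  (continuous_infDist_pt Γ).rpow_const fun _ => Or.inr ha.le

/-- The weight absorbs constants near `Γ`. -/
theorem eventually_weight_mul_lt (ha : 0 < a) {z : EuclideanSpace ℝ (Fin d)} (hz : z ∈ Γ) (k : ℝ)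
    {ε : ℝ} (hε : 0 < ε) : ∀ᶠ x in 𝓝 z ⊓ ae volume, weight Γ a x * k < ε := by
  have h : Tendsto (fun x => weight Γ a x * k) (𝓝 z) (𝓝 (weight Γ a z * k)) :=
    ((continuous_weight ha).mul continuous_const).tendsto z
  have h0 : weight Γ a z = 0 := by
    unfold weight
    rw [infDist_zero_of_mem hz, Real.zero_rpow ha.ne']
  rw [h0, zero_mul] at h
  exact (h.eventually_lt_const hε).filter_mono inf_le_left

theorem HasCorrections.empty : HasCorrections lam Lam a Γ ∅ := by
  intro F η hη
  refine ⟨fun _ => 0, _, _, fun x => by simpa using hη.le, fun p U _ _ =>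
    (isW2pLoc_of_contDiff (contDiff_const (c := (0 : ℝ)))), Eventually.of_forall fun x A _ => ?_,
    fun z hz => absurd hz.2 (notMem_empty z)⟩
  have : (Matrix.of fun i j : Fin d => partialDeriv j
      (partialDeriv i fun _ : EuclideanSpace ℝ (Fin d) => (0 : ℝ)) x) = 0 := by
    ext i j
    have : partialDeriv i (fun _ : EuclideanSpace ℝ (Fin d) => (0 : ℝ)) = fun _ => 0 := by
      funext y; simp [partialDeriv]
    simp [this, partialDeriv]
  rw [this]
  simpa using hη.le

theorem HasCorrections.mono {s t : Set (EuclideanSpace ℝ (Fin d))} (hst : s ⊆ t)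
    (h : HasCorrections lam Lam a Γ t) : HasCorrections lam Lam a Γ s := by
  intro F η hη
  obtain ⟨ψ, G, H, h1, h2, h3, h4⟩ := h F η hη
  exact ⟨ψ, G, H, h1, h2, h3, fun z hz => h4 z ⟨hz.1, hst hz.2⟩⟩

theorem HasCorrections.union (ha : 0 < a) {s t : Set (EuclideanSpace ℝ (Fin d))}
    (hs : HasCorrections lam Lam a Γ s) (ht : HasCorrections lam Lam a Γ t) :
    HasCorrections lam Lam a Γ (s ∪ t) := by
  intro F η hη
  obtain ⟨ψ, G, H, h1, h2, h3, h4⟩ := hs (F + 1) (η / 2) (by linarith)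
  obtain ⟨ψ', G', H', h1', h2', h3', h4'⟩ := ht (F + 1) (η / 2) (by linarith)
  refine ⟨_, _, _, fun x => ?_, fun p U hp hap => (h2 p U hp hap).add (h2' p U hp hap) hp, ?_, ?_⟩
  · linarith [abs_add_le (ψ x) (ψ' x), h1 x, h1' x]
  · filter_upwards [h3, h3'] with x hx hx' A hA
    rw [mul_add, Matrix.trace_add]
    linarith [hx A hA, hx' A hA]
  · rintro z ⟨hzΓ, hz⟩
    -- the weight vanishes at `z`, so the correction built for the other set does no harm
    have hw := eventually_weight_mul_lt ha hzΓ (η / 2) one_pos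
    rcases hz with hz | hz
    · filter_upwards [h4 z ⟨hzΓ, hz⟩, h3'.filter_mono inf_le_right, hw] with x hx hx' hw A hA
      rw [mul_add, Matrix.trace_add, mul_add]
      have := mul_le_mul_of_nonneg_left (hx' A hA) (weight_nonneg (Γ := Γ) (a := a) x)
      linarith [hx A hA]
    · filter_upwards [h4' z ⟨hzΓ, hz⟩, h3.filter_mono inf_le_right, hw] with x hx hx' hw A hA
      rw [mul_add, Matrix.trace_add, mul_add]
      have := mul_le_mul_of_nonneg_left (hx' A hA) (weight_nonneg (Γ := Γ) (a := a) x)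
      linarith [hx A hA]

/-- Near a point of `Γ`, a fixed multiple of `patch` serves as a correction, with the support of the
kernel shrunk so much that the regular terms are negligible. -/
theorem exists_mem_nhds_hasCorrections (hlam : 0 < lam) (hLam : lam ≤ Lam) (ha : 0 < a)
    (ha1 : a < 1) (hΓ : IsSmoothHypersurface Γ) {x₀ : EuclideanSpace ℝ (Fin d)} (hx₀ : x₀ ∈ Γ) :
    ∃ t ∈ 𝓝 x₀, HasCorrections lam Lam a Γ t := by
  obtain ⟨g, e, ρ, c, M, L, hg, hρ, hc, hL, hge, hgM, hgL, hg0⟩ := hΓ.exists_local_function hx₀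
  refine ⟨ball x₀ (ρ / 4), ball_mem_nhds x₀ (by positivity), fun F η hη => ?_⟩
  let χ : ContDiffBump x₀ := ⟨ρ / 4, ρ / 2, by positivity, by linarith⟩
  have hχ : ContDiff ℝ 2 χ := χ.contDiff
  have hχc : HasCompactSupport χ := χ.hasCompactSupport
  have hχs : Function.support χ ⊆ ball x₀ ρ := by
    rw [χ.support_eq]
    exact ball_subset_ball (by show ρ / 2 ≤ ρ; linarith)
  obtain ⟨B, hB0, hB⟩ := exists_patch_bound ha ha1 hχ hχc hg
  have hLam0 : 0 < Lam := hlam.trans_le hLam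
  have he : 0 < ‖e‖ := by
    rw [norm_pos_iff]
    rintro rfl
    have := hge x₀ (mem_ball_self hρ)
    rw [map_zero] at this
    linarith
  -- the gradient of `g` is at least `c / ‖e‖` long, by Cauchy-Schwarz
  have hgrad : ∀ x ∈ ball x₀ ρ, (c / ‖e‖) ^ 2 ≤
      (fun i => partialDeriv i g x) ⬝ᵥ fun i => partialDeriv i g x := by
    intro x hx
    have h1 : c ^ 2 ≤ (∑ i, e i * partialDeriv i g x) ^ 2 := by
      rw [← fderiv_apply_eq_sum]
      exact pow_le_pow_left₀ hc.le (hge x hx) 2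
    have h2 := Finset.sum_mul_sq_le_sq_mul_sq Finset.univ (fun i => e i) fun i => partialDeriv i g x
    rw [← EuclideanSpace.real_norm_sq_eq] at h2
    rw [div_pow, div_le_iff₀ (by positivity), mul_comm]
    refine h1.trans (h2.trans (le_of_eq ?_))
    simp [dotProduct, sq]
  set κ : ℝ := (c / ‖e‖) ^ 2 with hκ
  have hκ0 : 0 < κ := by positivity
  -- the factor makes the singular part of the Hessian contribute `|F| + 1` in the limit
  set K : ℝ := (|F| + 1) * L ^ a / (lam * κ) with hK
  have hK0 : 0 < K := by positivity
  have hKL : K * (lam * κ) * L ^ (-a) = |F| + 1 := by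
    rw [hK, Real.rpow_neg hL.le]
    field_simp
  obtain ⟨δ, hδ, hδη⟩ := exists_kernelMass_lt ha1
    (show 0 < η / (K * (B + 1) * (1 + d * (d * Lam))) by positivity)
  have hm0 := kernelMass_nonneg (a := a) (δ := δ)
  have hsmall : K * (kernelMass a δ * B) * (1 + d * (d * Lam)) ≤ η := by
    rw [lt_div_iff₀ (by positivity)] at hδη
    refine le_trans ?_ hδη.le
    have : K * (kernelMass a δ * B) * (1 + d * (d * Lam)) ≤
        K * (kernelMass a δ * (B + 1)) * (1 + d * (d * Lam)) := by gcongr; linarith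
    linarith
  have hKmB : 0 ≤ K * (kernelMass a δ * B) := by positivity
  have hdd : 0 ≤ K * (kernelMass a δ * B) * (d * (d * Lam)) := by positivity
  have htrace : ∀ x, ∀ A ∈ ellipticMatrices d lam Lam,
      -η + K * (lam * (χ x * kernel a δ 0 (g x) *
        ((fun i => partialDeriv i g x) ⬝ᵥ fun i => partialDeriv i g x))) ≤
        (A * (K • patchHess χ g a δ 0 x)).trace := by
    intro x A hA
    have h1 := abs_le.1 (abs_trace_mul_le hlam hA
      (R := Matrix.of (patchHessReg χ g a δ 0 x)) (hB δ 0 hδ x).2)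
    have h2 := (mul_dotProduct_le_of_mem_ellipticMatrices hA fun i => partialDeriv i g x).1
    have h3 := mul_le_mul_of_nonneg_left h2
      (mul_nonneg (χ.nonneg (x := x)) (kernel_nonneg (a := a) (δ := δ) (τ := 0) (g x)))
    rw [Matrix.mul_smul, Matrix.trace_smul, patchHess, Matrix.mul_add, Matrix.trace_add,
      Matrix.mul_smul, Matrix.trace_smul, trace_mul_vecMulVec_self, smul_eq_mul, smul_eq_mul]
    have h4 := mul_le_mul_of_nonneg_left (add_le_add h1.1 h3) hK0.le
    refine le_trans ?_ h4
    have h5 : K * (d * (d * (Lam * (kernelMass a δ * B)))) ≤ η := by linarith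
    linarith
  have hpos : ∀ x, 0 ≤ χ x * kernel a δ 0 (g x) *
      ((fun i => partialDeriv i g x) ⬝ᵥ fun i => partialDeriv i g x) := fun x =>
    mul_nonneg (mul_nonneg χ.nonneg (kernel_nonneg _)) 
      (Finset.sum_nonneg fun i _ => mul_self_nonneg _)
  refine ⟨fun x => K * patch χ g a δ 0 x, _, _, fun x => ?_, fun p U hp hap =>
    (isW2pLoc_patch ha ha1 hδ hχ hχc hχs hg hc hge hgM hp hap U).const_mul K,
    Eventually.of_forall fun x A hA => ?_, ?_⟩
  · rw [abs_mul, abs_of_pos hK0]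
    have := mul_le_mul_of_nonneg_left (hB δ 0 hδ x).1 hK0.le
    linarith
  · refine le_trans ?_ (htrace x A hA)
    have := hpos x
    have : 0 ≤ K * (lam * (χ x * kernel a δ 0 (g x) *
      ((fun i => partialDeriv i g x) ⬝ᵥ fun i => partialDeriv i g x))) := by positivity
    linarith
  · rintro z ⟨hzΓ, hz⟩
    have hw := eventually_weight_mul_lt ha hzΓ (η + K * (lam * κ) * δ ^ (-a)) one_pos
    have hzb : ∀ᶠ x in 𝓝 z ⊓ ae volume, x ∈ ball x₀ (ρ / 4) :=
      Eventually.filter_mono inf_le_left (isOpen_ball.mem_nhds hz)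
    filter_upwards [hw, hzb, (ae_ne_zero_of_fderiv hg hc hge hgM).filter_mono inf_le_right]
      with x hw hx hne A hA
    have hxρ : x ∈ ball x₀ ρ := ball_subset_ball (by linarith) hx
    have hgx := abs_pos.2 (hne hxρ)
    have hdist : |g x| ≤ L * infDist x Γ := by
      by_contra hcon
      push Not at hcon
      have h1 : infDist x Γ < |g x| / L := by rwa [lt_div_iff₀ hL, mul_comm]
      have h2 : infDist x Γ < ρ / 4 := (infDist_le_dist_of_mem hx₀).trans_lt hx
      obtain ⟨y, hy, hxy⟩ := (infDist_lt_iff ⟨x₀, hx₀⟩).1 (lt_min h1 h2)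
      have hyρ : y ∈ ball x₀ ρ := by
        have h3 := hxy.trans_le (min_le_right _ _)
        have h4 : dist x x₀ < ρ / 4 := hx
        rw [dist_comm] at h3
        rw [mem_ball]
        linarith [dist_triangle y x x₀]
      have h5 := hgL x hxρ y hyρ
      rw [hg0 y ⟨hy, hyρ⟩, sub_zero, ← dist_eq_norm] at h5
      have h6 := hxy.trans_le (min_le_left _ _)
      rw [lt_div_iff₀ hL] at h6
      linarith
    have hdpos : 0 < infDist x Γ := by
      by_contra hcon
      have : L * infDist x Γ ≤ 0 := mul_nonpos_of_nonneg_of_nonpos hL.le (not_lt.1 hcon)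
      linarith
    have hk : L ^ (-a) - weight Γ a x * δ ^ (-a) ≤ weight Γ a x * kernel a δ 0 (g x) := by
      have h1 : |g x| ^ (-a) - δ ^ (-a) ≤ kernel a δ 0 (g x) := by
        unfold kernel
        rw [max_eq_left (abs_nonneg (g x))]
        exact le_max_left _ _
      have h2 : L ^ (-a) ≤ weight Γ a x * |g x| ^ (-a) := by
        have h3 : (L * infDist x Γ) ^ (-a) ≤ |g x| ^ (-a) :=
          Real.rpow_le_rpow_of_nonpos hgx hdist (by linarith)
        rw [Real.mul_rpow hL.le hdpos.le] at h3
        have h4 := mul_le_mul_of_nonneg_left h3 (weight_nonneg (Γ := Γ) (a := a) x)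
        refine le_trans (le_of_eq ?_) h4
        unfold weight
        rw [Real.rpow_neg hdpos.le]
        have := Real.rpow_pos_of_pos hdpos a
        field_simp
      have h5 := mul_le_mul_of_nonneg_left h1 (weight_nonneg (Γ := Γ) (a := a) x)
      linarith
    have hχ1 : χ x = 1 := χ.one_of_mem_closedBall (ball_subset_closedBall hx)
    have h1 := htrace x A hA
    rw [hχ1, one_mul] at h1
    have h2 : K * (lam * (kernel a δ 0 (g x) * κ)) ≤ K * (lam * (kernel a δ 0 (g x) *
        ((fun i => partialDeriv i g x) ⬝ᵥ fun i => partialDeriv i g x))) := by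
      have := kernel_nonneg (a := a) (δ := δ) (τ := 0) (g x)
      have := hgrad x hxρ
      gcongr
    have h3 := mul_le_mul_of_nonneg_left
      ((add_le_add_right h2 (-η)).trans h1) (weight_nonneg (Γ := Γ) (a := a) x)
    have h4 := mul_le_mul_of_nonneg_left hk (show 0 ≤ K * (lam * κ) by positivity)
    have h5 := le_abs_self F
    linarith

theorem hasCorrections_of_isCompact (hlam : 0 < lam) (hLam : lam ≤ Lam) (ha : 0 < a)
    (ha1 : a < 1) (hΓ : IsSmoothHypersurface Γ) {K : Set (EuclideanSpace ℝ (Fin d))}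
    (hK : IsCompact K) (hKΓ : K ⊆ Γ) : HasCorrections lam Lam a Γ K := by
  refine hK.induction_on HasCorrections.empty (fun _ _ hst h => h.mono hst)
    (fun _ _ hs ht => hs.union ha ht) fun x hx => ?_
  obtain ⟨t, ht, h⟩ := exists_mem_nhds_hasCorrections hlam hLam ha ha1 hΓ (hKΓ hx)
  exact ⟨t, mem_nhdsWithin_of_mem_nhds ht, h⟩

end Corrections

section Reduction

variable {d : ℕ} {lam Lam a : ℝ} {Γ : Set (EuclideanSpace ℝ (Fin d))}

theorem le_zero_of_essLiminfAt_le {h : EuclideanSpace ℝ (Fin d) → ℝ}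
    {x₀ : EuclideanSpace ℝ (Fin d)} (hh : essLiminfAt h x₀ ≤ 0) {r : ℝ}
    (hr : ∀ᶠ x in 𝓝 x₀ ⊓ ae volume, r ≤ h x) : r ≤ 0 := by
  have h1 : (r : EReal) ≤ essLiminfAt h x₀ :=
    le_liminf_of_le (h := hr.mono fun x hx => EReal.coe_le_coe_iff.2 hx)
  exact_mod_cast h1.trans hh

theorem weight_pos {O : Set (EuclideanSpace ℝ (Fin d))} (hO : IsOpen (O \ Γ)) (hne : Γ.Nonempty)
    {x : EuclideanSpace ℝ (Fin d)} (hx : x ∈ O \ Γ) : 0 < weight Γ a x := by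
  refine Real.rpow_pos_of_pos ?_ a
  refine (infDist_pos_iff_notMem_closure hne).1 fun hcl => ?_
  obtain ⟨y, hy, hyΓ⟩ := mem_closure_iff.1 hcl _ hO hx
  exact hy.2 hyΓ

/-- Touching a viscosity supersolution, once corrected, is possible only off `Γ`, where the weight
is positive and the equation is uniformly elliptic. -/
theorem isApproxSuper_of_mem_SUpper (hlam : 0 < lam) (hLam : lam ≤ Lam) (ha : 0 < a)
    (hΓ : IsSmoothHypersurface Γ) (hne : Γ.Nonempty)
    (hO : IsOpen (ball (0 : EuclideanSpace ℝ (Fin d)) 1 \ Γ)) {p : ℝ} (hp : 1 ≤ p)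
    (hap : a * p < 1) {F u : EuclideanSpace ℝ (Fin d) → ℝ}
    (hF : ContinuousOn F (ball 0 1)) (hu : u ∈ SUpper p lam Lam (weight Γ a) F (ball 0 1)) :
    IsApproxSuper (Lam * d / lam) (ball 0 1 \ Γ)
      (fun x => (2 * lam)⁻¹ * (F x * (weight Γ a x)⁻¹)) (ball 0 (3 / 4)) u := by
  have ha1 : a < 1 := lt_of_le_of_lt (le_mul_of_one_le_right ha.le hp) hap
  have hsub : closedBall (0 : EuclideanSpace ℝ (Fin d)) (3 / 4) ⊆ ball 0 1 :=
    closedBall_subset_ball (by norm_num)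
  have hK : IsCompact (closedBall (0 : EuclideanSpace ℝ (Fin d)) (3 / 4) ∩ Γ) := by
    have h := (isCompact_closedBall (0 : EuclideanSpace ℝ (Fin d)) (3 / 4)).diff hO
    refine (congrArg IsCompact ?_).mp h
    ext x
    constructor
    · rintro ⟨h1, h2⟩
      exact ⟨h1, by_contra fun h3 => h2 ⟨hsub h1, h3⟩⟩
    · rintro ⟨h1, h2⟩
      exact ⟨h1, fun h3 => h3.2 h2⟩
  have hcorr := hasCorrections_of_isCompact hlam hLam ha ha1 hΓ hK inter_subset_right
  obtain ⟨C, hC⟩ := (isCompact_closedBall (0 : EuclideanSpace ℝ (Fin d))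
    (3 / 4)).exists_bound_of_continuousOn (hF.mono hsub)
  intro η hη
  obtain ⟨ψ, G, H, h1, h2, h3, h4⟩ := hcorr (C + 2) (min η (2 * lam * η)) (by positivity)
  refine ⟨ψ, fun x _ => (h1 x).trans (min_le_left _ _), ?_, ?_⟩
  · exact (hu.1.mono (ball_subset_closedBall.trans hsub)).sub
      ((h2 p univ hp hap).continuousOn.mono (subset_univ _))
  intro x hx q e e' c hc htouch
  have hx1 : x ∈ ball (0 : EuclideanSpace ℝ (Fin d)) 1 := hsub (ball_subset_closedBall hx)
  obtain ⟨G', hq⟩ := exists_isW2pLoc_quadratic (p := p) (U := ball 0 1) (u x - ψ x) x q e e' c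
  have hmin : IsLocalMin (fun z => u z - (ψ z + ((u x - ψ x) + inner ℝ q (z - x) +
      (inner ℝ e (z - x) ^ 2 + inner ℝ e' (z - x) ^ 2 - c * ‖z - x‖ ^ 2)))) x := by
    filter_upwards [htouch] with z hz
    simp only [sub_self, inner_zero_right, norm_zero]
    linarith
  have hess := hu.2 _ _ _ ((h2 p _ hp hap).add hq hp) x hx1 hmin
  set N : Matrix (Fin d) (Fin d) ℝ :=
    (2 : ℝ) • (Matrix.vecMulVec e e + Matrix.vecMulVec e' e' - c • 1) with hN
  set s : ℝ := 2 * lam * (‖e‖ ^ 2 + ‖e'‖ ^ 2) - 2 * (d * Lam * c) with hs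
  have hNs : ∀ A ∈ ellipticMatrices d lam Lam, s ≤ (A * N).trace := fun A hA =>
    le_trace_mul_quadratic hlam hA e e' hc
  -- On `Γ` the weight annihilates the Hessian of the polynomial, while the correction alone
  -- contributes at least `C + 2`, more than `F` can compensate.
  have hxΓ : x ∉ Γ := by
    intro hxΓ
    have hxb : ∀ᶠ y in 𝓝 x ⊓ ae volume, y ∈ ball (0 : EuclideanSpace ℝ (Fin d)) (3 / 4) :=
      Eventually.filter_mono inf_le_left (isOpen_ball.mem_nhds hx)
    refine absurd (le_zero_of_essLiminfAt_le (r := 1) hess ?_) (by norm_num)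
    filter_upwards [hxb, h4 x ⟨hxΓ, ball_subset_closedBall hx, hxΓ⟩,
      eventually_weight_mul_lt ha hxΓ (-s) one_pos] with y hy hyA hw
    have hFy := (le_abs_self _).trans (hC y (ball_subset_closedBall hy))
    have hinf : (C + 1) ≤ weight Γ a y * pucciInf lam Lam (H y + N) := by
      rcases (weight_nonneg (Γ := Γ) (a := a) y).eq_or_lt with h0 | h0
      · have := hyA _ (smul_one_mem_ellipticMatrices hLam)
        rw [← h0, zero_mul] at this ⊢
        linarith
      · rw [mul_comm, ← div_le_iff₀ h0]
        refine le_pucciInf hLam fun A hA => ?_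
        rw [div_le_iff₀ h0, mul_add, Matrix.trace_add, add_mul]
        have := mul_le_mul_of_nonneg_left (hNs A hA) h0.le
        linarith [hyA A hA]
    linarith
  have hxV : x ∈ ball (0 : EuclideanSpace ℝ (Fin d)) 1 \ Γ := ⟨hx1, hxΓ⟩
  refine ⟨hxV, ?_⟩
  have hwx : 0 < weight Γ a x := weight_pos hO hne hxV
  set t : ℝ := s - min η (2 * lam * η) with ht
  have hcont : Tendsto (fun y => weight Γ a y * t - F y) (𝓝 x) (𝓝 (weight Γ a x * t - F x)) :=
    (((continuous_weight ha).tendsto x).mul_const t).sub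
      (hF.continuousAt (isOpen_ball.mem_nhds hx1)).tendsto
  -- off `Γ` all data are continuous, so the essential lower limit gives the inequality at `x`
  have hle : weight Γ a x * t - F x ≤ 0 := by
    refine le_of_forall_lt fun r hr => ?_
    obtain ⟨r', hr1, hr2⟩ := exists_between hr
    refine hr1.trans_le (le_zero_of_essLiminfAt_le hess ?_)
    filter_upwards [(hcont.eventually_const_lt hr2).filter_mono inf_le_left,
      h3.filter_mono inf_le_right] with y hy hyA
    have hinf : t ≤ pucciInf lam Lam (H y + N) := by
      refine le_pucciInf hLam fun A hA => ?_
      rw [mul_add, Matrix.trace_add]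
      linarith [hyA A hA, hNs A hA]
    have := mul_le_mul_of_nonneg_left hinf (weight_nonneg (Γ := Γ) (a := a) y)
    linarith
  have hη' : min η (2 * lam * η) ≤ 2 * lam * η := min_le_right _ _
  have hts : t ≤ F x * (weight Γ a x)⁻¹ := by
    rw [← div_eq_mul_inv, le_div_iff₀ hwx]
    linarith
  have : ‖e‖ ^ 2 + ‖e'‖ ^ 2 = (2 * lam)⁻¹ * (2 * lam * (‖e‖ ^ 2 + ‖e'‖ ^ 2)) := by field_simp
  rw [this]
  have h5 : 2 * lam * (‖e‖ ^ 2 + ‖e'‖ ^ 2) ≤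
      2 * (d * Lam * c) + F x * (weight Γ a x)⁻¹ + 2 * lam * η := by linarith
  refine (mul_le_mul_of_nonneg_left h5 (by positivity)).trans (le_of_eq ?_)
  field_simp
  ring

end Reduction

end WeightedPucci

/-! ### Norms and the Hölder estimate for the weighted class -/

namespace WeightedPucci

section Norms

variable {d : ℕ}

/-- On an open set the essential supremum of a continuous function bounds all its values. -/
theorem enorm_le_eLpNorm_top {O : Set (EuclideanSpace ℝ (Fin d))} (hO : IsOpen O)
    {u : EuclideanSpace ℝ (Fin d) → ℝ} (hu : ContinuousOn u O) {x : EuclideanSpace ℝ (Fin d)}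
    (hx : x ∈ O) : ‖u x‖ₑ ≤ eLpNorm u ∞ (volume.restrict O) := by
  rw [eLpNorm_exponent_top]
  have hae := ae_le_eLpNormEssSup (f := u) (μ := volume.restrict O)
  rw [ae_restrict_iff' hO.measurableSet] at hae
  have hopen : IsOpen (O ∩ (fun y => ‖u y‖ₑ) ⁻¹' Ioi (eLpNormEssSup u (volume.restrict O))) :=
    hu.enorm.isOpen_inter_preimage hO isOpen_Ioi
  have hzero :
      volume (O ∩ (fun y => ‖u y‖ₑ) ⁻¹' Ioi (eLpNormEssSup u (volume.restrict O))) = 0 := by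
    refine measure_mono_null (fun y hy => ?_) hae
    exact fun h => absurd (h hy.1) (not_le.2 hy.2)
  by_contra hcon
  exact eq_empty_iff_forall_notMem.1 ((hopen.measure_eq_zero_iff volume).1 hzero) x
    ⟨hx, not_le.1 hcon⟩

theorem eLpNorm_natCast_pow (hd : 1 ≤ d) (h : EuclideanSpace ℝ (Fin d) → ℝ)
    (μ : Measure (EuclideanSpace ℝ (Fin d))) :
    eLpNorm h (d : ℝ≥0∞) μ ^ d = ∫⁻ x, ‖h x‖ₑ ^ d ∂μ := by
  have hd0 : (d : ℝ) ≠ 0 := by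
    have : d ≠ 0 := by omega
    exact_mod_cast this
  rw [eLpNorm_eq_lintegral_rpow_enorm_toReal (by simpa using (by omega : d ≠ 0)) (by simp),
    ENNReal.toReal_natCast, ← ENNReal.rpow_natCast, ← ENNReal.rpow_mul, one_div,
    inv_mul_cancel₀ hd0, ENNReal.rpow_one]
  simp only [ENNReal.rpow_natCast]

theorem holderNormOn_le {α S T : ℝ} (hα : 0 ≤ α) (hS : 0 ≤ S) (hT : 0 ≤ T)
    {u : EuclideanSpace ℝ (Fin d) → ℝ} {s : Set (EuclideanSpace ℝ (Fin d))}
    (huS : ∀ x ∈ s, |u x| ≤ S) (huT : ∀ x ∈ s, ∀ y ∈ s, |u x - u y| ≤ T * ‖x - y‖ ^ α) :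
    holderNormOn (NNReal.mk α hα) u s ≤ ENNReal.ofReal (S + T) := by
  rw [ENNReal.ofReal_add hS hT]
  refine add_le_add (iSup₂_le fun x hx => ?_) ?_
  · rw [← ofReal_norm]
    exact ENNReal.ofReal_le_ofReal (huS x hx)
  · have h : HolderWith T.toNNReal (NNReal.mk α hα) (s.domRestrict u) := by
      rintro ⟨x, hx⟩ ⟨y, hy⟩
      rw [Subtype.edist_eq, edist_dist, edist_dist, Real.dist_eq, dist_eq_norm,
        NNReal.coe_mk, ENNReal.ofReal_rpow_of_nonneg (norm_nonneg _) hα]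
      change _ ≤ ENNReal.ofReal T * _
      rw [← ENNReal.ofReal_mul hT]
      exact ENNReal.ofReal_le_ofReal (huT x hx y hy)
    exact h.eHolderNorm_le

end Norms

theorem DividesIntoTwo.isOpen_diff {d : ℕ} {Γ Ω O : Set (EuclideanSpace ℝ (Fin d))}
    (h : DividesIntoTwo Γ Ω) (hO : IsOpen O) (hOΩ : O ⊆ Ω) : IsOpen (O \ Γ) := by
  obtain ⟨V, W, hV, hW, -, -, -, hVW⟩ := h
  have : O \ Γ = O ∩ (V ∪ W) := by
    rw [hVW]
    ext x
    exact ⟨fun hx => ⟨hx.1, hOΩ hx.1, hx.2⟩, fun hx => ⟨hx.1, hx.2.2⟩⟩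
  rw [this]
  exact hO.inter (hV.union hW)

theorem DividesIntoTwo.nonempty {d : ℕ} {Γ Ω : Set (EuclideanSpace ℝ (Fin d))}
    (h : DividesIntoTwo Γ Ω) (hΩ : IsConnected Ω) : Γ.Nonempty := by
  obtain ⟨V, W, hV, hW, hVc, hWc, hdisj, hVW⟩ := h
  by_contra hne
  rw [not_nonempty_iff_eq_empty] at hne
  rw [hne, sdiff_empty] at hVW
  obtain ⟨v, hv⟩ := hVc.nonempty
  obtain ⟨w, hw⟩ := hWc.nonempty
  obtain ⟨z, -, hz⟩ := hΩ.isPreconnected V W hV hW hVW.ge ⟨v, hVW ▸ Or.inl hv, hv⟩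
    ⟨w, hVW ▸ Or.inr hw, hw⟩
  exact disjoint_left.1 hdisj hz.1 hz.2

end WeightedPucci

open WeightedPucci in
theorem proposition2p4 (d : ℕ) (hd : 1 ≤ d) (lam Lam : ℝ) (hlam : 0 < lam) (hLam : lam ≤ Lam)
    (a : ℝ) (ha : 0 < a) (Γ : Set (EuclideanSpace ℝ (Fin d)))
    (hΓ : WeightedPucci.IsSmoothHypersurface Γ) :
    ∃ (α : ℝ≥0) (C : ℝ), 0 < α ∧ α < 1 ∧ 0 < C ∧
      ∀ (Ω : Set (EuclideanSpace ℝ (Fin d))), IsOpen Ω → IsConnected Ω → Bornology.IsBounded Ω →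
        ball 0 1 ⊆ Ω → Γ ⊆ Ω → WeightedPucci.DividesIntoTwo Γ Ω →
      ∀ (f : EuclideanSpace ℝ (Fin d) → ℝ), ContinuousOn f (closure Ω) →
        MemLp (fun x => f x * (WeightedPucci.weight Γ a x)⁻¹) (d : ℝ≥0∞) (volume.restrict Ω) →
      ∀ (p : ℝ), 1 ≤ p → a * p < 1 →
      ∀ u ∈ WeightedPucci.SStar p lam Lam (WeightedPucci.weight Γ a) f (ball 0 1),
        WeightedPucci.holderNormOn α u (ball 0 (1 / 2)) < ∞ ∧
        WeightedPucci.holderNormOn α u (ball 0 (1 / 2)) ≤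
          ENNReal.ofReal C * (eLpNorm u ∞ (volume.restrict (ball 0 1)) +
            eLpNorm (fun x => f x * (WeightedPucci.weight Γ a x)⁻¹) (d : ℝ≥0∞)
              (volume.restrict (ball 0 1))) := by
  have hd' : (1 : ℝ) ≤ d := by exact_mod_cast hd
  have hθ : 1 ≤ Lam * d / lam := by
    rw [le_div_iff₀ hlam, one_mul]
    nlinarith
  obtain ⟨α, C, hα, hα1, hC, hest⟩ := exists_holder_estimate hd hθ
  have hμ : 0 < (2 * lam)⁻¹ := by positivity
  refine ⟨NNReal.mk α hα.le, 1 + C * (1 + (2 * lam)⁻¹), hα, hα1, by positivity, ?_⟩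
  intro Ω _ hΩc _ hBΩ _ hdiv f hf hfL p hp hap u hu
  have hO := hdiv.isOpen_diff (O := ball 0 1) isOpen_ball hBΩ
  have hne := hdiv.nonempty hΩc
  have hF : ContinuousOn (fun x => |f x|) (ball 0 1) :=
    (hf.mono (hBΩ.trans subset_closure)).abs
  have huc : ContinuousOn u (ball 0 1) := hu.1.1
  have hsub : ball (0 : EuclideanSpace ℝ (Fin d)) (3 / 4) ⊆ ball 0 1 :=
    ball_subset_ball (by norm_num)
  have hsub' : ball (0 : EuclideanSpace ℝ (Fin d)) (1 / 2) ⊆ ball 0 (3 / 4) :=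
    ball_subset_ball (by norm_num)
  set N := eLpNorm (fun x => f x * (weight Γ a x)⁻¹) (d : ℝ≥0∞) (volume.restrict (ball 0 1))
    with hN
  have hNtop : N ≠ ∞ := (hfL.mono_measure (Measure.restrict_mono hBΩ le_rfl)).2.ne
  set G : ℝ := (2 * lam)⁻¹ * N.toReal with hG
  have hG0 : 0 ≤ G := by positivity
  set g : EuclideanSpace ℝ (Fin d) → ℝ := fun x => (2 * lam)⁻¹ * (|f x| * (weight Γ a x)⁻¹) with hg
  have hgc : ContinuousOn g (ball 0 1 \ Γ) :=
    continuousOn_const.mul ((hF.mono sdiff_subset).mul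
      ((continuous_weight ha).continuousOn.inv₀ fun x hx => (weight_pos hO hne hx).ne'))
  have hg0 : ∀ x, 0 ≤ g x := fun x => by
    have := weight_nonneg (Γ := Γ) (a := a) x
    positivity
  have hgL : ∫⁻ x in ball (0 : EuclideanSpace ℝ (Fin d)) (3 / 4), ENNReal.ofReal (g x) ^ d ≤
      ENNReal.ofReal G ^ d := by
    have h1 : ∀ x, ENNReal.ofReal (g x) ^ d =
        ENNReal.ofReal (2 * lam)⁻¹ ^ d * ‖f x * (weight Γ a x)⁻¹‖ₑ ^ d := fun x => by
      rw [← mul_pow, ← ofReal_norm, ← ENNReal.ofReal_mul hμ.le, norm_mul,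
        Real.norm_eq_abs, Real.norm_of_nonneg (inv_nonneg.2 (weight_nonneg x))]
    calc _ ≤ ∫⁻ x in ball (0 : EuclideanSpace ℝ (Fin d)) 1, ENNReal.ofReal (g x) ^ d :=
          lintegral_mono_set hsub
      _ = ENNReal.ofReal (2 * lam)⁻¹ ^ d * N ^ d := by
          simp only [h1]
          rw [lintegral_const_mul' _ _ (ENNReal.pow_ne_top ENNReal.ofReal_ne_top), hN,
            eLpNorm_natCast_pow hd]
      _ = _ := by
          rw [hG, ENNReal.ofReal_mul hμ.le, ENNReal.ofReal_toReal hNtop, mul_pow]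
  have hsup := isApproxSuper_of_mem_SUpper hlam hLam ha hΓ hne hO hp hap hF hu.1
  have hsup' := isApproxSuper_of_mem_SUpper hlam hLam ha hΓ hne hO hp hap hF (neg_mem_SUpper hu.2)
  have key : ∀ S : ℝ, 0 ≤ S → (∀ x ∈ ball (0 : EuclideanSpace ℝ (Fin d)) (3 / 4), |u x| ≤ S) →
      holderNormOn (NNReal.mk α hα.le) u (ball 0 (1 / 2)) ≤ ENNReal.ofReal (S + C * (S + G)) :=
    fun S hS huS => holderNormOn_le hα.le hS (by positivity) (fun x hx => huS x (hsub' hx))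
      (hest _ g u hO hgc hg0 hsup hsup' S G hS hG0 huS hgL)
  constructor
  · -- the interior ball gives a finite bound even if `u` is unbounded near the unit sphere
    obtain ⟨S, hS⟩ := (isCompact_closedBall (0 : EuclideanSpace ℝ (Fin d))
      (3 / 4)).exists_bound_of_continuousOn (huc.mono (closedBall_subset_ball (by norm_num)))
    exact (key (max S 0) (le_max_right _ _) fun x hx =>
      (hS x (ball_subset_closedBall hx)).trans (le_max_left _ _)).trans_lt ENNReal.ofReal_lt_top
  · set S := eLpNorm u ∞ (volume.restrict (ball 0 1)) with hS
    have hC' : 0 < 1 + C * (1 + (2 * lam)⁻¹) := by positivity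
    rcases eq_or_ne S ∞ with hStop | hStop
    · rw [hStop, top_add, ENNReal.mul_top (by simpa using hC')]
      exact le_top
    · refine (key S.toReal ENNReal.toReal_nonneg fun x hx => ?_).trans ?_
      · have h := enorm_le_eLpNorm_top isOpen_ball huc (hsub hx)
        rwa [← ofReal_norm, ENNReal.ofReal_le_iff_le_toReal hStop] at h
      · rw [← ENNReal.ofReal_toReal hStop, ← ENNReal.ofReal_toReal hNtop,
          ← ENNReal.ofReal_add ENNReal.toReal_nonneg ENNReal.toReal_nonneg,
          ← ENNReal.ofReal_mul hC'.le, ENNReal.toReal_ofReal ENNReal.toReal_nonneg]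
        refine ENNReal.ofReal_le_ofReal ?_
        have h1 : 0 ≤ S.toReal := ENNReal.toReal_nonneg
        have h2 : 0 ≤ N.toReal := ENNReal.toReal_nonneg
        have h3 : 0 ≤ C * (2 * lam)⁻¹ * S.toReal := by positivity
        have h4 : 0 ≤ C * N.toReal := by positivity
        rw [hG]
        linarith
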